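/- Let $I\subseteq\mathbb R$ be an open interval, $(M^*,g^*)$ a smooth Riemannian manifold of dimension $n-1\ge 3$, and $a:I\to(0,\infty)$ smooth. Let $(M,g)$ be the generalized Robertson–Walker (GRW) space-time of dimension $n>3$ given by $M=I\times M^*$, $g=-dt^2+a(t)^2g^*$, and let $u=\partial_t$ be its comoving unit time-like vector field. Denote by $R_{kl}$ the Ricci tensor, by $C_{jklm}$ the Weyl tensor, and put $C_{kl}=u^ju^mC_{jklm}$. The space-time is called a perfect fluid if $R_{kl}=A\,g_{kl}+B\,v_kv_l$ for some smooth scalar fields $A,B$ and some smooth vector field $v$ with $v^jv_j=-1$. Theorem. The GRW space-time is a perfect fluid if and only if $C_{kl}=0$, and if and only if $u^mC_{jklm}=0$. If it is a perfect fluid, then $\nabla^mC_{jklm}=0$ and $u^j\nabla^mC_{jklm}=0$. If moreover the warping function $a$ is not constant (i.e. the space-time is not a direct product), then each of the conditions $\nabla^mC_{jklm}=0$ and $u^j\nabla^mC_{jklm}=0$ is also equivalent to the space-time being a perfect fluid. -/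

import Mathlib

open scoped Manifold ContDiff Topology Bundle

noncomputable section

/-! ### Tensor calculus in coordinates

`E` is the coordinate space, `b` a basis of `E` (so the coordinates of `y : E` are `b.repr y i`) and
`G : E → Matrix ι ι ℝ` the matrix of components `g_{ij}` of a metric as a function of the
coordinates. All formulas use the Levi-Civita connection of `g`. -/

namespace Coord

variable {ι : Type*} [Fintype ι] [DecidableEq ι]
  {E : Type*} [NormedAddCommGroup E] [NormedSpace ℝ E]

/-- The partial derivative `∂_i f` at `y`. -/
def pd (b : Module.Basis ι ℝ E) (f : E → ℝ) (i : ι) (y : E) : ℝ :=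
  fderiv ℝ f y (b i)

/-- Christoffel symbols `Γ^k_{ij} = (1/2) g^{kl} (∂_i g_{jl} + ∂_j g_{il} - ∂_l g_{ij})`;
the argument order is `christoffel b G k i j y`. -/
def christoffel (b : Module.Basis ι ℝ E) (G : E → Matrix ι ι ℝ) (k i j : ι) (y : E) : ℝ :=
  (1 / 2) * ∑ l, (G y)⁻¹ k l *
    (pd b (fun z => G z j l) i y + pd b (fun z => G z i l) j y - pd b (fun z => G z i j) l y)

/-- The curvature tensor `R_{jkl}{}^m`, with the sign for which
`(∇_j ∇_k - ∇_k ∇_j) X_l = R_{jkl}{}^m X_m`. -/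
def riemannUp (b : Module.Basis ι ℝ E) (G : E → Matrix ι ι ℝ) (j k l m : ι) (y : E) : ℝ :=
  pd b (christoffel b G m j l) k y - pd b (christoffel b G m k l) j y
    + ∑ p, (christoffel b G m k p y * christoffel b G p j l y
        - christoffel b G m j p y * christoffel b G p k l y)

/-- `R_{jklm} = R_{jkl}{}^p g_{pm}`. -/
def riemann (b : Module.Basis ι ℝ E) (G : E → Matrix ι ι ℝ) (j k l m : ι) (y : E) : ℝ :=
  ∑ p, riemannUp b G j k l p y * G y p m

/-- The Ricci tensor `R_{kl} = - R_{mkl}{}^m` (positive on round spheres). -/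
def ricci (b : Module.Basis ι ℝ E) (G : E → Matrix ι ι ℝ) (k l : ι) (y : E) : ℝ :=
  - ∑ m, riemannUp b G m k l m y

/-- The scalar curvature `R = g^{kl} R_{kl}`. -/
def scalar (b : Module.Basis ι ℝ E) (G : E → Matrix ι ι ℝ) (y : E) : ℝ :=
  ∑ k, ∑ l, (G y)⁻¹ k l * ricci b G k l y

/-- The Weyl tensor `C_{jklm}`; `n` is the dimension. -/
def weyl (b : Module.Basis ι ℝ E) (G : E → Matrix ι ι ℝ) (j k l m : ι) (y : E) : ℝ :=
  let n : ℝ := Fintype.card ι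
  riemann b G j k l m y
    + 1 / (n - 2) * (G y j m * ricci b G k l y - G y k m * ricci b G j l y
        + ricci b G j m y * G y k l - ricci b G k m y * G y j l)
    - scalar b G y / ((n - 1) * (n - 2)) * (G y j m * G y k l - G y k m * G y j l)

/-- The covariant derivative `∇_p T_{jklm}` of a covariant tensor field of rank four. -/
def cov4 (b : Module.Basis ι ℝ E) (G : E → Matrix ι ι ℝ) (T : ι → ι → ι → ι → E → ℝ)
    (p j k l m : ι) (y : E) : ℝ :=
  pd b (T j k l m) p y
    - ∑ q, (christoffel b G q p j y * T q k l m y + christoffel b G q p k y * T j q l m y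
        + christoffel b G q p l y * T j k q m y + christoffel b G q p m y * T j k l q y)

/-- The divergence `∇^m C_{jklm} = g^{mp} ∇_p C_{jklm}` of the Weyl tensor. -/
def divWeyl (b : Module.Basis ι ℝ E) (G : E → Matrix ι ι ℝ) (j k l : ι) (y : E) : ℝ :=
  ∑ m, ∑ p, (G y)⁻¹ m p * cov4 b G (weyl b G) p j k l m y

end Coord

/-! ### Metrics and vector fields on a manifold, read in a chart -/

section Manifold

variable {ι : Type*} [Fintype ι] [DecidableEq ι]
  {E : Type*} [NormedAddCommGroup E] [NormedSpace ℝ E]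
  {H : Type*} [TopologicalSpace H] (J : ModelWithCorners ℝ E H)
  {M : Type*} [TopologicalSpace M] [ChartedSpace H M]

/-- The coordinate vector field `∂_i` of the chart `e`, at the point with coordinates `y`. -/
def coordVec (b : Module.Basis ι ℝ E) (e : OpenPartialHomeomorph M H) (i : ι) (y : E) :
    TangentSpace J ((e.extend J).symm y) :=
  mfderiv 𝓘(ℝ, E) J (e.extend J).symm y (b i)

/-- The components `g_{ij} = g(∂_i, ∂_j)` of `g` in the chart `e`. -/
def metricComp (b : Module.Basis ι ℝ E)
    (g : ∀ p : M, TangentSpace J p → TangentSpace J p → ℝ)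
    (e : OpenPartialHomeomorph M H) (y : E) : Matrix ι ι ℝ :=
  Matrix.of fun i j => g ((e.extend J).symm y) (coordVec J b e i y) (coordVec J b e j y)

/-- The components `v^i` of the vector field `v` in the chart `e`. -/
def vecComp (b : Module.Basis ι ℝ E) (v : ∀ p : M, TangentSpace J p)
    (e : OpenPartialHomeomorph M H) (i : ι) (y : E) : ℝ :=
  b.repr (mfderiv J 𝓘(ℝ, E) (e.extend J) ((e.extend J).symm y) (v ((e.extend J).symm y))) i

/-- The components `v_k = g_{ki} v^i` of the vector field `v` with lowered index. -/
def covecComp (b : Module.Basis ι ℝ E)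
    (g : ∀ p : M, TangentSpace J p → TangentSpace J p → ℝ) (v : ∀ p : M, TangentSpace J p)
    (e : OpenPartialHomeomorph M H) (k : ι) (y : E) : ℝ :=
  ∑ i, metricComp J b g e y k i * vecComp J b v e i y

/-- `(M, g)` is a perfect fluid: `R_{kl} = A g_{kl} + B v_k v_l` with smooth scalar fields `A`, `B`
and a smooth vector field `v` with `v^j v_j = -1`. -/
def IsPerfectFluid [IsManifold J 1 M] (b : Module.Basis ι ℝ E)
    (g : ∀ p : M, TangentSpace J p → TangentSpace J p → ℝ) : Prop :=
  ∃ (A B : M → ℝ) (v : ∀ p : M, TangentSpace J p),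
    ContMDiff J 𝓘(ℝ, ℝ) ∞ A ∧ ContMDiff J 𝓘(ℝ, ℝ) ∞ B ∧
    ContMDiff J J.tangent ∞ (fun p : M => (⟨p, v p⟩ : TangentBundle J M)) ∧
    (∀ p, g p (v p) (v p) = -1) ∧
    ∀ e ∈ atlas H M, ∀ y ∈ (e.extend J).target, ∀ k l : ι,
      Coord.ricci b (metricComp J b g e) k l y =
        A ((e.extend J).symm y) * metricComp J b g e y k l
          + B ((e.extend J).symm y) * (covecComp J b g v e k y * covecComp J b g v e l y)

/-- `∇^m C_{jklm} = 0`. -/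
def DivWeylZero (b : Module.Basis ι ℝ E)
    (g : ∀ p : M, TangentSpace J p → TangentSpace J p → ℝ) : Prop :=
  ∀ e ∈ atlas H M, ∀ y ∈ (e.extend J).target, ∀ j k l : ι,
    Coord.divWeyl b (metricComp J b g e) j k l y = 0

/-- `u^m C_{jklm} = 0`. -/
def WeylContractZero (b : Module.Basis ι ℝ E)
    (g : ∀ p : M, TangentSpace J p → TangentSpace J p → ℝ) (u : ∀ p : M, TangentSpace J p) :
    Prop :=
  ∀ e ∈ atlas H M, ∀ y ∈ (e.extend J).target, ∀ j k l : ι,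
    ∑ m, vecComp J b u e m y * Coord.weyl b (metricComp J b g e) j k l m y = 0

/-- `C_{kl} = u^j u^m C_{jklm} = 0`. -/
def ContractedWeylZero (b : Module.Basis ι ℝ E)
    (g : ∀ p : M, TangentSpace J p → TangentSpace J p → ℝ) (u : ∀ p : M, TangentSpace J p) :
    Prop :=
  ∀ e ∈ atlas H M, ∀ y ∈ (e.extend J).target, ∀ k l : ι,
    ∑ j, ∑ m, vecComp J b u e j y * vecComp J b u e m y *
      Coord.weyl b (metricComp J b g e) j k l m y = 0

/-- `u^j ∇^m C_{jklm} = 0`. -/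
def DivWeylContractZero (b : Module.Basis ι ℝ E)
    (g : ∀ p : M, TangentSpace J p → TangentSpace J p → ℝ) (u : ∀ p : M, TangentSpace J p) :
    Prop :=
  ∀ e ∈ atlas H M, ∀ y ∈ (e.extend J).target, ∀ k l : ι,
    ∑ j, vecComp J b u e j y * Coord.divWeyl b (metricComp J b g e) j k l y = 0

end Manifold

/-! ### Generalized Robertson-Walker space-times -/

namespace GRW

variable {m : ℕ} (I : TopologicalSpace.Opens ℝ)
  (N : Type*) [TopologicalSpace N] [ChartedSpace (EuclideanSpace ℝ (Fin m)) N]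

/-- The model with corners of the product `I × N`; its coordinate space is `ℝ × ℝ^m`. -/
abbrev model (m : ℕ) :
    ModelWithCorners ℝ (ℝ × EuclideanSpace ℝ (Fin m)) (ModelProd ℝ (EuclideanSpace ℝ (Fin m))) :=
  𝓘(ℝ, ℝ).prod (𝓡 m)

/-- The standard basis of `ℝ × ℝ^m`. -/
def basis (m : ℕ) : Module.Basis (Unit ⊕ Fin m) ℝ (ℝ × EuclideanSpace ℝ (Fin m)) :=
  (Module.Basis.singleton Unit ℝ).prod (EuclideanSpace.basisFun (Fin m) ℝ).toBasis

variable {I N}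

/-- The differential `dt` of the time coordinate `(t, x) ↦ t` on `I × N`. -/
def dt (p : I × N) (X : TangentSpace (model m) p) : ℝ :=
  mfderiv (model m) 𝓘(ℝ, ℝ) (fun q : I × N => (q.1 : ℝ)) p X

/-- The differential of the projection `(t, x) ↦ x` on `I × N`. -/
def spatial (p : I × N) (X : TangentSpace (model m) p) : TangentSpace (𝓡 m) p.2 :=
  mfderiv (model m) (𝓡 m) (Prod.snd : I × N → N) p X

/-- The comoving velocity `u = ∂/∂t`, as an element of `T_{(t,x)}(I × N) = ℝ × T_x N`. -/
def velocity (p : I × N) : TangentSpace (model m) p :=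
  ((1 : ℝ), (0 : EuclideanSpace ℝ (Fin m)))

theorem hasMFDerivAt_val (t : I) :
    HasMFDerivAt 𝓘(ℝ, ℝ) 𝓘(ℝ, ℝ) (fun s : I => (s : ℝ)) t (ContinuousLinearMap.id ℝ ℝ) := by
  refine ⟨continuous_subtype_val.continuousAt, ?_⟩
  apply HasFDerivAt.hasFDerivWithinAt
  refine (hasFDerivAt_id _).congr_of_eventuallyEq ?_
  have := TopologicalSpace.Opens.chartAt_subtype_val_symm_eventuallyEq (H := ℝ) I (x := t)
  simp only [mfld_simps] at this ⊢
  exact this.mono fun y hy => hy.symm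

theorem dt_apply (p : I × N) (X : TangentSpace (model m) p) :
    dt p X = (show ℝ × EuclideanSpace ℝ (Fin m) from X).1 := by
  have h := (hasMFDerivAt_val p.1).comp p
    (hasMFDerivAt_fst (I := 𝓘(ℝ, ℝ)) (I' := 𝓡 m) (x := p))
  unfold dt
  erw [h.mfderiv]
  rfl

theorem spatial_apply (p : I × N) (X : TangentSpace (model m) p) :
    spatial p X = (show ℝ × EuclideanSpace ℝ (Fin m) from X).2 := by
  unfold spatial
  rw [mfderiv_snd]
  rfl

section metric

variable [IsManifold (𝓡 m) ∞ N]

/-- The warped product metric `-dt² + a(t)² h` on `I × N`. -/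
def metric (a : ℝ → ℝ)
    (h : Bundle.ContMDiffRiemannianMetric (𝓡 m) ∞ (EuclideanSpace ℝ (Fin m))
      (fun x : N => TangentSpace (𝓡 m) x))
    (p : I × N) (X Y : TangentSpace (model m) p) : ℝ :=
  -(dt p X * dt p Y) + a p.1 ^ 2 * h.inner p.2 (spatial p X) (spatial p Y)

theorem metric_velocity (a : ℝ → ℝ)
    (h : Bundle.ContMDiffRiemannianMetric (𝓡 m) ∞ (EuclideanSpace ℝ (Fin m))
      (fun x : N => TangentSpace (𝓡 m) x)) (p : I × N) :
    metric a h p (velocity p) (velocity p) = -1 := by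
  rw [metric, dt_apply, spatial_apply]
  have h0 : h.inner p.2 (0 : EuclideanSpace ℝ (Fin m)) = 0 := (h.inner p.2).map_zero
  have h1 : h.inner p.2 (0 : EuclideanSpace ℝ (Fin m)) (0 : EuclideanSpace ℝ (Fin m)) = 0 := by
    rw [h0]; rfl
  simp [velocity, h1]

end metric

end GRW

end

/-!
The conditions are all compared with one on the fibre, `GRW.FibreEinstein`: the fibre `(N, h)` is
Einstein, i.e. the trace-free part `E` of its Ricci tensor vanishes. Write `m` for the dimension of
the fibre and `0` for the time index. In a product chart the warped metric is block diagonal with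
blocks `-1` and `a² h`, and its curvature is explicit in terms of that of `h`:

* `R_{00} = -m a''/a`, `R_{0i} = 0`, and `R_{ij}` is the Ricci tensor of `h` plus
  `(a a'' + (m - 1) a'²) h_{ij}`;
* the electric part of the Weyl tensor is `C_{0ij0} = -E_{ij} / (m - 1)`, its magnetic part
  vanishes, and its purely spatial part is `a²` times a tensor built from `h` alone;
* `∇^p C_{0ijp} = (m - 2) (a'/a) E_{ij} / (m - 1)`.

If the space-time is a perfect fluid, then `B v_0 v_i = R_{0i} = 0`, while `v_0 ≠ 0` because `v` is
time-like; so `R_{ij}` is a multiple of the metric and the fibre is Einstein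
(`GRW.fibreEinstein_of_isPerfectFluid`). Conversely, over an Einstein fibre the velocity `∂/∂t` and
explicit `A`, `B` exhibit a perfect fluid (`GRW.isPerfectFluid_of_fibreEinstein`); these are smooth
because the scalar curvature of the fibre is a smooth function that does not depend on the chart.
The formula for `C_{0ij0}` turns `C_{kl} = 0` into `E = 0`, and if `E = 0` only the purely spatial
components of the Weyl tensor survive, so `u^p C_{jklp} = 0`. They are divergence-free by Schur's
lemma and the contracted Bianchi identity, which gives `∇^p C_{jklp} = 0`. Finally, if `a` is not
constant, then `a' ≠ 0` at some time, and the formula for `∇^p C_{0ijp}` at that time gives `E = 0`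
from `u^j ∇^p C_{jklp} = 0`.

The tensor calculus is carried out over an arbitrary commutative `ℝ`-algebra with commuting
derivations: there the Bianchi identities, Schur's lemma and the curvature of a warped product are
algebraic identities, with no differentiability side conditions. Coordinate formulas are transported
to the algebra `SmoothFun U` of smooth functions on an open set, with its directional derivatives,
by the relations `Reads` and `IsFrame`.
-/

set_option linter.unusedSectionVars false

noncomputable section

/-! ### Tensor calculus over a ring with commuting derivations -/

namespace DiffRing

open Matrix

variable {A : Type*} [CommRing A] [Algebra ℝ A] {ι : Type*} [Fintype ι] [DecidableEq ι]

theorem map_derivation_mul {m n o : Type*} [Fintype n] (d : Derivation ℝ A A) (M : Matrix m n A)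
    (N : Matrix n o A) : (M * N).map d = M.map d * N + M * N.map d := by
  ext i j
  simp only [map_apply, mul_apply, map_sum, Derivation.leibniz, smul_eq_mul, Matrix.add_apply]
  rw [← Finset.sum_add_distrib]
  exact Finset.sum_congr rfl fun _ _ => by ring

theorem map_derivation_add {m n : Type*} (d : Derivation ℝ A A) (M N : Matrix m n A) :
    (M + N).map d = M.map d + N.map d := by
  ext i j; simp

theorem map_derivation_sub {m n : Type*} (d : Derivation ℝ A A) (M N : Matrix m n A) :
    (M - N).map d = M.map d - N.map d := by
  ext i j; simp

theorem map_derivation_transpose {m n : Type*} (d : Derivation ℝ A A) (M : Matrix m n A) :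
    Mᵀ.map d = (M.map d)ᵀ := rfl

theorem map_derivation_one (d : Derivation ℝ A A) : (1 : Matrix ι ι A).map d = 0 := by
  ext i j
  by_cases h : i = j <;> simp [h]

/-- The Christoffel symbols of the metric `g` with inverse `gi`; the entry `(k, j)` of the
matrix with index `i` is `Γ^k_{ij}`. -/
def levi (D : ι → Derivation ℝ A A) (g gi : Matrix ι ι A) (i : ι) : Matrix ι ι A :=
  Matrix.of fun k j => (1 / 2 : ℝ) • ∑ l, gi k l * (D i (g j l) + D j (g i l) - D l (g i j))

/-- The curvature `D_i Γ_j - D_j Γ_i + [Γ_i, Γ_j]` of a connection, as an endomorphism. -/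
def curv (D : ι → Derivation ℝ A A) (Γ : ι → Matrix ι ι A) (i j : ι) : Matrix ι ι A :=
  (Γ j).map (D i) - (Γ i).map (D j) + Γ i * Γ j - Γ j * Γ i

/-- The Ricci tensor of a connection. -/
def ric (D : ι → Derivation ℝ A A) (Γ : ι → Matrix ι ι A) (k l : ι) : A :=
  -∑ m, curv D Γ k m m l

/-- The scalar curvature of a connection with respect to the inverse metric `gi`. -/
def scal (D : ι → Derivation ℝ A A) (Γ : ι → Matrix ι ι A) (gi : Matrix ι ι A) : A :=
  ∑ k, ∑ l, gi k l * ric D Γ k l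

/-- The curvature tensor `R_{jklm}` with all indices lowered. -/
def riem (D : ι → Derivation ℝ A A) (Γ : ι → Matrix ι ι A) (g : Matrix ι ι A) (j k l m : ι) : A :=
  ∑ p, curv D Γ k j p l * g p m

/-- The Weyl tensor `C_{jklm}` in dimension `n`. -/
def weyl (n : ℝ) (D : ι → Derivation ℝ A A) (Γ : ι → Matrix ι ι A) (g gi : Matrix ι ι A)
    (j k l m : ι) : A :=
  riem D Γ g j k l m
    + (1 / (n - 2)) • (g j m * ric D Γ k l - g k m * ric D Γ j l
        + ric D Γ j m * g k l - ric D Γ k m * g j l)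
    - (1 / ((n - 1) * (n - 2))) • (scal D Γ gi * (g j m * g k l - g k m * g j l))

/-- The covariant derivative of a covariant tensor of rank four. -/
def cov4 (D : ι → Derivation ℝ A A) (Γ : ι → Matrix ι ι A) (T : ι → ι → ι → ι → A)
    (p j k l m : ι) : A :=
  D p (T j k l m) - ∑ q, (Γ p q j * T q k l m + Γ p q k * T j q l m
    + Γ p q l * T j k q m + Γ p q m * T j k l q)

/-- The divergence in the last index of a covariant tensor of rank four. -/
def div4 (D : ι → Derivation ℝ A A) (Γ : ι → Matrix ι ι A) (gi : Matrix ι ι A)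
    (T : ι → ι → ι → ι → A) (j k l : ι) : A :=
  ∑ m, ∑ p, gi m p * cov4 D Γ T p j k l m

/-- `Γ` is torsion-free and compatible with the metric `g`. -/
structure IsLeviCivita (D : ι → Derivation ℝ A A) (g : Matrix ι ι A) (Γ : ι → Matrix ι ι A) :
    Prop where
  symm : ∀ i j k, Γ i k j = Γ j k i
  compat : ∀ i, g.map (D i) = (Γ i)ᵀ * g + g * Γ i

variable {D : ι → Derivation ℝ A A} {g gi : Matrix ι ι A} {Γ : ι → Matrix ι ι A}

theorem IsLeviCivita.compat_apply (h : IsLeviCivita D g Γ) (i j k : ι) :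
    D i (g j k) = ∑ p, Γ i p j * g p k + ∑ p, g j p * Γ i p k := by
  have := congrFun (congrFun (h.compat i) j) k
  simpa [mul_apply] using this

/-- The Koszul formula: a torsion-free metric connection is given by the Christoffel symbols. -/
theorem IsLeviCivita.levi_eq (hg : gᵀ = g) (hgi : gi * g = 1) (h : IsLeviCivita D g Γ) (i : ι) :
    levi D g gi i = Γ i := by
  have hs : ∀ i j, g i j = g j i := fun i j => congrFun (congrFun hg j) i
  ext k j
  have h1 : ∀ l, D i (g j l) + D j (g i l) - D l (g i j) = (2 : ℝ) • ∑ p, g l p * Γ i p j := by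
    intro l
    rw [h.compat_apply, h.compat_apply, h.compat_apply, two_smul]
    simp only [← Finset.sum_add_distrib, ← Finset.sum_sub_distrib]
    refine Finset.sum_congr rfl fun p _ => ?_
    rw [h.symm j i p, h.symm i l p, h.symm j l p, hs p l, hs j p]
    ring
  have h2 : ∑ l, gi k l * ∑ p, g l p * Γ i p j = Γ i k j := by
    have := congrFun (congrFun (mul_assoc gi g (Γ i)) k) j
    rw [hgi, one_mul] at this
    rw [this]
    simp [mul_apply]
  simp only [levi, of_apply, h1, mul_smul_comm, ← Finset.smul_sum, h2, smul_smul]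
  norm_num

/-- The Christoffel symbols with the upper index lowered. -/
theorem levi_lower (hgi : gi * g = 1) (i j l : ι) :
    ∑ p, g l p * levi D g gi i p j
      = (1 / 2 : ℝ) • (D i (g j l) + D j (g i l) - D l (g i j)) := by
  have hgi' : g * gi = 1 := mul_eq_one_comm.mp hgi
  set v : ι → A := fun l => D i (g j l) + D j (g i l) - D l (g i j) with hv
  have h1 : ∀ p, levi D g gi i p j = (1 / 2 : ℝ) • (gi *ᵥ v) p := fun p => by
    simp [levi, mulVec, dotProduct, hv]
  have h2 : (g *ᵥ (gi *ᵥ v)) l = v l := by rw [mulVec_mulVec, hgi', one_mulVec]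
  simp only [h1, mul_smul_comm, ← Finset.smul_sum]
  exact congrArg _ h2

theorem isLeviCivita_levi (hg : gᵀ = g) (hgi : gi * g = 1) :
    IsLeviCivita D g (levi D g gi) := by
  have hs : ∀ i j, g i j = g j i := fun i j => congrFun (congrFun hg j) i
  refine ⟨fun i j k => ?_, fun i => ?_⟩
  · simp only [levi, of_apply]
    congr 1
    refine Finset.sum_congr rfl fun l _ => ?_
    rw [hs j i]
    ring
  · ext j l
    have h1 : ((levi D g gi i)ᵀ * g) j l = ∑ p, g l p * levi D g gi i p j := by
      simp only [mul_apply, transpose_apply]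
      exact Finset.sum_congr rfl fun p _ => by rw [hs l p, mul_comm]
    have h2 : (g * levi D g gi i) j l = ∑ p, g j p * levi D g gi i p l := by
      simp only [mul_apply]
    rw [Matrix.add_apply, h1, h2, levi_lower hgi, levi_lower hgi, ← smul_add, map_apply,
      hs l j, hs i l, hs i j]
    have : D i (g j l) + D j (g l i) - D l (g j i) + (D i (g j l) + D l (g j i) - D j (g l i))
      = (2 : ℝ) • D i (g j l) := by rw [two_smul]; ring
    rw [this, smul_smul]
    norm_num

theorem curv_antisymm (i j : ι) : curv D Γ j i = -curv D Γ i j := by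
  simp only [curv]; abel

theorem curv_self (i : ι) : curv D Γ i i = 0 := by
  simp [curv]

/-- The Jacobi identity `[D_i, D_j] = 0` applied to the entries of a matrix. -/
theorem map_derivation_comm (hD : ∀ i j x, D i (D j x) = D j (D i x)) (i j : ι)
    (M : Matrix ι ι A) : (M.map (D i)).map (D j) = (M.map (D j)).map (D i) := by
  ext a b; exact hD j i _

/-- The curvature of a metric connection is skew-adjoint. -/
theorem IsLeviCivita.curv_skew (hD : ∀ i j x, D i (D j x) = D j (D i x))
    (h : IsLeviCivita D g Γ) (i j : ι) : (curv D Γ i j)ᵀ * g + g * curv D Γ i j = 0 := by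
  have h1 := map_derivation_comm hD i j g
  rw [h.compat i, h.compat j] at h1
  simp only [map_derivation_add, map_derivation_mul, map_derivation_transpose, h.compat] at h1
  simp only [curv, transpose_add, transpose_sub, transpose_mul]
  rw [← sub_eq_zero] at h1
  rw [← neg_eq_zero, ← h1]
  noncomm_ring

/-- The covariant derivative of the curvature, as an endomorphism: the index `p` is the direction
of differentiation. -/
def covCurv (D : ι → Derivation ℝ A A) (Γ : ι → Matrix ι ι A) (p j k : ι) : Matrix ι ι A :=
  (curv D Γ k j).map (D p) + Γ p * curv D Γ k j - curv D Γ k j * Γ p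
    - ∑ q, (Γ p q j • curv D Γ k q + Γ p q k • curv D Γ q j)

theorem covCurv_antisymm (p j k : ι) : covCurv D Γ p k j = -covCurv D Γ p j k := by
  have h1 : ∀ M : Matrix ι ι A, (-M).map (D p) = -M.map (D p) := fun M => by ext; simp
  have h2 : ∑ q, (Γ p q k • curv D Γ j q + Γ p q j • curv D Γ q k)
      = -∑ q, (Γ p q j • curv D Γ k q + Γ p q k • curv D Γ q j) := by
    rw [← Finset.sum_neg_distrib]
    refine Finset.sum_congr rfl fun q _ => ?_
    rw [curv_antisymm q j, curv_antisymm k q, smul_neg, smul_neg]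
    abel
  rw [covCurv, covCurv, h2, curv_antisymm k j, h1]
  noncomm_ring

/-- The second Bianchi identity for a torsion-free connection. -/
theorem bianchi (hD : ∀ i j x, D i (D j x) = D j (D i x)) (hΓ : ∀ i j k, Γ i k j = Γ j k i)
    (p j k : ι) : covCurv D Γ p j k + covCurv D Γ j k p + covCurv D Γ k p j = 0 := by
  have hsum : ∑ q, (Γ p q j • curv D Γ k q + Γ p q k • curv D Γ q j)
      + ∑ q, (Γ j q k • curv D Γ p q + Γ j q p • curv D Γ q k)
      + ∑ q, (Γ k q p • curv D Γ j q + Γ k q j • curv D Γ q p) = 0 := by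
    rw [← Finset.sum_add_distrib, ← Finset.sum_add_distrib]
    refine Finset.sum_eq_zero fun q _ => ?_
    rw [hΓ j k q, hΓ j p q, hΓ k p q, curv_antisymm k q, curv_antisymm j q, curv_antisymm p q]
    simp only [smul_neg]
    abel
  have hdiff : ((curv D Γ k j).map (D p) + Γ p * curv D Γ k j - curv D Γ k j * Γ p)
      + ((curv D Γ p k).map (D j) + Γ j * curv D Γ p k - curv D Γ p k * Γ j)
      + ((curv D Γ j p).map (D k) + Γ k * curv D Γ j p - curv D Γ j p * Γ k) = 0 := by
    simp only [curv, map_derivation_add, map_derivation_mul, map_derivation_sub]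
    rw [map_derivation_comm hD p k, map_derivation_comm hD p j, map_derivation_comm hD k j]
    noncomm_ring
  have e : ∀ a b c x y z : Matrix ι ι A, a + b + c = 0 → x + y + z = 0 →
      (a - x) + (b - y) + (c - z) = 0 := by
    intro a b c x y z h1 h2
    rw [show (a - x) + (b - y) + (c - z) = (a + b + c) - (x + y + z) by abel, h1, h2, sub_zero]
  exact e _ _ _ _ _ _ hdiff hsum

/-- The covariant derivative of a covariant tensor of rank two. -/
def cov2 (D : ι → Derivation ℝ A A) (Γ : ι → Matrix ι ι A) (T : ι → ι → A) (p k l : ι) : A :=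
  D p (T k l) - ∑ q, (Γ p q k * T q l + Γ p q l * T k q)

/-- Contraction commutes with covariant differentiation: `∇_p R_{mjl}{}^m = -∇_p R_{jl}`. -/
theorem sum_covCurv (p j l : ι) :
    ∑ m, covCurv D Γ p m j m l = -cov2 D Γ (ric D Γ) p j l := by
  have h1 : ∑ m, (Γ p * curv D Γ j m) m l = ∑ m, ∑ q, Γ p q m * curv D Γ j q m l := by
    rw [Finset.sum_comm]
    simp only [mul_apply]
  have h2 : ∑ m, (curv D Γ j m * Γ p) m l = -∑ q, Γ p q l * ric D Γ j q := by
    simp only [mul_apply, ric, mul_neg, Finset.sum_neg_distrib, neg_neg, Finset.mul_sum]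
    rw [Finset.sum_comm]
    exact Finset.sum_congr rfl fun _ _ => Finset.sum_congr rfl fun _ _ => mul_comm _ _
  have h3 : ∑ m, ∑ q, Γ p q j * curv D Γ q m m l = -∑ q, Γ p q j * ric D Γ q l := by
    simp only [ric, mul_neg, Finset.sum_neg_distrib, neg_neg, Finset.mul_sum]
    rw [Finset.sum_comm]
  have h4 : ∑ m, D p (curv D Γ j m m l) = -D p (ric D Γ j l) := by
    simp [ric]
  simp only [covCurv, Matrix.sub_apply, Matrix.add_apply, map_apply, Matrix.sum_apply, Matrix.smul_apply,
    smul_eq_mul, Finset.sum_add_distrib, Finset.sum_sub_distrib, h1, h2, h3, h4, cov2]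
  ring

/-- The contracted Bianchi identity `∇_p R_{jkl}{}^p = ∇_k R_{jl} - ∇_j R_{kl}`. -/
theorem sum_covCurv_divergence (hD : ∀ i j x, D i (D j x) = D j (D i x))
    (hΓ : ∀ i j k, Γ i k j = Γ j k i) (j k l : ι) :
    ∑ p, covCurv D Γ p j k p l = cov2 D Γ (ric D Γ) k j l - cov2 D Γ (ric D Γ) j k l := by
  have h : ∀ p, covCurv D Γ p j k p l = covCurv D Γ j p k p l - covCurv D Γ k p j p l := by
    intro p
    have := congrFun (congrFun (bianchi hD hΓ p j k) p) l
    rw [covCurv_antisymm j p k] at this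
    simp only [Matrix.add_apply, Matrix.neg_apply, Matrix.zero_apply] at this
    linear_combination this
  simp only [h, Finset.sum_sub_distrib, sum_covCurv]
  ring

/-- A multiple `f g` of the metric has covariant derivative `(D_p f) g`. -/
theorem IsLeviCivita.cov2_smul (h : IsLeviCivita D g Γ) (f : A) (p k l : ι) :
    cov2 D Γ (fun i j => f * g i j) p k l = D p f * g k l := by
  simp only [cov2, Derivation.leibniz, smul_eq_mul, h.compat_apply, Finset.sum_add_distrib]
  simp only [mul_add, Finset.mul_sum]
  rw [Finset.sum_congr rfl fun q _ => mul_left_comm f (Γ p q k) (g q l),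
    Finset.sum_congr rfl fun q _ => (by ring : f * (g k q * Γ p q l) = Γ p q l * (f * g k q))]
  ring

/-- The covariant derivative of the curvature of a metric connection is skew-adjoint. -/
theorem IsLeviCivita.covCurv_skew (hD : ∀ i j x, D i (D j x) = D j (D i x))
    (h : IsLeviCivita D g Γ) (p j k : ι) :
    (covCurv D Γ p j k)ᵀ * g + g * covCurv D Γ p j k = 0 := by
  have h1 := congrArg (fun M : Matrix ι ι A => M.map (D p)) (h.curv_skew hD k j)
  have h0 : (0 : Matrix ι ι A).map (D p) = 0 := by ext; simp
  simp only [map_derivation_add, map_derivation_mul, map_derivation_transpose, h.compat, h0] at h1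
  have h2 := h.curv_skew hD k j
  have h3 : (∑ q, (Γ p q j • curv D Γ k q + Γ p q k • curv D Γ q j))ᵀ * g
      + g * ∑ q, (Γ p q j • curv D Γ k q + Γ p q k • curv D Γ q j) = 0 := by
    rw [transpose_sum, Finset.sum_mul, Finset.mul_sum, ← Finset.sum_add_distrib]
    refine Finset.sum_eq_zero fun q _ => ?_
    simp only [transpose_add, transpose_smul, Matrix.add_mul, Matrix.mul_add, Matrix.smul_mul,
      Matrix.mul_smul]
    rw [show ∀ a b c d : Matrix ι ι A, a + b + (c + d) = (a + c) + (b + d) from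
      fun a b c d => by abel, ← smul_add, ← smul_add, h.curv_skew hD, h.curv_skew hD, smul_zero,
      smul_zero, add_zero]
  have h4 : (covCurv D Γ p j k)ᵀ * g + g * covCurv D Γ p j k =
      (((curv D Γ k j).map (D p))ᵀ * g + (curv D Γ k j)ᵀ * ((Γ p)ᵀ * g + g * Γ p)
        + (((Γ p)ᵀ * g + g * Γ p) * curv D Γ k j + g * (curv D Γ k j).map (D p)))
      - ((curv D Γ k j)ᵀ * g + g * curv D Γ k j) * Γ p
      - (Γ p)ᵀ * ((curv D Γ k j)ᵀ * g + g * curv D Γ k j)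
      - ((∑ q, (Γ p q j • curv D Γ k q + Γ p q k • curv D Γ q j))ᵀ * g
      + g * ∑ q, (Γ p q j • curv D Γ k q + Γ p q k • curv D Γ q j)) := by
    simp only [covCurv, transpose_add, transpose_sub, transpose_mul]
    noncomm_ring
  rw [h4, h1, h2, h3]
  simp

theorem transpose_inv_eq (hg : gᵀ = g) (hgi : gi * g = 1) : giᵀ = gi := by
  have h1 : gᵀ * giᵀ = 1 := by rw [← transpose_mul, hgi, transpose_one]
  rw [hg] at h1
  calc giᵀ = gi * g * giᵀ := by rw [hgi, one_mul]
    _ = gi := by rw [mul_assoc, h1, mul_one]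

/-- Schur's lemma: the factor `f` of an Einstein metric `R_{kl} = f g_{kl}` satisfies
`(n - 2) ∂ f = 0`. -/
theorem IsLeviCivita.schur (hD : ∀ i j x, D i (D j x) = D j (D i x)) (h : IsLeviCivita D g Γ)
    (hg : gᵀ = g) (hgi : gi * g = 1) {f : A} (hf : ∀ k l, ric D Γ k l = f * g k l) (j : ι) :
    ((Fintype.card ι : A) - 2) * D j f = 0 := by
  have hgi' : g * gi = 1 := mul_eq_one_comm.mp hgi
  have hs : ∀ i j, g i j = g j i := fun i j => congrFun (congrFun hg j) i
  have hgis : giᵀ = gi := transpose_inv_eq hg hgi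
  have hr : ric D Γ = fun k l => f * g k l := by ext k l; exact hf k l
  have hskew : ∀ p k, (covCurv D Γ p j k * gi)ᵀ = -(covCurv D Γ p j k * gi) := by
    intro p k
    have h1 := congrArg (fun M => gi * M * gi) (h.covCurv_skew hD p j k)
    simp only [Matrix.mul_add, Matrix.add_mul, mul_zero, zero_mul] at h1
    rw [← mul_assoc gi g, hgi, one_mul, ← mul_assoc, mul_assoc _ g gi, hgi', mul_one] at h1
    rw [transpose_mul, hgis]
    exact eq_neg_of_add_eq_zero_left h1
  -- the double trace of `∇_p R_{jkl}{}^p`, computed from the contracted Bianchi identity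
  have hT1 : ∑ p, ∑ k, (covCurv D Γ p j k * gi) p k = D j f - (Fintype.card ι : A) * D j f := by
    simp only [mul_apply]
    rw [Finset.sum_comm]
    have e1 : ∀ k, ∑ p, ∑ l, covCurv D Γ p j k p l * gi l k
        = ∑ l, (D k f * g j l - D j f * g k l) * gi l k := by
      intro k
      rw [Finset.sum_comm]
      refine Finset.sum_congr rfl fun l _ => ?_
      rw [← Finset.sum_mul, sum_covCurv_divergence hD h.symm, hr, h.cov2_smul, h.cov2_smul]
    have e2 : ∀ k, ∑ l, (D k f * g j l - D j f * g k l) * gi l k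
        = D k f * (g * gi) j k - D j f * (g * gi) k k := by
      intro k
      simp only [mul_apply, sub_mul, Finset.sum_sub_distrib, Finset.mul_sum, mul_assoc]
    simp only [e1, e2, hgi', Finset.sum_sub_distrib, Matrix.one_apply]
    simp
  -- the same double trace, computed with the last two indices exchanged
  have hT2 : ∑ p, ∑ k, (covCurv D Γ p j k * gi) p k = -D j f := by
    have e1 : ∀ p k, (covCurv D Γ p j k * gi) p k = ∑ l, covCurv D Γ p k j k l * gi l p := by
      intro p k
      have := congrFun (congrFun (hskew p k) k) p
      rw [transpose_apply] at this
      rw [this, covCurv_antisymm p j k, ← Matrix.neg_mul, mul_apply]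
    have e2 : ∀ p, ∑ k, ∑ l, covCurv D Γ p k j k l * gi l p = -(D p f * (g * gi) j p) := by
      intro p
      rw [Finset.sum_comm, mul_apply, Finset.mul_sum, ← Finset.sum_neg_distrib]
      refine Finset.sum_congr rfl fun l _ => ?_
      rw [← Finset.sum_mul, sum_covCurv, hr, h.cov2_smul]
      ring
    simp only [e1, e2, hgi', Matrix.one_apply]
    simp
  linear_combination hT1 - hT2

/-- As the metric is parallel, lowering an index commutes with covariant differentiation. -/
theorem cov4_riem (h : IsLeviCivita D g Γ) (p j k l m : ι) :
    cov4 D Γ (riem D Γ g) p j k l m = ∑ q, covCurv D Γ p j k q l * g q m := by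
  have hT : ∀ j k, (curv D Γ k j)ᵀ * g = Matrix.of fun l m => riem D Γ g j k l m := by
    intro j k; ext l m; simp [riem, mul_apply]
  have h0 : ((covCurv D Γ p j k)ᵀ * g) l m = ∑ q, covCurv D Γ p j k q l * g q m := by
    simp [mul_apply]
  have h1 : (covCurv D Γ p j k)ᵀ * g = ((curv D Γ k j)ᵀ * g).map (D p)
      - (Γ p)ᵀ * ((curv D Γ k j)ᵀ * g) - ((curv D Γ k j)ᵀ * g) * Γ p
      - ∑ q, (Γ p q j • ((curv D Γ k q)ᵀ * g) + Γ p q k • ((curv D Γ q j)ᵀ * g)) := by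
    have : ∑ q, (Γ p q j • ((curv D Γ k q)ᵀ * g) + Γ p q k • ((curv D Γ q j)ᵀ * g))
        = (∑ q, (Γ p q j • curv D Γ k q + Γ p q k • curv D Γ q j))ᵀ * g := by
      rw [transpose_sum, Finset.sum_mul]
      refine Finset.sum_congr rfl fun q _ => ?_
      simp only [transpose_add, transpose_smul, Matrix.add_mul, Matrix.smul_mul]
    rw [this, map_derivation_mul, h.compat, map_derivation_transpose]
    simp only [covCurv, transpose_add, transpose_sub, transpose_mul]
    noncomm_ring
  rw [← h0, h1]
  simp only [hT, cov4, Matrix.sub_apply, map_apply, of_apply, Matrix.sum_apply, Matrix.add_apply,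
    Matrix.smul_apply, smul_eq_mul, mul_apply, transpose_apply, Finset.sum_add_distrib]
  rw [Finset.sum_congr rfl fun q _ => mul_comm (Γ p q m) (riem D Γ g j k l q)]
  ring

/-- The contracted Bianchi identity with all indices lowered:
`∇^m R_{jklm} = ∇_k R_{jl} - ∇_j R_{kl}`. -/
theorem div4_riem (hD : ∀ i j x, D i (D j x) = D j (D i x)) (h : IsLeviCivita D g Γ)
    (hgi : gi * g = 1) (j k l : ι) :
    div4 D Γ gi (riem D Γ g) j k l
      = cov2 D Γ (ric D Γ) k j l - cov2 D Γ (ric D Γ) j k l := by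
  have hgi' : g * gi = 1 := mul_eq_one_comm.mp hgi
  rw [← sum_covCurv_divergence hD h.symm]
  simp only [div4, cov4_riem h]
  rw [Finset.sum_comm]
  refine Finset.sum_congr rfl fun p _ => ?_
  have : ∑ q, covCurv D Γ p j k q l * (g * gi) q p = covCurv D Γ p j k p l := by
    simp [hgi', Matrix.one_apply]
  rw [← this]
  simp only [mul_apply, Finset.mul_sum]
  rw [Finset.sum_comm]
  refine Finset.sum_congr rfl fun q _ => Finset.sum_congr rfl fun r _ => by ring

/-- The tensor `g_{jm} g_{kl}` is parallel. -/
theorem IsLeviCivita.cov4_metric_mul (h : IsLeviCivita D g Γ) (p j k l m : ι) :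
    cov4 D Γ (fun j k l m => g j m * g k l) p j k l m = 0 := by
  simp only [cov4, Derivation.leibniz, smul_eq_mul, h.compat_apply, mul_add, Finset.mul_sum]
  rw [sub_eq_zero]
  simp only [← Finset.sum_add_distrib]
  exact Finset.sum_congr rfl fun q _ => by ring

end DiffRing

end

noncomputable section

/-! ### Warped products over a ring with commuting derivations -/

namespace DiffRing

open Matrix

variable {A : Type*} [CommRing A] [Algebra ℝ A] {ι : Type*} [Fintype ι] [DecidableEq ι]

section Einstein

variable {D : ι → Derivation ℝ A A} {g gi : Matrix ι ι A} {Γ : ι → Matrix ι ι A}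

/-- The trace-free part of the Ricci tensor. -/
def tracefreeRic (D : ι → Derivation ℝ A A) (Γ : ι → Matrix ι ι A) (g gi : Matrix ι ι A)
    (k l : ι) : A :=
  ric D Γ k l - (1 / (Fintype.card ι : ℝ)) • (scal D Γ gi * g k l)

/-- The curvature `K_{jklm}` for which `a² K_{jklm}` are the purely spatial components of the Weyl
tensor of a warped product `-dt² + a² g`; the dimension of `g` is the cardinality of `ι`. Its
coefficients are those of the Weyl tensor in one dimension more, so it is not trace-free. -/
def spatialWeyl (D : ι → Derivation ℝ A A) (Γ : ι → Matrix ι ι A) (g gi : Matrix ι ι A)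
    (j k l m : ι) : A :=
  riem D Γ g j k l m
    + (1 / ((Fintype.card ι : ℝ) - 1)) • (g j m * ric D Γ k l - g k m * ric D Γ j l
        + ric D Γ j m * g k l - ric D Γ k m * g j l)
    - (1 / ((Fintype.card ι : ℝ) * ((Fintype.card ι : ℝ) - 1))) •
        (scal D Γ gi * (g j m * g k l - g k m * g j l))

theorem derivation_one_apply (d : Derivation ℝ A A) (i j : ι) : d ((1 : Matrix ι ι A) i j) = 0 :=
  congrFun (congrFun (map_derivation_one d) i) j

theorem sum_inv_mul_left (hgi : gi * g = 1) (X : ι → A) (j : ι) :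
    ∑ q, ∑ p, gi q p * (g p j * X q) = X j := by
  have : ∀ q, ∑ p, gi q p * (g p j * X q) = (gi * g) q j * X q := fun q => by
    simp only [mul_apply, Finset.sum_mul, mul_assoc]
  simp [this, hgi, Matrix.one_apply]

theorem sum_inv_mul_right (hgi : gi * g = 1) (X : ι → A) (j : ι) :
    ∑ q, ∑ p, gi q p * (g j q * X p) = X j := by
  rw [Finset.sum_comm]
  have : ∀ p, ∑ q, gi q p * (g j q * X p) = (g * gi) j p * X p := fun q => by
    simp only [mul_apply, Finset.sum_mul]
    exact Finset.sum_congr rfl fun _ _ => by ring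
  simp [this, mul_eq_one_comm.mp hgi, Matrix.one_apply]

theorem sum_inv_mul_self (hgi : gi * g = 1) :
    ∑ q, ∑ p, gi q p * g p q = (Fintype.card ι : A) := by
  have : ∀ q, ∑ p, gi q p * g p q = (gi * g) q q := fun q => by
    simp only [mul_apply]
  simp [this, hgi]

theorem sum_inv_mul_riem (hgi : gi * g = 1) (i j : ι) :
    ∑ q, ∑ p, gi q p * riem D Γ g p i j q = -ric D Γ i j := by
  rw [Finset.sum_comm, ric, neg_neg]
  refine Finset.sum_congr rfl fun p _ => ?_
  have : ∑ r, curv D Γ i p r j * (g * gi) r p = curv D Γ i p p j := by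
    simp [mul_eq_one_comm.mp hgi, Matrix.one_apply]
  rw [← this]
  simp only [riem, mul_apply, Finset.mul_sum]
  rw [Finset.sum_comm]
  exact Finset.sum_congr rfl fun _ _ => Finset.sum_congr rfl fun _ _ => by ring

/-- The numerical coefficients of the Weyl tensor as elements of `A`: with `d` the cardinality of
`ι`, `u = 1 / (d - 1)` and `v = 1 / d`. Identities between curvature components then become polynomial
identities modulo `u (d - 1) = 1` and `v d = 1`. -/
theorem exists_coeff (hd : 2 ≤ Fintype.card ι) : ∃ u v : A,
    u * ((Fintype.card ι : A) - 1) = 1 ∧ v * (Fintype.card ι : A) = 1 ∧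
    (∀ x : A, (1 / ((Fintype.card ι : ℝ) - 1)) • x = u * x) ∧
    (∀ x : A, (1 / (Fintype.card ι : ℝ)) • x = v * x) ∧
    (∀ x : A, (1 / ((Fintype.card ι : ℝ) * ((Fintype.card ι : ℝ) - 1))) • x = u * v * x) ∧
    ∀ d : Derivation ℝ A A, d u = 0 ∧ d v = 0 := by
  have hd' : (2 : ℝ) ≤ Fintype.card ι := by exact_mod_cast hd
  refine ⟨algebraMap ℝ A (1 / ((Fintype.card ι : ℝ) - 1)),
    algebraMap ℝ A (1 / (Fintype.card ι : ℝ)),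
    ?_, ?_, fun x => Algebra.smul_def _ _, fun x => Algebra.smul_def _ _, fun x => ?_,
    fun d => ⟨d.map_algebraMap _, d.map_algebraMap _⟩⟩
  · rw [show ((Fintype.card ι : A) - 1) = algebraMap ℝ A ((Fintype.card ι : ℝ) - 1) by simp,
      ← map_mul, one_div_mul_cancel (by linarith), map_one]
  · rw [show (Fintype.card ι : A) = algebraMap ℝ A (Fintype.card ι : ℝ) by simp,
      ← map_mul, one_div_mul_cancel (by linarith), map_one]
  · rw [Algebra.smul_def, ← map_mul, one_div_mul_one_div_rev]

/-- The trace of `spatialWeyl` is a multiple of the trace-free Ricci tensor. -/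
theorem sum_inv_mul_spatialWeyl (hd : 2 ≤ Fintype.card ι) (hg : gᵀ = g) (hgi : gi * g = 1)
    (i j : ι) : ∑ q, ∑ p, gi q p * spatialWeyl D Γ g gi p i j q
      = -((1 / ((Fintype.card ι : ℝ) - 1)) • tracefreeRic D Γ g gi i j) := by
  obtain ⟨u, v, hu, hv, h1, h2, h3, -⟩ := exists_coeff (A := A) hd
  have hs : ∀ i j, g i j = g j i := fun i j => congrFun (congrFun hg j) i
  simp only [spatialWeyl, tracefreeRic, h1, h2, h3]
  have hsplit : ∀ p q, gi q p * (riem D Γ g p i j q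
      + u * (g p q * ric D Γ i j - g i q * ric D Γ p j
        + ric D Γ p q * g i j - ric D Γ i q * g p j)
      - u * v * (scal D Γ gi * (g p q * g i j - g i q * g p j)))
      = gi q p * riem D Γ g p i j q + u * ric D Γ i j * (gi q p * g p q)
        - u * (gi q p * (g i q * ric D Γ p j)) + u * g i j * (gi q p * ric D Γ p q)
        - u * (gi q p * (g p j * ric D Γ i q))
        - u * v * scal D Γ gi * g i j * (gi q p * g p q)
        + u * v * scal D Γ gi * (gi q p * (g i q * g p j)) := fun p q => by ring
  have hgis : giᵀ = gi := transpose_inv_eq hg hgi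
  have hscal : ∑ q, ∑ p, gi q p * ric D Γ p q = scal D Γ gi := by
    rw [scal, Finset.sum_comm]
    exact Finset.sum_congr rfl fun p _ => Finset.sum_congr rfl fun q _ => by
      rw [show gi q p = gi p q from congrFun (congrFun hgis p) q]
  simp only [hsplit, Finset.sum_add_distrib, Finset.sum_sub_distrib, ← Finset.mul_sum,
    sum_inv_mul_riem hgi, sum_inv_mul_self hgi, hscal, sum_inv_mul_right hgi (fun p => ric D Γ p j),
    sum_inv_mul_left hgi (fun q => ric D Γ i q), sum_inv_mul_right hgi (fun p => g p j)]
  linear_combination (ric D Γ i j - v * scal D Γ gi * g i j) * hu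
    - u * scal D Γ gi * g i j * hv + scal D Γ gi * g i j * v * hu

/-- Skew-symmetry of the curvature in its last two indices. -/
theorem IsLeviCivita.riem_skew (hD : ∀ i j x, D i (D j x) = D j (D i x))
    (hg : gᵀ = g) (h : IsLeviCivita D g Γ) (j k l m : ι) :
    riem D Γ g j k m l = -riem D Γ g j k l m := by
  have hs : ∀ i j, g i j = g j i := fun i j => congrFun (congrFun hg j) i
  have h1 := congrFun (congrFun (h.curv_skew hD k j) l) m
  simp only [Matrix.add_apply, mul_apply, transpose_apply, Matrix.zero_apply] at h1
  simp only [riem]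
  rw [Finset.sum_congr rfl fun p _ => show curv D Γ k j p m * g p l = g l p * curv D Γ k j p m by
    rw [hs p l, mul_comm]]
  linear_combination h1

/-- For an Einstein metric, the tensor `spatialWeyl` is divergence-free: by Schur's lemma it differs
from the curvature by a constant multiple of a parallel tensor, and the divergence of the curvature
vanishes by the contracted Bianchi identity. -/
theorem IsLeviCivita.div4_spatialWeyl (hd : 3 ≤ Fintype.card ι)
    (hD : ∀ i j x, D i (D j x) = D j (D i x)) (h : IsLeviCivita D g Γ)
    (hg : gᵀ = g) (hgi : gi * g = 1) (hE : ∀ i j, tracefreeRic D Γ g gi i j = 0) (j k l : ι) :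
    div4 D Γ gi (spatialWeyl D Γ g gi) j k l = 0 := by
  obtain ⟨u, v, hu, hv, h1, h2, h3, hd0⟩ := exists_coeff (A := A) (ι := ι) (by omega)
  -- the Einstein factor, `R_{kl} = f g_{kl}`
  set f := v * scal D Γ gi with hf
  have hr : ∀ k l, ric D Γ k l = f * g k l := by
    intro k l
    have := hE k l
    rw [tracefreeRic, h2, sub_eq_zero] at this
    rw [this, hf, mul_assoc]
  have hr' : ric D Γ = fun k l => f * g k l := by ext k l; exact hr k l
  have hDf : ∀ i, D i f = 0 := by
    intro i
    have h4 := h.schur hD hg hgi hr i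
    have h5 : (1 / ((Fintype.card ι : ℝ) - 2)) • (((Fintype.card ι : A) - 2) * D i f) = D i f := by
      have h6 : ((Fintype.card ι : ℝ) - 2) ≠ 0 := by
        have : (3 : ℝ) ≤ Fintype.card ι := by exact_mod_cast hd
        linarith
      rw [show ((Fintype.card ι : A) - 2) = algebraMap ℝ A ((Fintype.card ι : ℝ) - 2) by
          rw [map_sub, map_natCast, map_ofNat],
        ← Algebra.smul_def, smul_smul, one_div_mul_cancel h6, one_smul]
    rw [← h5, h4, smul_zero]
  have hK : spatialWeyl D Γ g gi = fun j k l m => riem D Γ g j k l m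
      + u * f * (g j m * g k l) - u * f * (g k m * g j l) := by
    ext j k l m
    simp only [spatialWeyl, h1, h3, hr]
    ring
  have huf : ∀ p, D p (u * f) = 0 := fun p => by simp [(hd0 _).1, hDf]
  have hcov : ∀ p j k l m, cov4 D Γ (spatialWeyl D Γ g gi) p j k l m
      = cov4 D Γ (riem D Γ g) p j k l m := by
    intro p j k l m
    have e1 := h.cov4_metric_mul p j k l m
    have e2 := h.cov4_metric_mul p k j l m
    rw [hK]
    simp only [cov4, Derivation.map_add, Derivation.map_sub, Derivation.leibniz (D p) (u * f),
      huf, smul_eq_mul, mul_zero, add_zero] at e1 e2 ⊢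
    simp only [mul_add, mul_sub, Finset.sum_add_distrib, Finset.sum_sub_distrib,
      mul_left_comm _ (u * f), ← Finset.mul_sum] at e1 e2 ⊢
    linear_combination (u * f) * e1 - (u * f) * e2
  have : div4 D Γ gi (spatialWeyl D Γ g gi) j k l = div4 D Γ gi (riem D Γ g) j k l := by
    simp only [div4, hcov]
  rw [this, div4_riem hD h hgi, hr', h.cov2_smul, h.cov2_smul, hDf, hDf]
  ring

end Einstein

section Warped

/-- The data of a warped product metric `-dt² + a² H`, where `D₀` is the time derivative, `D` are
the spatial derivatives, `Hi` is the inverse of `H` and `ai` the inverse of `a`. -/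
structure WarpedData (A : Type*) [CommRing A] [Algebra ℝ A] (ι : Type*) [Fintype ι]
    [DecidableEq ι] where
  D₀ : Derivation ℝ A A
  D : ι → Derivation ℝ A A
  H : Matrix ι ι A
  Hi : Matrix ι ι A
  a : A
  ai : A
  comm : ∀ i j x, D i (D j x) = D j (D i x)
  comm₀ : ∀ i x, D₀ (D i x) = D i (D₀ x)
  symm : Hᵀ = H
  inv : Hi * H = 1
  static : ∀ i j, D₀ (H i j) = 0
  a_spatial : ∀ i, D i a = 0
  mul_ai : a * ai = 1

namespace WarpedData

variable (w : WarpedData A ι)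

/-- The Christoffel symbols of the spatial metric. -/
def Γ : ι → Matrix ι ι A := levi w.D w.H w.Hi

/-- The logarithmic derivative `a' / a` of the warping function. -/
def β : A := w.D₀ w.a * w.ai

/-- The derivations of the warped product, with `inl ()` the time direction. -/
def WD : Unit ⊕ ι → Derivation ℝ A A := Sum.elim (fun _ => w.D₀) w.D

/-- The warped product metric. -/
def G : Matrix (Unit ⊕ ι) (Unit ⊕ ι) A := fromBlocks (-1) 0 0 (w.a ^ 2 • w.H)

/-- The inverse of the warped product metric. -/
def Gi : Matrix (Unit ⊕ ι) (Unit ⊕ ι) A := fromBlocks (-1) 0 0 (w.ai ^ 2 • w.Hi)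

/-- The Christoffel symbols of the warped product metric: the nonzero ones are
`Γ^i_{0j} = Γ^i_{j0} = (a'/a) δ^i_j`, `Γ^0_{ij} = a a' H_{ij}` and those of `H`. -/
def WΓ : Unit ⊕ ι → Matrix (Unit ⊕ ι) (Unit ⊕ ι) A := Sum.elim
  (fun _ => fromBlocks 0 0 0 (w.β • 1))
  (fun i => fromBlocks 0 (Matrix.of fun _ j => w.a * w.D₀ w.a * w.H i j)
    (Matrix.of fun k _ => w.β * (1 : Matrix ι ι A) k i) (w.Γ i))

theorem H_comm (i j : ι) : w.H i j = w.H j i := congrFun (congrFun w.symm j) i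

theorem a_mul_β : w.a * w.β = w.D₀ w.a := by
  rw [β]; linear_combination w.D₀ w.a * w.mul_ai

theorem isLeviCivita : IsLeviCivita w.D w.H w.Γ := isLeviCivita_levi w.symm w.inv

theorem D_D₀_a (i : ι) : w.D i (w.D₀ w.a) = 0 := by
  rw [← w.comm₀, w.a_spatial, map_zero]

theorem Hi_comm (i j : ι) : w.Hi i j = w.Hi j i :=
  congrFun (congrFun (transpose_inv_eq w.symm w.inv) j) i

theorem D_ai (i : ι) : w.D i w.ai = 0 := by
  have h := congrArg (w.D i) w.mul_ai
  rw [Derivation.leibniz, w.a_spatial, Derivation.map_one_eq_zero] at h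
  simp only [smul_eq_mul, mul_zero, add_zero] at h
  calc w.D i w.ai = w.ai * (w.a * w.D i w.ai) := by
        linear_combination -(w.D i w.ai) * w.mul_ai
    _ = 0 := by rw [h, mul_zero]

theorem D_β (i : ι) : w.D i w.β = 0 := by
  simp [β, D_D₀_a, D_ai]

theorem D₀_β : w.D₀ w.β + w.β ^ 2 = w.D₀ (w.D₀ w.a) * w.ai := by
  have h := congrArg w.D₀ w.a_mul_β
  rw [Derivation.leibniz] at h
  simp only [smul_eq_mul] at h
  linear_combination w.ai * h - (w.D₀ w.β + w.β ^ 2) * w.mul_ai - w.ai * w.β * (-w.a_mul_β)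

theorem D₀_Hi (i j : ι) : w.D₀ (w.Hi i j) = 0 := by
  have h0 : w.H.map w.D₀ = 0 := by ext; simp [w.static]
  have h := congrArg (fun M : Matrix ι ι A => M.map w.D₀) w.inv
  simp only [map_derivation_mul, map_derivation_one, h0, mul_zero, add_zero] at h
  have h1 : w.Hi.map w.D₀ = 0 := by
    calc w.Hi.map w.D₀ = w.Hi.map w.D₀ * w.H * w.Hi := by
          rw [mul_assoc, mul_eq_one_comm.mp w.inv, mul_one]
      _ = 0 := by rw [h, zero_mul]
  exact congrFun (congrFun h1 i) j

theorem D₀_Γ (i k j : ι) : w.D₀ (w.Γ i k j) = 0 := by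
  simp [Γ, levi, w.comm₀, w.static, D₀_Hi]

theorem G_transpose : w.Gᵀ = w.G := by
  simp [G, fromBlocks_transpose, w.symm]

theorem Gi_mul_G : w.Gi * w.G = 1 := by
  have h : w.ai ^ 2 * w.a ^ 2 = 1 := by rw [← mul_pow, mul_comm, w.mul_ai, one_pow]
  simp [G, Gi, fromBlocks_multiply, w.inv, smul_smul, mul_comm (w.a ^ 2), h]

/-- By uniqueness of the Levi-Civita connection, this identifies `WΓ` with the Christoffel symbols
of the warped product metric. -/
theorem isLeviCivita_WΓ : IsLeviCivita w.WD w.G w.WΓ := by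
  refine ⟨fun i j k => ?_, fun i => ?_⟩
  · rcases i with i | i <;> rcases j with j | j <;> rcases k with k | k
    case inr.inr.inl => simp [WΓ, w.H_comm i j]
    case inr.inr.inr => exact w.isLeviCivita.symm i j k
    all_goals simp [WΓ]
  · have hβ := w.a_mul_β
    have hc := w.isLeviCivita.compat
    rcases i with i | i <;> ext (j | j) (k | k) <;>
      simp [WΓ, G, WD, mul_apply, Fintype.sum_sum_type, Derivation.leibniz, w.static]
    case inl.inr.inr =>
      simp only [Matrix.one_apply, mul_ite, ite_mul, mul_one, mul_zero, zero_mul,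
        Finset.sum_ite_eq', Finset.mem_univ, if_true]
      linear_combination (-2 * w.a * w.H j k) * hβ
    case inr.inl.inr =>
      simp only [Matrix.one_apply, mul_ite, ite_mul, mul_one, mul_zero, zero_mul,
        Finset.sum_ite_eq', Finset.mem_univ, if_true]
      linear_combination (-w.a * w.H i k) * hβ
    case inr.inr.inl =>
      simp only [Matrix.one_apply, mul_ite, mul_one, mul_zero,
        Finset.sum_ite_eq', Finset.mem_univ, if_true]
      rw [w.H_comm j i]
      linear_combination (-w.a * w.H i j) * hβ
    case inr.inr.inr =>
      rw [w.isLeviCivita.compat_apply, w.a_spatial]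
      simp only [mul_add, Finset.mul_sum, mul_zero, add_zero]
      congr 1
      · exact Finset.sum_congr rfl fun p _ => by ring
      · exact Finset.sum_congr rfl fun p _ => by ring

theorem curv_inl_inr (i : ι) : curv w.WD w.WΓ (.inl ()) (.inr i)
    = fromBlocks 0 (Matrix.of fun _ j => w.a * w.D₀ (w.D₀ w.a) * w.H i j)
      (Matrix.of fun k _ => w.D₀ (w.D₀ w.a) * w.ai * (1 : Matrix ι ι A) k i) 0 := by
  ext (j | j) (k | k) <;>
    simp [curv, WΓ, WD, mul_apply, Fintype.sum_sum_type, Derivation.leibniz, D_β, D₀_Γ, w.static,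
      ← D₀_β]
  · simp only [Matrix.one_apply, mul_ite, mul_one, mul_zero, Finset.sum_ite_eq', Finset.mem_univ,
      if_true]
    linear_combination (-w.D₀ w.a * w.H i k) * w.a_mul_β
  · rw [derivation_one_apply]
    have e : ∀ p, w.β * (1 : Matrix ι ι A) j p * (w.β * (1 : Matrix ι ι A) p i)
        = w.β ^ 2 * ((1 : Matrix ι ι A) j p * (1 : Matrix ι ι A) p i) := fun p => by ring
    simp only [e, ← Finset.mul_sum]
    rw [← mul_apply, one_mul]
    ring
  · rw [derivation_one_apply]
    simp only [Matrix.one_apply, mul_ite, ite_mul, mul_one, mul_zero, zero_mul, Finset.sum_ite_eq,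
      Finset.sum_ite_eq', Finset.mem_univ, if_true]
    ring

theorem curv_inr_inl (i : ι) : curv w.WD w.WΓ (.inr i) (.inl ())
    = -fromBlocks 0 (Matrix.of fun _ j => w.a * w.D₀ (w.D₀ w.a) * w.H i j)
      (Matrix.of fun k _ => w.D₀ (w.D₀ w.a) * w.ai * (1 : Matrix ι ι A) k i) 0 := by
  rw [curv_antisymm (Sum.inl ()) (Sum.inr i), curv_inl_inr]

theorem curv_inr_inr (i l : ι) : curv w.WD w.WΓ (.inr i) (.inr l)
    = fromBlocks 0 0 0 (curv w.D w.Γ i l + w.D₀ w.a ^ 2 • Matrix.of fun p q =>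
        (1 : Matrix ι ι A) p i * w.H l q - (1 : Matrix ι ι A) p l * w.H i q) := by
  ext (j | j) (k | k) <;>
    simp [curv, WΓ, WD, mul_apply, Fintype.sum_sum_type, Derivation.leibniz, D_β, w.a_spatial,
      D_D₀_a]
  · simp only [Matrix.one_apply, mul_ite, mul_one, mul_zero, Finset.sum_ite_eq', Finset.mem_univ,
      if_true]
    rw [w.H_comm i l, sub_self]
  · rw [w.isLeviCivita.compat_apply, w.isLeviCivita.compat_apply]
    simp only [mul_add, Finset.mul_sum, mul_assoc]
    have e : ∑ p, w.a * (w.D₀ w.a * (w.Γ i p l * w.H p k))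
        = ∑ p, w.a * (w.D₀ w.a * (w.Γ l p i * w.H p k)) :=
      Finset.sum_congr rfl fun p _ => by rw [w.isLeviCivita.symm i l p]
    rw [e]
    ring
  · rw [derivation_one_apply, derivation_one_apply]
    simp only [Matrix.one_apply, mul_ite, mul_one, mul_zero, Finset.sum_ite_eq', Finset.mem_univ,
      if_true]
    rw [w.isLeviCivita.symm i l j]
    ring
  · linear_combination (w.D₀ w.a * ((1 : Matrix ι ι A) j i * w.H l k
      - (1 : Matrix ι ι A) j l * w.H i k)) * w.a_mul_β

theorem ric_inl_inl : ric w.WD w.WΓ (.inl ()) (.inl ())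
    = -((Fintype.card ι : A) * (w.D₀ (w.D₀ w.a) * w.ai)) := by
  simp [ric, Fintype.sum_sum_type, curv_self, curv_inl_inr]

theorem ric_inl_inr (l : ι) : ric w.WD w.WΓ (.inl ()) (.inr l) = 0 := by
  simp [ric, Fintype.sum_sum_type, curv_self, curv_inl_inr]

theorem ric_inr_inl (k : ι) : ric w.WD w.WΓ (.inr k) (.inl ()) = 0 := by
  simp [ric, Fintype.sum_sum_type, curv_inr_inr, curv_inr_inl]

theorem ric_inr_inr (k l : ι) : ric w.WD w.WΓ (.inr k) (.inr l) = ric w.D w.Γ k l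
    + (w.a * w.D₀ (w.D₀ w.a) + ((Fintype.card ι : A) - 1) * w.D₀ w.a ^ 2) * w.H k l := by
  simp only [ric, Fintype.sum_sum_type, curv_inr_inr]
  simp [curv_inr_inl, Matrix.one_apply, Finset.sum_add_distrib, mul_sub]
  ring

theorem scal_eq : scal w.WD w.WΓ w.Gi = w.ai ^ 2 * scal w.D w.Γ w.Hi
    + (Fintype.card ι : A) * (2 * (w.D₀ (w.D₀ w.a) * w.ai)
      + ((Fintype.card ι : A) - 1) * (w.D₀ w.a * w.ai) ^ 2) := by
  have hn : ∑ k, ∑ l, w.Hi k l * w.H k l = (Fintype.card ι : A) := by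
    rw [← sum_inv_mul_self w.inv]
    exact Finset.sum_congr rfl fun _ _ => Finset.sum_congr rfl fun _ _ => by rw [w.H_comm]
  have h1 : scal w.WD w.WΓ w.Gi = (Fintype.card ι : A) * (w.D₀ (w.D₀ w.a) * w.ai)
      + ∑ k, ∑ l, w.ai ^ 2 * w.Hi k l * (ric w.D w.Γ k l
    + (w.a * w.D₀ (w.D₀ w.a) + ((Fintype.card ι : A) - 1) * w.D₀ w.a ^ 2) * w.H k l) := by
    simp [scal, Fintype.sum_sum_type, Gi, ric_inl_inl, ric_inr_inr]
  have h2 : ∀ k l, w.ai ^ 2 * w.Hi k l * (ric w.D w.Γ k l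
    + (w.a * w.D₀ (w.D₀ w.a) + ((Fintype.card ι : A) - 1) * w.D₀ w.a ^ 2) * w.H k l)
      = w.ai ^ 2 * (w.Hi k l * ric w.D w.Γ k l) + w.ai ^ 2 * (w.a * w.D₀ (w.D₀ w.a)
        + ((Fintype.card ι : A) - 1) * w.D₀ w.a ^ 2) * (w.Hi k l * w.H k l) := fun k l => by ring
  rw [h1]
  simp only [h2, Finset.sum_add_distrib, ← Finset.mul_sum, hn]
  rw [scal]
  linear_combination (Fintype.card ι : A) * w.ai * w.D₀ (w.D₀ w.a) * w.mul_ai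

/-- The scalar curvature multiplied by `a²`, which clears the inverse of `a`. -/
theorem sq_mul_scal : w.a ^ 2 * scal w.WD w.WΓ w.Gi = scal w.D w.Γ w.Hi
    + (Fintype.card ι : A) * (2 * (w.a * w.D₀ (w.D₀ w.a))
      + ((Fintype.card ι : A) - 1) * w.D₀ w.a ^ 2) := by
  rw [scal_eq]
  -- the factor `a ai + 1` comes from `a² ai² - 1 = (a ai + 1) (a ai - 1)`
  linear_combination (scal w.D w.Γ w.Hi
    + (Fintype.card ι : A) * ((Fintype.card ι : A) - 1) * w.D₀ w.a ^ 2) * (w.a * w.ai + 1)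
      * w.mul_ai + 2 * (Fintype.card ι : A) * w.a * w.D₀ (w.D₀ w.a) * w.mul_ai

theorem sq_mul_ric_inl_inl : w.a ^ 2 * ric w.WD w.WΓ (.inl ()) (.inl ())
    = -((Fintype.card ι : A) * (w.a * w.D₀ (w.D₀ w.a))) := by
  rw [ric_inl_inl]
  linear_combination -(Fintype.card ι : A) * w.a * w.D₀ (w.D₀ w.a) * w.mul_ai

@[simp] theorem G_inl_inl : w.G (.inl ()) (.inl ()) = -1 := by simp [G]
@[simp] theorem G_inl_inr (i : ι) : w.G (.inl ()) (.inr i) = 0 := by simp [G]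
@[simp] theorem G_inr_inl (i : ι) : w.G (.inr i) (.inl ()) = 0 := by simp [G]
@[simp] theorem G_inr_inr (i j : ι) : w.G (.inr i) (.inr j) = w.a ^ 2 * w.H i j := by simp [G]

/-- The trace-free part of the Ricci tensor of the spatial metric. -/
def E (i j : ι) : A := tracefreeRic w.D w.Γ w.H w.Hi i j

/-- The Weyl tensor of the warped product. -/
def W (j k l m : Unit ⊕ ι) : A :=
  weyl ((Fintype.card ι : ℝ) + 1) w.WD w.WΓ w.G w.Gi j k l m

theorem W_antisymm (j k l m : Unit ⊕ ι) : w.W k j l m = -w.W j k l m := by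
  have : riem w.WD w.WΓ w.G k j l m = -riem w.WD w.WΓ w.G j k l m := by
    simp [riem, curv_antisymm k j]
  simp only [W, weyl, this, mul_sub, smul_sub, smul_add]
  abel

theorem W_self (j l m : Unit ⊕ ι) : w.W j j l m = 0 := by
  simp [W, weyl, riem, curv_self]

/-- The tensors `E`, `spatialWeyl` and `W` with their numerical coefficients as elements of `A`. -/
theorem exists_weyl_coeff (hd : 2 ≤ Fintype.card ι) : ∃ u v : A,
    u * ((Fintype.card ι : A) - 1) = 1 ∧ v * (Fintype.card ι : A) = 1 ∧
    (∀ d : Derivation ℝ A A, d u = 0 ∧ d v = 0) ∧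
    (∀ x : A, (1 / ((Fintype.card ι : ℝ) - 1)) • x = u * x) ∧
    (∀ i j, w.E i j = ric w.D w.Γ i j - v * scal w.D w.Γ w.Hi * w.H i j) ∧
    (∀ j k l m, spatialWeyl w.D w.Γ w.H w.Hi j k l m = riem w.D w.Γ w.H j k l m
      + u * (w.H j m * ric w.D w.Γ k l - w.H k m * ric w.D w.Γ j l
        + ric w.D w.Γ j m * w.H k l - ric w.D w.Γ k m * w.H j l)
      - u * v * scal w.D w.Γ w.Hi * (w.H j m * w.H k l - w.H k m * w.H j l)) ∧
    (∀ j k l m, w.W j k l m = riem w.WD w.WΓ w.G j k l m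
      + u * (w.G j m * ric w.WD w.WΓ k l - w.G k m * ric w.WD w.WΓ j l
        + ric w.WD w.WΓ j m * w.G k l - ric w.WD w.WΓ k m * w.G j l)
      - u * v * scal w.WD w.WΓ w.Gi * (w.G j m * w.G k l - w.G k m * w.G j l)) := by
  obtain ⟨u, v, hu, hv, h1, h2, h3, hd0⟩ := exists_coeff (A := A) hd
  refine ⟨u, v, hu, hv, hd0, h1, fun i j => ?_, fun j k l m => ?_, fun j k l m => ?_⟩
  · rw [E, tracefreeRic, h2, mul_assoc]
  · rw [spatialWeyl, h1, h3, mul_assoc (u * v)]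
  · rw [W, weyl, show (Fintype.card ι : ℝ) + 1 - 2 = (Fintype.card ι : ℝ) - 1 by ring,
      show (Fintype.card ι : ℝ) + 1 - 1 = (Fintype.card ι : ℝ) by ring, h1, h3, mul_assoc (u * v)]

theorem riem_apply_inl (j k l : Unit ⊕ ι) :
    riem w.WD w.WΓ w.G j k l (.inl ()) = -curv w.WD w.WΓ k j (.inl ()) l := by
  simp [riem, Fintype.sum_sum_type, G]

theorem riem_apply_inr (j k l : Unit ⊕ ι) (m : ι) : riem w.WD w.WΓ w.G j k l (.inr m)
    = ∑ p, curv w.WD w.WΓ k j (.inr p) l * (w.a ^ 2 * w.H p m) := by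
  simp [riem, Fintype.sum_sum_type, G]

variable {w}

/-- The electric part of the Weyl tensor is a multiple of the trace-free Ricci tensor of the
fibre. -/
theorem W_electric (hd : 2 ≤ Fintype.card ι) (i j : ι) :
    w.W (.inl ()) (.inr i) (.inr j) (.inl ())
      = -((1 / ((Fintype.card ι : ℝ) - 1)) • w.E i j) := by
  obtain ⟨u, v, hu, hv, -, h1, hE, hK, hW⟩ := w.exists_weyl_coeff hd
  have hr : -(curv w.WD w.WΓ (.inr i) (.inl ()) (.inl ()) (.inr j))
      = w.a * w.D₀ (w.D₀ w.a) * w.H i j := by simp [curv_inr_inl]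
  rw [hW, h1, hE, riem_apply_inl, hr]
  simp only [ric_inr_inl, ric_inl_inr, ric_inr_inr, G_inl_inl, G_inl_inr, G_inr_inl, G_inr_inr]
  linear_combination -(w.a * w.D₀ (w.D₀ w.a) * w.H i j) * hu
    + u * w.H i j * (2 * (w.a * w.D₀ (w.D₀ w.a))
      + ((Fintype.card ι : A) - 1) * w.D₀ w.a ^ 2) * hv
    + u * v * w.H i j * w.sq_mul_scal + u * w.H i j * w.sq_mul_ric_inl_inl

theorem W_electric' (hd : 2 ≤ Fintype.card ι) (i j : ι) :
    w.W (.inl ()) (.inr i) (.inl ()) (.inr j)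
      = (1 / ((Fintype.card ι : ℝ) - 1)) • w.E i j := by
  obtain ⟨u, v, hu, hv, -, h1, hE, hK, hW⟩ := w.exists_weyl_coeff hd
  have hr : ∑ p, curv w.WD w.WΓ (.inr i) (.inl ()) (.inr p) (.inl ()) * (w.a ^ 2 * w.H p j)
      = -(w.D₀ (w.D₀ w.a) * w.ai * (w.a ^ 2 * w.H i j)) := by
    simp [curv_inr_inl, Matrix.one_apply]
  rw [hW, h1, hE, riem_apply_inr, hr]
  simp only [ric_inr_inl, ric_inl_inr, ric_inr_inr, G_inl_inl, G_inl_inr, G_inr_inl, G_inr_inr]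
  linear_combination (w.a * w.D₀ (w.D₀ w.a) * w.H i j) * hu
    - u * w.H i j * (2 * (w.a * w.D₀ (w.D₀ w.a))
      + ((Fintype.card ι : A) - 1) * w.D₀ w.a ^ 2) * hv
    - u * v * w.H i j * w.sq_mul_scal - u * w.H i j * w.sq_mul_ric_inl_inl
    - w.a * w.D₀ (w.D₀ w.a) * w.H i j * w.mul_ai

/-- The magnetic part of the Weyl tensor vanishes. -/
theorem W_magnetic (hd : 2 ≤ Fintype.card ι) (i j k : ι) :
    w.W (.inl ()) (.inr i) (.inr j) (.inr k) = 0 := by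
  obtain ⟨u, v, hu, hv, -, h1, hE, hK, hW⟩ := w.exists_weyl_coeff hd
  rw [hW, riem_apply_inr]
  simp [curv_inr_inl, ric_inl_inr, G]

theorem W_magnetic_inl (hd : 2 ≤ Fintype.card ι) (i : ι) :
    w.W (.inl ()) (.inr i) (.inl ()) (.inl ()) = 0 := by
  obtain ⟨u, v, hu, hv, -, h1, hE, hK, hW⟩ := w.exists_weyl_coeff hd
  rw [hW, riem_apply_inl]
  simp [curv_inr_inl, ric_inr_inl, G]

theorem W_inr_inr_inl_inl (hd : 2 ≤ Fintype.card ι) (i j : ι) :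
    w.W (.inr i) (.inr j) (.inl ()) (.inl ()) = 0 := by
  obtain ⟨u, v, hu, hv, -, h1, hE, hK, hW⟩ := w.exists_weyl_coeff hd
  rw [hW, riem_apply_inl]
  simp [curv_inr_inr, G]

theorem W_inr_inr_inl_inr (hd : 2 ≤ Fintype.card ι) (i j k : ι) :
    w.W (.inr i) (.inr j) (.inl ()) (.inr k) = 0 := by
  obtain ⟨u, v, hu, hv, -, h1, hE, hK, hW⟩ := w.exists_weyl_coeff hd
  rw [hW, riem_apply_inr]
  simp [curv_inr_inr, ric_inr_inl, G]

theorem W_inr_inr_inr_inl (hd : 2 ≤ Fintype.card ι) (i j k : ι) :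
    w.W (.inr i) (.inr j) (.inr k) (.inl ()) = 0 := by
  obtain ⟨u, v, hu, hv, -, h1, hE, hK, hW⟩ := w.exists_weyl_coeff hd
  rw [hW, riem_apply_inl]
  simp [curv_inr_inr, ric_inr_inl, G]

/-- The purely spatial components of the Weyl tensor; the terms in `a'` and `a''` cancel. -/
theorem W_spatial (hd : 2 ≤ Fintype.card ι) (i j k l : ι) :
    w.W (.inr i) (.inr j) (.inr k) (.inr l)
      = w.a ^ 2 * spatialWeyl w.D w.Γ w.H w.Hi i j k l := by
  obtain ⟨u, v, hu, hv, -, h1, hE, hK, hW⟩ := w.exists_weyl_coeff hd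
  have hr : riem w.WD w.WΓ w.G (.inr i) (.inr j) (.inr k) (.inr l)
      = w.a ^ 2 * riem w.D w.Γ w.H i j k l + w.a ^ 2 * w.D₀ w.a ^ 2 *
        (w.H j l * w.H i k - w.H i l * w.H j k) := by
    rw [riem_apply_inr, riem]
    have e : ∀ p, curv w.WD w.WΓ (.inr j) (.inr i) (.inr p) (.inr k) * (w.a ^ 2 * w.H p l)
        = w.a ^ 2 * (curv w.D w.Γ j i p k * w.H p l) + w.a ^ 2 * w.D₀ w.a ^ 2 *
          ((1 : Matrix ι ι A) p j * (w.H i k * w.H p l)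
            - (1 : Matrix ι ι A) p i * (w.H j k * w.H p l)) := fun p => by
      simp only [curv_inr_inr, fromBlocks_apply₂₂, Matrix.add_apply, Matrix.smul_apply, of_apply,
        smul_eq_mul]
      ring
    simp only [e, Finset.sum_add_distrib, ← Finset.mul_sum, Finset.sum_sub_distrib]
    simp only [Matrix.one_apply, ite_mul, one_mul, zero_mul, Finset.sum_ite_eq', Finset.mem_univ,
      if_true]
    ring
  rw [hW, hK, hr]
  simp only [ric_inr_inr, G_inr_inr]
  linear_combination (w.a ^ 2 * (w.H i l * w.H j k - w.H j l * w.H i k)) * (w.D₀ w.a ^ 2 * hu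
    - u * (2 * (w.a * w.D₀ (w.D₀ w.a)) + ((Fintype.card ι : A) - 1) * w.D₀ w.a ^ 2) * hv
    - u * v * w.sq_mul_scal)

theorem div4_WΓ (T : Unit ⊕ ι → Unit ⊕ ι → Unit ⊕ ι → Unit ⊕ ι → A) (j k l : Unit ⊕ ι) :
    div4 w.WD w.WΓ w.Gi T j k l = -cov4 w.WD w.WΓ T (.inl ()) j k l (.inl ())
      + w.ai ^ 2 * ∑ q, ∑ p, w.Hi q p * cov4 w.WD w.WΓ T (.inr p) j k l (.inr q) := by
  simp [div4, Fintype.sum_sum_type, Gi, Finset.mul_sum, mul_assoc]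

end WarpedData

end Warped

end DiffRing

end

noncomputable section

/-! ### The divergence of the Weyl tensor of a warped product -/

namespace DiffRing

open Matrix

variable {A : Type*} [CommRing A] [Algebra ℝ A] {ι : Type*} [Fintype ι] [DecidableEq ι]

namespace WarpedData

variable {w : WarpedData A ι}

/-- The Ricci tensor of the fibre does not depend on time. -/
theorem D₀_E (i j : ι) : w.D₀ (w.E i j) = 0 := by
  simp [E, tracefreeRic, scal, ric, curv, mul_apply, Derivation.leibniz, D₀_Γ, w.comm₀, w.static,
    D₀_Hi]

/-- The divergence of the Weyl tensor, contracted with the velocity, is proportional to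
`a'` times the trace-free Ricci tensor of the spatial metric. The time derivative, the trace of the
spatial part and the mixed terms contribute multiples of the same tensor, with total coefficient
`m - 2`. -/
theorem div_W_inl_inr_inr (hd : 2 ≤ Fintype.card ι) (i j : ι) :
    div4 w.WD w.WΓ w.Gi w.W (.inl ()) (.inr i) (.inr j) = ((Fintype.card ι : A) - 2) * w.β *
      ((1 / ((Fintype.card ι : ℝ) - 1)) • w.E i j) := by
  obtain ⟨F, hF⟩ : ∃ F : ι → ι → A, ∀ i j, (1 / ((Fintype.card ι : ℝ) - 1)) • w.E i j = F i j :=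
    ⟨_, fun _ _ => rfl⟩
  have hDF : ∀ i j, w.D₀ (F i j) = 0 := fun i j => by rw [← hF]; simp [D₀_E]
  have e1 : ∀ i j, w.W (.inl ()) (.inr i) (.inr j) (.inl ()) = -F i j := fun i j => by
    rw [W_electric hd, hF]
  have e2 : ∀ i j, w.W (.inl ()) (.inr i) (.inl ()) (.inr j) = F i j := fun i j => by
    rw [W_electric' hd, hF]
  have hK : ∑ q, ∑ p, w.Hi q p * spatialWeyl w.D w.Γ w.H w.Hi p i j q = -F i j := by
    rw [← hF]
    exact sum_inv_mul_spatialWeyl hd w.symm w.inv i j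
  rw [hF]
  have h0 : cov4 w.WD w.WΓ w.W (.inl ()) (.inl ()) (.inr i) (.inr j) (.inl ())
      = 2 * w.β * F i j := by
    simp [cov4, Fintype.sum_sum_type, WΓ, e1, WD, Matrix.one_apply, hDF,
      Finset.sum_add_distrib]
    ring
  have h1 : ∀ p q, cov4 w.WD w.WΓ w.W (.inr p) (.inl ()) (.inr i) (.inr j) (.inr q)
      = -(w.β * (w.a ^ 2 * spatialWeyl w.D w.Γ w.H w.Hi p i j q))
        - w.a ^ 2 * w.β * (w.H p j * F i q - w.H p q * F i j) := by
    intro p q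
    simp [cov4, Fintype.sum_sum_type, WΓ, e1, e2, WD,
      Matrix.one_apply, W_magnetic hd, W_spatial hd, W_self, ← a_mul_β]
    ring
  have h2 : ∀ p q, w.Hi q p * cov4 w.WD w.WΓ w.W (.inr p) (.inl ()) (.inr i) (.inr j) (.inr q)
      = -w.a ^ 2 * w.β * (w.Hi q p * spatialWeyl w.D w.Γ w.H w.Hi p i j q
        + w.Hi q p * (w.H p j * F i q) - F i j * (w.Hi q p * w.H p q)) := by
    intro p q
    rw [h1]
    ring
  rw [div4_WΓ, h0]
  simp only [h2, ← Finset.mul_sum, Finset.sum_add_distrib, Finset.sum_sub_distrib,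
    hK, sum_inv_mul_self w.inv, sum_inv_mul_left w.inv (fun q => F i q)]
  linear_combination ((Fintype.card ι : A) * w.β * F i j) * (w.a * w.ai + 1) * w.mul_ai

/-- If the fibre is Einstein, only the purely spatial components of the Weyl tensor survive. -/
theorem W_eq_zero (hd : 2 ≤ Fintype.card ι) (hE : ∀ i j, w.E i j = 0) :
    (∀ j k l, w.W (.inl ()) j k l = 0) ∧ (∀ j k l, w.W j (.inl ()) k l = 0) ∧
    (∀ j k l, w.W j k (.inl ()) l = 0) ∧ (∀ j k l, w.W j k l (.inl ()) = 0) := by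
  have h1 : ∀ j k l, w.W (.inl ()) j k l = 0 := by
    rintro (j | j) (k | k) (l | l)
    · exact w.W_self _ _ _
    · exact w.W_self _ _ _
    · exact w.W_self _ _ _
    · exact w.W_self _ _ _
    · exact W_magnetic_inl hd j
    · rw [W_electric' hd, hE, smul_zero]
    · rw [W_electric hd, hE, smul_zero, neg_zero]
    · exact W_magnetic hd j k l
  have h2 : ∀ j k l, w.W j (.inl ()) k l = 0 := fun j k l => by
    rw [w.W_antisymm (.inl ()) j, h1, neg_zero]
  refine ⟨h1, h2, ?_, ?_⟩
  · rintro (j | j) (k | k) l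
    · exact h1 _ _ _
    · exact h1 _ _ _
    · exact h2 _ _ _
    · rcases l with l | l
      · exact W_inr_inr_inl_inl hd j k
      · exact W_inr_inr_inl_inr hd j k l
  · rintro (j | j) (k | k) l
    · exact h1 _ _ _
    · exact h1 _ _ _
    · exact h2 _ _ _
    · rcases l with l | l
      · exact W_inr_inr_inl_inl hd j k
      · exact W_inr_inr_inr_inl hd j k l

theorem cov4_inl (hd : 2 ≤ Fintype.card ι) (hE : ∀ i j, w.E i j = 0) (j k l : Unit ⊕ ι) :
    cov4 w.WD w.WΓ w.W (.inl ()) j k l (.inl ()) = 0 := by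
  obtain ⟨-, -, -, h4⟩ := W_eq_zero hd hE
  simp [cov4, h4, Fintype.sum_sum_type, WΓ]

theorem div_W_antisymm (j k l : Unit ⊕ ι) :
    div4 w.WD w.WΓ w.Gi w.W k j l = -div4 w.WD w.WΓ w.Gi w.W j k l := by
  have : ∀ p m, cov4 w.WD w.WΓ w.W p k j l m = -cov4 w.WD w.WΓ w.W p j k l m := by
    intro p m
    simp only [cov4, w.W_antisymm j k, fun q => w.W_antisymm q k, fun q => w.W_antisymm j q,
      map_neg, mul_neg, Finset.sum_add_distrib, Finset.sum_neg_distrib]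
    ring
  simp only [div4, this, mul_neg, Finset.sum_neg_distrib]

/-- A warped product with Einstein fibre has divergence-free Weyl tensor. In the purely spatial
components this is the vanishing of the divergence of `spatialWeyl`. -/
theorem div_W_eq_zero (hd : 3 ≤ Fintype.card ι) (hE : ∀ i j, w.E i j = 0) (j k l : Unit ⊕ ι) :
    div4 w.WD w.WΓ w.Gi w.W j k l = 0 := by
  have hd' : 2 ≤ Fintype.card ι := by omega
  obtain ⟨h1, h2, h3, h4⟩ := W_eq_zero hd' hE
  have hinl : ∀ k l, div4 w.WD w.WΓ w.Gi w.W (.inl ()) k l = 0 := by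
    rintro (k | k) (l | l)
    · rw [div4_WΓ, cov4_inl hd' hE]
      simp [cov4, h1, h2, WΓ]
    · rw [div4_WΓ, cov4_inl hd' hE]
      simp [cov4, h1, h2, WΓ]
    · rw [div4_WΓ, cov4_inl hd' hE]
      simp [cov4, h1, h3, WΓ]
    · rw [div_W_inl_inr_inr hd', hE, smul_zero, mul_zero]
  rcases j with j | j
  · exact hinl k l
  rcases k with k | k
  · rw [div_W_antisymm (.inl ()) (.inr j), hinl, neg_zero]
  rcases l with l | l
  · -- the trace of `K_{jkpq}` over `p, q` vanishes because `K` is skew in these indices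
    have hskew : ∀ p q, spatialWeyl w.D w.Γ w.H w.Hi j k q p
        = -spatialWeyl w.D w.Γ w.H w.Hi j k p q := by
      obtain ⟨u, v, -, -, -, -, hE', hK, -⟩ := w.exists_weyl_coeff hd'
      have hr : ∀ i j, ric w.D w.Γ i j = v * scal w.D w.Γ w.Hi * w.H i j := fun i j => by
        rw [← sub_eq_zero, ← hE', hE]
      intro p q
      rw [hK, hK, w.isLeviCivita.riem_skew w.comm w.symm]
      simp only [hr]
      ring
    have hc : ∀ p q, cov4 w.WD w.WΓ w.W (.inr p) (.inr j) (.inr k) (.inl ()) (.inr q)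
        = -(w.β * w.a ^ 2 * spatialWeyl w.D w.Γ w.H w.Hi j k p q) := by
      intro p q
      simp [cov4, h3, Fintype.sum_sum_type, WΓ, W_spatial hd', Matrix.one_apply]
      ring
    rw [div4_WΓ, cov4_inl hd' hE]
    have hS : ∑ q, ∑ p, w.Hi q p * spatialWeyl w.D w.Γ w.H w.Hi j k p q = 0 := by
      have h5 : ∑ q, ∑ p, w.Hi q p * spatialWeyl w.D w.Γ w.H w.Hi j k p q
          = -∑ q, ∑ p, w.Hi q p * spatialWeyl w.D w.Γ w.H w.Hi j k p q := by
        conv_lhs => rw [Finset.sum_comm]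
        simp only [← Finset.sum_neg_distrib]
        refine Finset.sum_congr rfl fun q _ => Finset.sum_congr rfl fun p _ => ?_
        rw [w.Hi_comm, hskew, mul_neg]
      have h6 : (2 : ℝ) • ∑ q, ∑ p, w.Hi q p * spatialWeyl w.D w.Γ w.H w.Hi j k p q = 0 := by
        rw [two_smul]
        exact add_eq_zero_iff_eq_neg.mpr h5
      exact (smul_eq_zero_iff_right two_ne_zero).mp h6
    have hc' : ∀ p q, w.Hi q p * cov4 w.WD w.WΓ w.W (.inr p) (.inr j) (.inr k) (.inl ()) (.inr q)
        = -(w.β * w.a ^ 2) * (w.Hi q p * spatialWeyl w.D w.Γ w.H w.Hi j k p q) := fun p q => by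
      rw [hc]; ring
    simp only [hc', ← Finset.mul_sum, hS]
    simp
  · have hc : ∀ p q, cov4 w.WD w.WΓ w.W (.inr p) (.inr j) (.inr k) (.inr l) (.inr q)
        = w.a ^ 2 * cov4 w.D w.Γ (spatialWeyl w.D w.Γ w.H w.Hi) p j k l q := by
      intro p q
      simp [cov4, h1, h2, h3, h4, Fintype.sum_sum_type, WΓ, W_spatial hd', WD, Derivation.leibniz,
        w.a_spatial]
      rw [mul_sub, Finset.mul_sum]
      congr 1
      exact Finset.sum_congr rfl fun _ _ => by ring
    have h0 := w.isLeviCivita.div4_spatialWeyl hd w.comm w.symm w.inv hE j k l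
    rw [div4] at h0
    rw [div4_WΓ, cov4_inl hd' hE]
    simp only [hc, mul_left_comm _ (w.a ^ 2), ← Finset.mul_sum, h0]
    simp

end WarpedData

end DiffRing

end

noncomputable section

/-! ### The ring of smooth functions on an open set -/

open TopologicalSpace (Opens)

variable {E : Type*} [NormedAddCommGroup E] [NormedSpace ℝ E]

/-- The algebra of smooth functions on an open subset of a normed space, as functions on the subtype
that are restrictions of functions on the whole space that are smooth on `U`. -/
def SmoothFun (U : Opens E) : Subalgebra ℝ (U → ℝ) where
  carrier := {f | ∃ F : E → ℝ, ContDiffOn ℝ ∞ F U ∧ ∀ y : U, F y = f y}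
  mul_mem' := by
    rintro f g ⟨F, hF, hf⟩ ⟨G, hG, hg⟩
    exact ⟨fun y => F y * G y, hF.mul hG, fun y => by simp [hf, hg]⟩
  add_mem' := by
    rintro f g ⟨F, hF, hf⟩ ⟨G, hG, hg⟩
    exact ⟨fun y => F y + G y, hF.add hG, fun y => by simp [hf, hg]⟩
  algebraMap_mem' := fun r => ⟨fun _ => r, contDiffOn_const, fun _ => rfl⟩

namespace SmoothFun

variable {U : Opens E}

/-- Evaluation of smooth functions at a point. -/
def ev (y : U) : SmoothFun U →ₐ[ℝ] ℝ := (Pi.evalAlgHom ℝ (fun _ : U => ℝ) y).comp (SmoothFun U).val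

/-- A function that is smooth on `U`, as an element of the ring of smooth functions. -/
def mk (F : E → ℝ) (hF : ContDiffOn ℝ ∞ F U) : SmoothFun U := ⟨fun y => F y, F, hF, fun _ => rfl⟩

@[simp] theorem ev_mk (F : E → ℝ) (hF : ContDiffOn ℝ ∞ F U) (y : U) : ev y (mk F hF) = F y := rfl

theorem ext_ev {f g : SmoothFun U} (h : ∀ y, ev y f = ev y g) : f = g :=
  Subtype.ext (funext h)

/-- A chosen extension of a smooth function on `U` to the whole space; it is arbitrary outside
`U`. -/
def extend (f : SmoothFun U) : E → ℝ := f.2.choose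

theorem contDiffOn_extend (f : SmoothFun U) : ContDiffOn ℝ ∞ (extend f) U := f.2.choose_spec.1

@[simp] theorem extend_apply (f : SmoothFun U) (y : U) : (extend f) y = ev y f :=
  f.2.choose_spec.2 y

theorem contDiffAt_extend (f : SmoothFun U) (y : U) : ContDiffAt ℝ ∞ (extend f) (y : E) :=
  (contDiffOn_extend f).contDiffAt (U.2.mem_nhds y.2)

theorem differentiableAt_extend (f : SmoothFun U) (y : U) : DifferentiableAt ℝ (extend f) (y : E) :=
  (contDiffAt_extend f y).differentiableAt (by simp)

/-- Any function that agrees with `f` on `U` has the same germs as the chosen extension. -/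
theorem extend_eventuallyEq {f : SmoothFun U} {F : E → ℝ} (h : ∀ y : U, F y = ev y f) (y : U) :
    (extend f) =ᶠ[𝓝 (y : E)] F := by
  filter_upwards [U.2.mem_nhds y.2] with z hz
  rw [extend_apply f ⟨z, hz⟩, ← h ⟨z, hz⟩]

theorem contDiffOn_fderiv_apply (f : SmoothFun U) (v : E) :
    ContDiffOn ℝ ∞ (fun y => fderiv ℝ (extend f) y v) U :=
  ((contDiffOn_extend f).fderiv_of_isOpen U.2 (m := ∞) (by simp)).clm_apply contDiffOn_const

/-- The directional derivative along `v`, as a derivation of the ring of smooth functions. -/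
def dir (U : Opens E) (v : E) : Derivation ℝ (SmoothFun U) (SmoothFun U) :=
  Derivation.mk'
    { toFun := fun f => mk (fun y => fderiv ℝ (extend f) y v) (contDiffOn_fderiv_apply f v)
      map_add' := fun f g => ext_ev fun y => by
        have h : (extend (f + g)) =ᶠ[𝓝 (y : E)] (extend f) + (extend g) :=
          extend_eventuallyEq (fun z => by simp) y
        rw [ev_mk, h.fderiv_eq, fderiv_add (differentiableAt_extend f y)
          (differentiableAt_extend g y)]
        simp
      map_smul' := fun c f => ext_ev fun y => by
        have h : (extend (c • f)) =ᶠ[𝓝 (y : E)] c • (extend f) :=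
          extend_eventuallyEq (fun z => by simp) y
        rw [ev_mk, h.fderiv_eq, fderiv_const_smul (differentiableAt_extend f y)]
        simp }
    fun f g => ext_ev fun y => by
      have h : (extend (f * g)) =ᶠ[𝓝 (y : E)] (extend f) * (extend g) :=
        extend_eventuallyEq (fun z => by simp) y
      simp only [LinearMap.coe_mk, AddHom.coe_mk]
      rw [ev_mk, h.fderiv_eq, fderiv_mul (differentiableAt_extend f y)
        (differentiableAt_extend g y)]
      simp

theorem ev_dir {f : SmoothFun U} {F : E → ℝ} (h : ∀ y : U, F y = ev y f) (v : E) (y : U) :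
    ev y (dir U v f) = fderiv ℝ F y v := by
  rw [← (extend_eventuallyEq h y).fderiv_eq]
  rfl

/-- Directional derivatives commute, by the symmetry of the second derivative. -/
theorem dir_comm (v w : E) (f : SmoothFun U) : dir U v (dir U w f) = dir U w (dir U v f) := by
  have key : ∀ v w : E, ∀ y : U, ev y (dir U v (dir U w f))
      = fderiv ℝ (fderiv ℝ (extend f)) y v w := by
    intro v w y
    rw [ev_dir (F := fun z => fderiv ℝ (extend f) z w) (fun z => rfl)]
    have hd : DifferentiableAt ℝ (fderiv ℝ (extend f)) y :=
      ((contDiffAt_extend f y).fderiv_right (m := ∞) (by simp)).differentiableAt (by simp)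
    rw [fderiv_clm_apply hd (differentiableAt_const w)]
    simp
  refine ext_ev fun y => ?_
  rw [key, key]
  exact ((contDiffAt_extend f y).isSymmSndFDerivAt
    (by simpa using WithTop.coe_le_coe.2 (le_top : (2 : ℕ∞) ≤ ⊤))).eq v w

theorem isUnit_of_ne_zero {f : SmoothFun U} (h : ∀ y, ev y f ≠ 0) : IsUnit f := by
  refine IsUnit.of_mul_eq_one (mk (fun y => (extend f y)⁻¹)
    ((contDiffOn_extend f).inv fun y hy => ?_)) (ext_ev fun y => ?_)
  · rw [extend_apply f ⟨y, hy⟩]; exact h _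
  · simp [h y]

end SmoothFun

/-! ### Coordinate formulas as identities in the ring of smooth functions -/

open SmoothFun DiffRing

variable {E' : Type*} [NormedAddCommGroup E'] [NormedSpace ℝ E']
  {ι : Type*} [Fintype ι] [DecidableEq ι]

/-- The function `F` of the coordinates `φ` is the smooth function `f`: `F ∘ φ = f` on `U`. -/
def Reads {U : Opens E} (φ : U → E') (F : E' → ℝ) (f : SmoothFun U) : Prop :=
  ∀ y, F (φ y) = ev y f

/-- The derivations `D i` are the partial derivatives in the coordinates `φ`. -/
def IsFrame {U : Opens E} (φ : U → E') (b : Module.Basis ι ℝ E')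
    (D : ι → Derivation ℝ (SmoothFun U) (SmoothFun U)) : Prop :=
  ∀ F f, Reads φ F f → ∀ i, Reads φ (Coord.pd b F i) (D i f)

theorem isFrame_dir (U : Opens E) (b : Module.Basis ι ℝ E) :
    IsFrame (fun y : U => (y : E)) b (fun i => dir U (b i)) :=
  fun _ _ h i y => (ev_dir h (b i) y).symm

namespace IsFrame

variable {U : Opens E} {φ : U → E'} {b : Module.Basis ι ℝ E'}
  {D : ι → Derivation ℝ (SmoothFun U) (SmoothFun U)} {G : E' → Matrix ι ι ℝ}
  {g gi : Matrix ι ι (SmoothFun U)}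

theorem christoffel (h : IsFrame φ b D) (hG : ∀ i j, Reads φ (fun z => G z i j) (g i j))
    (hGi : ∀ i j, Reads φ (fun z => (G z)⁻¹ i j) (gi i j)) (k i j : ι) :
    Reads φ (Coord.christoffel b G k i j) (levi D g gi i k j) := by
  intro y
  simp only [Coord.christoffel, levi, Matrix.of_apply, map_smul, map_sum, map_mul, map_add, map_sub,
    smul_eq_mul, ← h _ _ (hG _ _) _ y, ← hGi _ _ y]

theorem riemannUp (h : IsFrame φ b D) (hG : ∀ i j, Reads φ (fun z => G z i j) (g i j))
    (hGi : ∀ i j, Reads φ (fun z => (G z)⁻¹ i j) (gi i j)) (j k l m : ι) :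
    Reads φ (Coord.riemannUp b G j k l m) (curv D (levi D g gi) k j m l) := by
  intro y
  simp only [Coord.riemannUp, curv, Matrix.add_apply, Matrix.sub_apply, Matrix.mul_apply,
    Matrix.map_apply, map_sum, map_mul, map_add, map_sub, ← h _ _ (h.christoffel hG hGi _ _ _) _ y,
    ← h.christoffel hG hGi _ _ _ y, Finset.sum_sub_distrib]
  ring

theorem ricci (h : IsFrame φ b D) (hG : ∀ i j, Reads φ (fun z => G z i j) (g i j))
    (hGi : ∀ i j, Reads φ (fun z => (G z)⁻¹ i j) (gi i j)) (k l : ι) :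
    Reads φ (Coord.ricci b G k l) (ric D (levi D g gi) k l) := by
  intro y
  simp only [Coord.ricci, ric, map_neg, map_sum, ← h.riemannUp hG hGi _ _ _ _ y]

theorem scalar (h : IsFrame φ b D) (hG : ∀ i j, Reads φ (fun z => G z i j) (g i j))
    (hGi : ∀ i j, Reads φ (fun z => (G z)⁻¹ i j) (gi i j)) :
    Reads φ (Coord.scalar b G) (scal D (levi D g gi) gi) := by
  intro y
  simp only [Coord.scalar, scal, map_mul, map_sum, ← h.ricci hG hGi _ _ y, ← hGi _ _ y]

theorem weyl (h : IsFrame φ b D) (hG : ∀ i j, Reads φ (fun z => G z i j) (g i j))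
    (hGi : ∀ i j, Reads φ (fun z => (G z)⁻¹ i j) (gi i j)) (j k l m : ι) :
    Reads φ (Coord.weyl b G j k l m)
      (DiffRing.weyl (Fintype.card ι) D (levi D g gi) g gi j k l m) := by
  intro y
  simp only [Coord.weyl, Coord.riemann, DiffRing.weyl, riem, map_add, map_sub, map_smul, map_mul,
    map_sum, smul_eq_mul, ← h.ricci hG hGi _ _ y, ← h.scalar hG hGi y,
    ← h.riemannUp hG hGi _ _ _ _ y, ← hG _ _ y]
  ring

theorem divWeyl (h : IsFrame φ b D) (hG : ∀ i j, Reads φ (fun z => G z i j) (g i j))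
    (hGi : ∀ i j, Reads φ (fun z => (G z)⁻¹ i j) (gi i j)) (j k l : ι) :
    Reads φ (Coord.divWeyl b G j k l) (div4 D (levi D g gi) gi
      (DiffRing.weyl (Fintype.card ι) D (levi D g gi) g gi) j k l) := by
  intro y
  simp only [Coord.divWeyl, div4, Coord.cov4, cov4, map_add, map_sub, map_mul,
    map_sum, ← h.weyl hG hGi _ _ _ _ y, ← h _ _ (h.weyl hG hGi _ _ _ _) _ y,
    ← h.christoffel hG hGi _ _ _ y, ← hGi _ _ y]

end IsFrame

/-- A matrix of smooth functions that is invertible at every point is invertible over the ring of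
smooth functions, with the pointwise inverse. -/
theorem Matrix.exists_inv_of_ev {U : Opens E} {φ : U → E'} {G : E' → Matrix ι ι ℝ}
    {g : Matrix ι ι (SmoothFun U)} (hG : ∀ i j, Reads φ (fun z => G z i j) (g i j))
    (hdet : ∀ y, IsUnit (G (φ y)).det) :
    ∃ gi : Matrix ι ι (SmoothFun U), gi * g = 1 ∧
      ∀ i j, Reads φ (fun z => (G z)⁻¹ i j) (gi i j) := by
  have hmap : ∀ y, (ev y).mapMatrix g = G (φ y) := fun y => by
    ext i j; exact (hG i j y).symm
  have hu : IsUnit g.det := by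
    refine isUnit_of_ne_zero fun y => ?_
    rw [AlgHom.map_det, hmap]
    exact (hdet y).ne_zero
  refine ⟨g⁻¹, g.nonsing_inv_mul hu, fun i j y => ?_⟩
  have h1 : (ev y).mapMatrix g⁻¹ * G (φ y) = 1 := by
    rw [← hmap, ← map_mul, g.nonsing_inv_mul hu, map_one]
  have h2 := Matrix.inv_eq_left_inv h1
  simp only [h2]
  rfl

end

noncomputable section

/-! ### The curvature of a generalized Robertson–Walker metric in a product chart -/

open TopologicalSpace (Opens)
open SmoothFun DiffRing

/-- The trace-free part of the Ricci tensor of the metric `G` in coordinates. -/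
def Coord.tracefreeRicci {ι : Type*} [Fintype ι] [DecidableEq ι] {E : Type*}
    [NormedAddCommGroup E] [NormedSpace ℝ E] (b : Module.Basis ι ℝ E) (G : E → Matrix ι ι ℝ)
    (k l : ι) (y : E) : ℝ :=
  Coord.ricci b G k l y - 1 / (Fintype.card ι : ℝ) * (Coord.scalar b G y * G y k l)

namespace GRW

variable {m : ℕ}

/-- The standard basis of the coordinate space of the fibre. -/
abbrev fibreBasis (m : ℕ) : Module.Basis (Fin m) ℝ (EuclideanSpace ℝ (Fin m)) :=
  (EuclideanSpace.basisFun (Fin m) ℝ).toBasis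

theorem basis_inl (m : ℕ) : basis m (.inl ()) = ((1 : ℝ), (0 : EuclideanSpace ℝ (Fin m))) := by
  simp [basis]

theorem basis_inr (m : ℕ) (i : Fin m) : basis m (.inr i) = ((0 : ℝ), fibreBasis m i) := by
  simp [basis]

/-- On `I × V` the matrix `G` is that of the warped product metric `-dt² + a(t)² H(x)`, where
`H` is a nondegenerate metric on `V`. -/
structure IsWarped (I : Opens ℝ) (V : Opens (EuclideanSpace ℝ (Fin m))) (a : ℝ → ℝ)
    (H : EuclideanSpace ℝ (Fin m) → Matrix (Fin m) (Fin m) ℝ)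
    (G : ℝ × EuclideanSpace ℝ (Fin m) → Matrix (Unit ⊕ Fin m) (Unit ⊕ Fin m) ℝ) : Prop where
  smooth_a : ContDiffOn ℝ ∞ a I
  pos : ∀ t ∈ I, 0 < a t
  smooth_H : ∀ i j, ContDiffOn ℝ ∞ (fun x => H x i j) V
  symm : ∀ x ∈ V, ∀ i j, H x i j = H x j i
  det : ∀ x ∈ V, IsUnit (H x).det
  eq : ∀ t ∈ I, ∀ x ∈ V, G (t, x) = Matrix.fromBlocks (-1) 0 0 (a t ^ 2 • H x)

/-- The product of two open sets of coordinates. -/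
def prodOpens (I : Opens ℝ) (V : Opens (EuclideanSpace ℝ (Fin m))) :
    Opens (ℝ × EuclideanSpace ℝ (Fin m)) := ⟨(I : Set ℝ) ×ˢ V, I.2.prod V.2⟩

variable {I : Opens ℝ} {V : Opens (EuclideanSpace ℝ (Fin m))}

theorem ev_dir_inl {f : SmoothFun (prodOpens I V)} {F : ℝ → ℝ}
    (h : ∀ y : prodOpens I V, F y.1.1 = ev y f) (y : prodOpens I V) :
    ev y (dir _ (basis m (.inl ())) f) = deriv F y.1.1 := by
  have h1 : F =ᶠ[𝓝 y.1.1] fun t => extend f (t, y.1.2) := by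
    filter_upwards [I.2.mem_nhds y.2.1] with t ht
    exact (h ⟨(t, y.1.2), ht, y.2.2⟩).trans (extend_apply f ⟨(t, y.1.2), ht, y.2.2⟩).symm
  have h2 : HasDerivAt (fun t => extend f (t, y.1.2))
      (fderiv ℝ (extend f) y.1 ((1 : ℝ), (0 : EuclideanSpace ℝ (Fin m)))) y.1.1 :=
    (differentiableAt_extend f y).hasFDerivAt.comp_hasDerivAt_of_eq _
      ((hasDerivAt_id _).prodMk (hasDerivAt_const _ _)) rfl
  rw [basis_inl, (h2.congr_of_eventuallyEq h1).deriv]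
  exact ev_dir (fun z => extend_apply f z) _ _

/-- On functions of the fibre coordinates alone, the spatial derivatives of the product are those of
the fibre. -/
theorem isFrame_snd : IsFrame (fun y : prodOpens I V => y.1.2) (fibreBasis m)
    (fun i => dir _ (basis m (.inr i))) := by
  intro F f h i y
  have h1 : F =ᶠ[𝓝 y.1.2] fun x => extend f (y.1.1, x) := by
    filter_upwards [V.2.mem_nhds y.2.2] with x hx
    exact (h ⟨(y.1.1, x), y.2.1, hx⟩).trans (extend_apply f ⟨(y.1.1, x), y.2.1, hx⟩).symm
  have h2 : HasFDerivAt (fun x => extend f (y.1.1, x))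
      ((fderiv ℝ (extend f) y.1).comp (ContinuousLinearMap.inr ℝ ℝ _)) y.1.2 := by
    have h3 : HasFDerivAt (extend f) (fderiv ℝ (extend f) y.1) (y.1.1, y.1.2) :=
      (differentiableAt_extend f y).hasFDerivAt
    exact h3.comp y.1.2 (hasFDerivAt_prodMk_right y.1.1 y.1.2)
  rw [Coord.pd, (h2.congr_of_eventuallyEq h1).fderiv, ev_dir (fun z => extend_apply f z), basis_inr]
  rfl

namespace IsWarped

variable {a : ℝ → ℝ} {H : EuclideanSpace ℝ (Fin m) → Matrix (Fin m) (Fin m) ℝ}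
  {G : ℝ × EuclideanSpace ℝ (Fin m) → Matrix (Unit ⊕ Fin m) (Unit ⊕ Fin m) ℝ}

/-- The warped product data over the ring of smooth functions on `I × V`. -/
theorem exists_warpedData (h : IsWarped I V a H G) :
    ∃ w : WarpedData (SmoothFun (prodOpens I V)) (Fin m),
      w.D₀ = dir _ (basis m (.inl ())) ∧ (w.D = fun i => dir _ (basis m (.inr i))) ∧
      (∀ y, ev y w.a = a y.1.1) ∧
      (∀ i j, Reads (fun y : prodOpens I V => y.1.2) (fun x => H x i j) (w.H i j)) ∧
      (∀ i j, Reads (fun y : prodOpens I V => y.1.2) (fun x => (H x)⁻¹ i j) (w.Hi i j)) := by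
  have hm1 : Set.MapsTo Prod.fst (prodOpens I V : Set (ℝ × EuclideanSpace ℝ (Fin m))) I :=
    fun y hy => hy.1
  have hm2 : Set.MapsTo Prod.snd (prodOpens I V : Set (ℝ × EuclideanSpace ℝ (Fin m))) V :=
    fun y hy => hy.2
  let g : Matrix (Fin m) (Fin m) (SmoothFun (prodOpens I V)) := Matrix.of fun i j =>
    SmoothFun.mk (fun y => H y.2 i j) ((h.smooth_H i j).comp contDiffOn_snd hm2)
  have hg : ∀ i j, Reads (fun y : prodOpens I V => y.1.2) (fun x => H x i j) (g i j) :=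
    fun i j y => rfl
  obtain ⟨gi, hgi, hgi'⟩ := Matrix.exists_inv_of_ev hg (fun y => h.det _ y.2.2)
  have ha : ContDiffOn ℝ ∞ (fun y : ℝ × EuclideanSpace ℝ (Fin m) => a y.1) (prodOpens I V) :=
    h.smooth_a.comp contDiffOn_fst hm1
  refine ⟨{ D₀ := dir _ (basis m (.inl ()))
            D := fun i => dir _ (basis m (.inr i))
            H := g
            Hi := gi
            a := SmoothFun.mk _ ha
            ai := SmoothFun.mk (fun y => (a y.1)⁻¹) (ha.inv fun y hy => (h.pos _ hy.1).ne')
            comm := fun i j x => dir_comm _ _ x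
            comm₀ := fun i x => dir_comm _ _ x
            symm := ?_
            inv := hgi
            static := ?_
            a_spatial := ?_
            mul_ai := ?_ }, rfl, rfl, fun y => rfl, hg, hgi'⟩
  · ext i j : 1
    exact ext_ev fun y => h.symm _ y.2.2 j i
  · intro i j
    refine ext_ev fun y => ?_
    rw [ev_dir (F := fun y => H y.2 i j) (fun _ => rfl), basis_inl]
    have h2 := ((h.smooth_H i j).contDiffAt (V.2.mem_nhds y.2.2)).differentiableAt (by simp)
    have h3 : HasFDerivAt (fun y : ℝ × EuclideanSpace ℝ (Fin m) => H y.2 i j) _ y.1 :=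
      h2.hasFDerivAt.comp y.1 hasFDerivAt_snd
    rw [h3.fderiv]
    simp
  · intro i
    refine ext_ev fun y => ?_
    rw [ev_dir (F := fun y => a y.1) (fun _ => rfl), basis_inr]
    have h2 := (h.smooth_a.contDiffAt (I.2.mem_nhds y.2.1)).differentiableAt (by simp)
    have h3 : HasFDerivAt (fun y : ℝ × EuclideanSpace ℝ (Fin m) => a y.1) _ y.1 :=
      h2.hasFDerivAt.comp y.1 hasFDerivAt_fst
    rw [h3.fderiv]
    simp
  · refine ext_ev fun y => ?_
    simp [(h.pos _ y.2.1).ne']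

/-- The coordinate expressions of the curvature of the fibre and of the total space are those
of a warped product over the ring of smooth functions on `I × V`. -/
theorem exists_reads (h : IsWarped I V a H G) :
    ∃ w : WarpedData (SmoothFun (prodOpens I V)) (Fin m),
      (∀ y, ev y w.a = a y.1.1 ∧ ev y (w.D₀ w.a) = deriv a y.1.1 ∧
        ev y (w.D₀ (w.D₀ w.a)) = deriv (deriv a) y.1.1 ∧ ev y w.ai = (a y.1.1)⁻¹ ∧
        (∀ i j, ev y (w.H i j) = H y.1.2 i j) ∧
        (∀ i j, ev y (ric w.D w.Γ i j) = Coord.ricci (fibreBasis m) H i j y.1.2) ∧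
        (∀ i j, ev y (w.E i j) = Coord.tracefreeRicci (fibreBasis m) H i j y.1.2)) ∧
      (∀ y i j, ev y (ric w.WD w.WΓ i j) = Coord.ricci (basis m) G i j y) ∧
      (∀ y j k l p, ev y (w.W j k l p) = Coord.weyl (basis m) G j k l p y) ∧
      (∀ y j k l, ev y (div4 w.WD w.WΓ w.Gi w.W j k l) = Coord.divWeyl (basis m) G j k l y) := by
  obtain ⟨w, hD₀, hD, ha, hH, hHi⟩ := h.exists_warpedData
  have hf1 : IsFrame (fun y : prodOpens I V => y.1.2) (fibreBasis m) w.D := by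
    rw [hD]; exact isFrame_snd
  have hf2 : IsFrame (fun y : prodOpens I V => y.1) (basis m) w.WD := by
    have : w.WD = fun i => dir _ (basis m i) := by
      ext i : 1
      rcases i with i | i <;> simp [WarpedData.WD, hD₀, hD]
    rw [this]
    exact isFrame_dir _ _
  have hai : ∀ y, ev y w.ai = (a y.1.1)⁻¹ := fun y => by
    have := congrArg (ev y) w.mul_ai
    rw [map_mul, ha, map_one] at this
    exact eq_inv_of_mul_eq_one_right this
  have hG : ∀ i j, Reads (fun y : prodOpens I V => y.1) (fun z => G z i j) (w.G i j) := by
    intro i j y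
    have e : G y.1 = _ := h.eq y.1.1 y.2.1 y.1.2 y.2.2
    simp only [e]
    rcases i with i | i <;> rcases j with j | j <;> simp [WarpedData.G, ha, ← hH _ _ y]
  have hGi : ∀ i j, Reads (fun y : prodOpens I V => y.1) (fun z => (G z)⁻¹ i j) (w.Gi i j) := by
    intro i j y
    have h1 : (ev y).mapMatrix w.Gi * G y.1 = 1 := by
      have h2 : G y.1 = (ev y).mapMatrix w.G := by ext i j; exact hG i j y
      rw [h2, ← map_mul, w.Gi_mul_G, map_one]
    simp only [Matrix.inv_eq_left_inv h1]
    rfl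
  have hΓ : w.WΓ = levi w.WD w.G w.Gi := funext fun i =>
    (w.isLeviCivita_WΓ.levi_eq w.G_transpose w.Gi_mul_G i).symm
  have hn : ((Fintype.card (Unit ⊕ Fin m) : ℕ) : ℝ) = (Fintype.card (Fin m) : ℝ) + 1 := by
    simp [add_comm]
  refine ⟨w, fun y => ?_, fun y i j => ?_, fun y j k l p => ?_, fun y j k l => ?_⟩
  · have h1 : ∀ z : prodOpens I V, deriv a z.1.1 = ev z (w.D₀ w.a) := fun z => by
      rw [hD₀, ev_dir_inl (fun z => (ha z).symm)]
    refine ⟨ha y, (h1 y).symm, ?_, hai y, fun i j => (hH i j y).symm,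
      fun i j => (hf1.ricci hH hHi i j y).symm, fun i j => ?_⟩
    · conv_lhs => rw [hD₀]
      rw [ev_dir_inl (by rw [← hD₀]; exact h1)]
    · rw [WarpedData.E, tracefreeRic, Coord.tracefreeRicci, map_sub, map_smul, map_mul,
        ← hH i j y, hf1.ricci hH hHi i j y, hf1.scalar hH hHi y]
      rfl
  · rw [hΓ]; exact (hf2.ricci hG hGi i j y).symm
  · rw [hf2.weyl hG hGi j k l p y, ← hΓ, hn]; rfl
  · rw [hf2.divWeyl hG hGi j k l y, ← hΓ, hn]; rfl

variable {t : ℝ} {x : EuclideanSpace ℝ (Fin m)}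

theorem ricci_inl_inl (h : IsWarped I V a H G) (ht : t ∈ I) (hx : x ∈ V) :
    Coord.ricci (basis m) G (.inl ()) (.inl ()) (t, x) = -(m * (deriv (deriv a) t * (a t)⁻¹)) := by
  obtain ⟨w, h1, h2, -, -⟩ := h.exists_reads
  obtain ⟨e1, e2, e3, e4, -⟩ := h1 ⟨(t, x), ht, hx⟩
  rw [← h2 ⟨(t, x), ht, hx⟩, w.ric_inl_inl]
  simp [e3, e4]

theorem ricci_inl_inr (h : IsWarped I V a H G) (ht : t ∈ I) (hx : x ∈ V) (l : Fin m) :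
    Coord.ricci (basis m) G (.inl ()) (.inr l) (t, x) = 0 := by
  obtain ⟨w, h1, h2, -, -⟩ := h.exists_reads
  rw [← h2 ⟨(t, x), ht, hx⟩, w.ric_inl_inr, map_zero]

theorem ricci_inr_inl (h : IsWarped I V a H G) (ht : t ∈ I) (hx : x ∈ V) (k : Fin m) :
    Coord.ricci (basis m) G (.inr k) (.inl ()) (t, x) = 0 := by
  obtain ⟨w, h1, h2, -, -⟩ := h.exists_reads
  rw [← h2 ⟨(t, x), ht, hx⟩, w.ric_inr_inl, map_zero]

theorem ricci_inr_inr (h : IsWarped I V a H G) (ht : t ∈ I) (hx : x ∈ V) (k l : Fin m) :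
    Coord.ricci (basis m) G (.inr k) (.inr l) (t, x) = Coord.ricci (fibreBasis m) H k l x
      + (a t * deriv (deriv a) t + (m - 1) * deriv a t ^ 2) * H x k l := by
  obtain ⟨w, h1, h2, -, -⟩ := h.exists_reads
  obtain ⟨e1, e2, e3, e4, e5, e6, -⟩ := h1 ⟨(t, x), ht, hx⟩
  rw [← h2 ⟨(t, x), ht, hx⟩, w.ric_inr_inr]
  simp [e1, e2, e3, e5, e6]

theorem weyl_electric (h : IsWarped I V a H G) (hm : 3 ≤ m) (ht : t ∈ I) (hx : x ∈ V)
    (i j : Fin m) : Coord.weyl (basis m) G (.inl ()) (.inr i) (.inr j) (.inl ()) (t, x)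
      = -(1 / ((m : ℝ) - 1) * Coord.tracefreeRicci (fibreBasis m) H i j x) := by
  obtain ⟨w, h1, -, h3, -⟩ := h.exists_reads
  obtain ⟨-, -, -, -, -, -, e7⟩ := h1 ⟨(t, x), ht, hx⟩
  rw [← h3 ⟨(t, x), ht, hx⟩, w.W_electric (by simp; omega)]
  simp [e7]

theorem divWeyl_inl_inr_inr (h : IsWarped I V a H G) (hm : 3 ≤ m) (ht : t ∈ I) (hx : x ∈ V)
    (i j : Fin m) : Coord.divWeyl (basis m) G (.inl ()) (.inr i) (.inr j) (t, x)
      = ((m : ℝ) - 2) * (deriv a t * (a t)⁻¹) *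
        (1 / ((m : ℝ) - 1) * Coord.tracefreeRicci (fibreBasis m) H i j x) := by
  obtain ⟨w, h1, -, -, h4⟩ := h.exists_reads
  obtain ⟨e1, e2, e3, e4, e5, e6, e7⟩ := h1 ⟨(t, x), ht, hx⟩
  rw [← h4 ⟨(t, x), ht, hx⟩, w.div_W_inl_inr_inr (by simp; omega)]
  simp only [WarpedData.β, map_mul, map_sub, map_smul, map_natCast, map_ofNat, e2, e4, e7,
    Fintype.card_fin, smul_eq_mul]

theorem weyl_inl_eq_zero (h : IsWarped I V a H G) (hm : 3 ≤ m)
    (hE : ∀ x ∈ V, ∀ i j, Coord.tracefreeRicci (fibreBasis m) H i j x = 0)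
    (ht : t ∈ I) (hx : x ∈ V) (j k l : Unit ⊕ Fin m) :
    Coord.weyl (basis m) G j k l (.inl ()) (t, x) = 0 := by
  obtain ⟨w, h1, -, h3, -⟩ := h.exists_reads
  have hE' : ∀ i j, w.E i j = 0 := fun i j => ext_ev fun y => by
    obtain ⟨-, -, -, -, -, -, e7⟩ := h1 y
    rw [e7, hE _ y.2.2, map_zero]
  rw [← h3 ⟨(t, x), ht, hx⟩, (w.W_eq_zero (by simp; omega) hE').2.2.2, map_zero]

theorem divWeyl_eq_zero (h : IsWarped I V a H G) (hm : 3 ≤ m)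
    (hE : ∀ x ∈ V, ∀ i j, Coord.tracefreeRicci (fibreBasis m) H i j x = 0)
    (ht : t ∈ I) (hx : x ∈ V) (j k l : Unit ⊕ Fin m) :
    Coord.divWeyl (basis m) G j k l (t, x) = 0 := by
  obtain ⟨w, h1, -, -, h4⟩ := h.exists_reads
  have hE' : ∀ i j, w.E i j = 0 := fun i j => ext_ev fun y => by
    obtain ⟨-, -, -, -, -, -, e7⟩ := h1 y
    rw [e7, hE _ y.2.2, map_zero]
  rw [← h4 ⟨(t, x), ht, hx⟩, w.div_W_eq_zero (by simp; omega) hE', map_zero]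

end IsWarped

end GRW

end

noncomputable section

/-! ### Invariance of the scalar curvature under changes of coordinates -/

namespace DiffRing

open Matrix

variable {A : Type*} [CommRing A] [Algebra ℝ A] {ι : Type*} [Fintype ι] [DecidableEq ι]

/-- A change of coordinates: the derivations `D` and `D'` are related by the Jacobian matrix `J`
with inverse `K`, and the metrics `g` and `g'` by the tensor transformation law. The condition
`closed` says that the rows of `J` are gradients. -/
structure CoordChange (D D' : ι → Derivation ℝ A A) (J K g g' gi gi' : Matrix ι ι A) : Prop where
  frame : ∀ i x, D i x = ∑ a, J a i * D' a x
  closed : ∀ i j a, D i (J a j) = D j (J a i)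
  inv : K * J = 1
  symm : g'ᵀ = g'
  metric : g = Jᵀ * g' * J
  metric_inv : gi * g = 1
  metric_inv' : gi' * g' = 1

namespace CoordChange

variable {D D' : ι → Derivation ℝ A A} {J K g g' gi gi' : Matrix ι ι A}

/-- The pull-back of the Levi-Civita connection of `g'`. -/
def pullback (D' : ι → Derivation ℝ A A) (J g' gi' : Matrix ι ι A) (i : ι) : Matrix ι ι A :=
  ∑ a, J a i • levi D' g' gi' a

theorem inv' (h : CoordChange D D' J K g g' gi gi') : J * K = 1 := mul_eq_one_comm.mp h.inv

theorem map_frame (h : CoordChange D D' J K g g' gi gi') (M : Matrix ι ι A)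
    (i : ι) : M.map (D i) = ∑ a, J a i • M.map (D' a) := by
  ext p q
  simp [Matrix.sum_apply, h.frame]

/-- The Levi-Civita connection of `g` is a gauge transform of the pull-back of that of `g'`. -/
theorem levi_eq (h : CoordChange D D' J K g g' gi gi') (i : ι) :
    levi D g gi i = K * (pullback D' J g' gi' i * J + J.map (D i)) := by
  have hg : gᵀ = g := by
    rw [h.metric]; simp only [transpose_mul, transpose_transpose, h.symm, mul_assoc]
  have hlc := isLeviCivita_levi (D := D') h.symm h.metric_inv'
  refine IsLeviCivita.levi_eq (Γ := fun i => K * (pullback D' J g' gi' i * J + J.map (D i))) hg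
    h.metric_inv
    ⟨fun i j k => ?_, fun i => ?_⟩ i
  · have key : ∀ c, (pullback D' J g' gi' i * J + J.map (D i)) c j
        = (pullback D' J g' gi' j * J + J.map (D j)) c i := by
      intro c
      simp only [pullback, Matrix.add_apply, mul_apply, Matrix.sum_apply, Matrix.smul_apply,
        smul_eq_mul, map_apply, h.closed i j c, Finset.sum_mul]
      congr 1
      rw [Finset.sum_comm]
      refine Finset.sum_congr rfl fun a _ => Finset.sum_congr rfl fun b _ => ?_
      rw [hlc.symm a b c]
      ring
    simp only [Matrix.mul_apply (M := K), key]
  · have e1 : J * (K * (pullback D' J g' gi' i * J + J.map (D i)))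
        = pullback D' J g' gi' i * J + J.map (D i) := by
      rw [← mul_assoc, h.inv', one_mul]
    have e2 : g'.map (D i) = (pullback D' J g' gi' i)ᵀ * g' + g' * pullback D' J g' gi' i := by
      rw [h.map_frame, pullback, transpose_sum, Finset.sum_mul, Finset.mul_sum,
        ← Finset.sum_add_distrib]
      refine Finset.sum_congr rfl fun a _ => ?_
      rw [hlc.compat, smul_add, transpose_smul, Matrix.smul_mul, Matrix.mul_smul]
    have e3 : (K * (pullback D' J g' gi' i * J + J.map (D i)))ᵀ * Jᵀ
        = (pullback D' J g' gi' i * J + J.map (D i))ᵀ := by rw [← transpose_mul, e1]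
    calc g.map (D i)
        = (pullback D' J g' gi' i * J + J.map (D i))ᵀ * g' * J
          + Jᵀ * g' * (pullback D' J g' gi' i * J + J.map (D i)) := by
          rw [h.metric]
          simp only [map_derivation_mul, e2, map_derivation_transpose, transpose_add,
            transpose_mul]
          noncomm_ring
      _ = (K * (pullback D' J g' gi' i * J + J.map (D i)))ᵀ * g
          + g * (K * (pullback D' J g' gi' i * J + J.map (D i))) := by
          conv_rhs => rw [h.metric, mul_assoc (Jᵀ * g'), e1, ← mul_assoc, ← mul_assoc, e3]

/-- The curvature of the pulled-back connection is the pull-back of the curvature. -/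
theorem curv_pullback (h : CoordChange D D' J K g g' gi gi') (i j : ι) :
    curv D (pullback D' J g' gi') i j
      = ∑ a, ∑ b, (J a i * J b j) • curv D' (levi D' g' gi') a b := by
  set Γ' := levi D' g' gi'
  have e1 : ∀ i j, (pullback D' J g' gi' j).map (D i) = ∑ b, D i (J b j) • Γ' b
      + ∑ a, ∑ b, (J a i * J b j) • (Γ' b).map (D' a) := by
    intro i j
    ext p q
    simp only [pullback, map_apply, Matrix.sum_apply, Matrix.smul_apply, Matrix.add_apply,
      smul_eq_mul, map_sum, Derivation.leibniz, h.frame i (levi D' g' gi' _ p q),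
      Finset.sum_add_distrib, Finset.mul_sum]
    rw [add_comm]
    congr 1
    · exact Finset.sum_congr rfl fun _ _ => mul_comm _ _
    · rw [Finset.sum_comm]
      exact Finset.sum_congr rfl fun _ _ => Finset.sum_congr rfl fun _ _ => by ring
  have e2 : ∀ i j, pullback D' J g' gi' i * pullback D' J g' gi' j
      = ∑ a, ∑ b, (J a i * J b j) • (Γ' a * Γ' b) := by
    intro i j
    simp only [pullback, Finset.sum_mul, Finset.mul_sum, Matrix.smul_mul, Matrix.mul_smul,
      smul_smul]
    rw [Finset.sum_comm]
    exact Finset.sum_congr rfl fun a _ => Finset.sum_congr rfl fun b _ => by rw [mul_comm]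
  have e3 : ∀ F : ι → ι → Matrix ι ι A, ∑ a, ∑ b, (J a j * J b i) • F a b
      = ∑ a, ∑ b, (J a i * J b j) • F b a := by
    intro F
    rw [Finset.sum_comm]
    exact Finset.sum_congr rfl fun a _ => Finset.sum_congr rfl fun b _ => by rw [mul_comm]
  have e4 : ∑ b, D i (J b j) • Γ' b = ∑ b, D j (J b i) • Γ' b :=
    Finset.sum_congr rfl fun b _ => by rw [h.closed]
  rw [curv, e1, e1, e2, e2, e4, e3, e3]
  simp only [curv, smul_add, smul_sub, Finset.sum_add_distrib, Finset.sum_sub_distrib]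
  abel

/-- The curvature transforms by conjugation with the Jacobian. -/
theorem curv_eq (h : CoordChange D D' J K g g' gi gi')
    (hD : ∀ i j x, D i (D j x) = D j (D i x)) (i j : ι) :
    curv D (levi D g gi) i j = K * curv D (pullback D' J g' gi') i j * J := by
  have e1 : ∀ i, J * levi D g gi i = pullback D' J g' gi' i * J + J.map (D i) := fun i => by
    rw [h.levi_eq, ← mul_assoc, h.inv', one_mul]
  have e2 : J * curv D (levi D g gi) i j = curv D (pullback D' J g' gi') i j * J := by
    have d : ∀ i j, J * (levi D g gi j).map (D i) = (pullback D' J g' gi' j).map (D i) * J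
        + pullback D' J g' gi' j * J.map (D i) + (J.map (D j)).map (D i)
        - J.map (D i) * levi D g gi j := by
      intro i j
      have := congrArg (fun M : Matrix ι ι A => M.map (D i)) (e1 j)
      simp only [map_derivation_mul, map_derivation_add] at this
      rw [eq_sub_iff_add_eq, add_comm, this]
    have p : ∀ i j, J * (levi D g gi i * levi D g gi j)
        = pullback D' J g' gi' i * (pullback D' J g' gi' j * J + J.map (D j)) + J.map (D i) * levi D g gi j := by
      intro i j
      rw [← mul_assoc, e1, add_mul, mul_assoc, e1]
    simp only [curv, Matrix.mul_add, Matrix.mul_sub, d, p]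
    rw [map_derivation_comm hD i j J]
    noncomm_ring
  rw [mul_assoc, ← e2, ← mul_assoc, h.inv, one_mul]

/-- The Ricci tensor transforms by the tensor law. -/
theorem ric_eq (h : CoordChange D D' J K g g' gi gi')
    (hD : ∀ i j x, D i (D j x) = D j (D i x)) :
    Matrix.of (ric D (levi D g gi)) = Jᵀ * Matrix.of (ric D' (levi D' g' gi')) * J := by
  ext k l
  have e1 : ∀ m, curv D (levi D g gi) k m m l
      = ∑ a, ∑ b, J a k * (∑ c, K m c * ∑ d, curv D' (levi D' g' gi') a b c d * J d l) * J b m := by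
    intro m
    rw [h.curv_eq hD, h.curv_pullback, mul_assoc]
    simp only [Finset.sum_mul, Finset.mul_sum, Matrix.smul_mul, Matrix.mul_smul]
    simp only [Matrix.sum_apply, Matrix.smul_apply, smul_eq_mul]
    refine Finset.sum_congr rfl fun a _ => Finset.sum_congr rfl fun b _ => ?_
    rw [mul_apply, Finset.mul_sum]
    refine Finset.sum_congr rfl fun c _ => ?_
    rw [mul_apply, Finset.mul_sum, Finset.mul_sum]
    exact Finset.sum_congr rfl fun d _ => by ring
  have e2 : ∀ a, ∑ m, ∑ b, J a k * (∑ c, K m c *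
      ∑ d, curv D' (levi D' g' gi') a b c d * J d l) * J b m
      = J a k * ∑ b, ∑ d, curv D' (levi D' g' gi') a b b d * J d l := by
    intro a
    have e3 : ∀ b, ∑ m, J a k * (∑ c, K m c *
        ∑ d, curv D' (levi D' g' gi') a b c d * J d l) * J b m
        = J a k * ∑ c, (J * K) b c * ∑ d, curv D' (levi D' g' gi') a b c d * J d l := by
      intro b
      simp only [mul_apply, Finset.sum_mul, Finset.mul_sum]
      rw [Finset.sum_comm]
      refine Finset.sum_congr rfl fun c _ => ?_
      rw [Finset.sum_comm]
      exact Finset.sum_congr rfl fun _ _ => Finset.sum_congr rfl fun _ _ => by ring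
    rw [Finset.sum_comm]
    simp only [e3, h.inv', Matrix.one_apply, ite_mul, one_mul, zero_mul, Finset.sum_ite_eq,
      Finset.mem_univ, if_true]
    rw [Finset.mul_sum]
  have e4 : ric D (levi D g gi) k l
      = -∑ a, J a k * ∑ b, ∑ d, curv D' (levi D' g' gi') a b b d * J d l := by
    rw [ric, Finset.sum_congr rfl fun m _ => e1 m, Finset.sum_comm,
      Finset.sum_congr rfl fun a _ => e2 a]
  rw [of_apply, e4, mul_assoc, mul_apply, ← Finset.sum_neg_distrib]
  refine Finset.sum_congr rfl fun a _ => ?_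
  rw [mul_apply, Finset.sum_comm, transpose_apply, ← mul_neg]
  congr 1
  rw [← Finset.sum_neg_distrib]
  refine Finset.sum_congr rfl fun d _ => ?_
  rw [of_apply, ric, neg_mul, Finset.sum_mul]

theorem scal_eq_trace (hg : gᵀ = g) (hgi : gi * g = 1) (Γ : ι → Matrix ι ι A) :
    scal D Γ gi = trace (gi * Matrix.of (ric D Γ)) := by
  simp only [trace, diag_apply, mul_apply, scal, of_apply]
  rw [Finset.sum_comm]
  refine Finset.sum_congr rfl fun i _ => Finset.sum_congr rfl fun j _ => ?_
  rw [show gi j i = gi i j from congrFun (congrFun (transpose_inv_eq hg hgi) i) j]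

/-- The scalar curvature is invariant under changes of coordinates. -/
theorem scal_eq (h : CoordChange D D' J K g g' gi gi')
    (hD : ∀ i j x, D i (D j x) = D j (D i x)) :
    scal D (levi D g gi) gi = scal D' (levi D' g' gi') gi' := by
  have hg : gᵀ = g := by
    rw [h.metric]; simp only [transpose_mul, transpose_transpose, h.symm, mul_assoc]
  have hJK : Kᵀ * Jᵀ = 1 := by rw [← transpose_mul, h.inv', transpose_one]
  have hJK' : Jᵀ * Kᵀ = 1 := mul_eq_one_comm.mp hJK
  have hgi : gi = K * gi' * Kᵀ := by
    have : K * gi' * Kᵀ * g = 1 := by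
      rw [h.metric]
      calc K * gi' * Kᵀ * (Jᵀ * g' * J) = K * (gi' * ((Kᵀ * Jᵀ) * g')) * J := by noncomm_ring
        _ = 1 := by rw [hJK, one_mul, h.metric_inv', mul_one, h.inv]
    calc gi = K * gi' * Kᵀ * g * gi := by rw [this, one_mul]
      _ = _ := by rw [mul_assoc, mul_eq_one_comm.mp h.metric_inv, mul_one]
  rw [scal_eq_trace hg h.metric_inv, scal_eq_trace h.symm h.metric_inv', h.ric_eq hD, hgi]
  calc trace (K * gi' * Kᵀ * (Jᵀ * Matrix.of (ric D' (levi D' g' gi')) * J))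
      = trace (K * (gi' * ((Kᵀ * Jᵀ) * Matrix.of (ric D' (levi D' g' gi'))) * J)) := by
        congr 1; noncomm_ring
    _ = trace (gi' * Matrix.of (ric D' (levi D' g' gi'))) := by
        rw [hJK, one_mul, trace_mul_comm, mul_assoc, h.inv', mul_one]

end CoordChange

end DiffRing

end

noncomputable section

section ChangeOfCoordinates

open TopologicalSpace (Opens)
open SmoothFun DiffRing
open scoped Matrix

variable {E : Type*} [NormedAddCommGroup E] [NormedSpace ℝ E]
  {ι : Type*} [Fintype ι] [DecidableEq ι]

/-- The scalar curvature is invariant under a smooth change of coordinates `φ`, with local inverse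
`ψ`, that transforms the metric by the tensor law. -/
theorem Coord.scalar_eq_of_change {U : Opens E} (b : Module.Basis ι ℝ E) {φ ψ : E → E}
    (hφ : ContDiffOn ℝ ∞ φ U) (hψ : ∀ y ∈ U, DifferentiableAt ℝ ψ (φ y))
    (hψφ : ∀ y ∈ U, ψ (φ y) = y) (hφψ : ∀ y ∈ U, ∀ᶠ z in 𝓝 (φ y), φ (ψ z) = z)
    {G G' : E → Matrix ι ι ℝ} (hG' : ∀ i j, ContDiffOn ℝ ∞ (fun y => G' (φ y) i j) U)
    (hsymm : ∀ y ∈ U, ∀ i j, G' (φ y) i j = G' (φ y) j i)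
    (hdet : ∀ y ∈ U, IsUnit (G' (φ y)).det)
    (hG : ∀ y ∈ U, G y = (LinearMap.toMatrix b b (fderiv ℝ φ y))ᵀ * G' (φ y) *
      LinearMap.toMatrix b b (fderiv ℝ φ y)) {y : E} (hy : y ∈ U) :
    Coord.scalar b G y = Coord.scalar b G' (φ y) := by
  have hfin : FiniteDimensional ℝ E := b.finiteDimensional_of_finite
  have hφd : ∀ y ∈ U, DifferentiableAt ℝ φ y := fun y hy =>
    (hφ.contDiffAt (U.2.mem_nhds hy)).differentiableAt (by simp)
  let c : ι → E →L[ℝ] ℝ := fun a => (b.coord a).toContinuousLinearMap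
  let φc : ι → SmoothFun U := fun a =>
    SmoothFun.mk (fun y => c a (φ y)) ((c a).contDiff.comp_contDiffOn hφ)
  let J : Matrix ι ι (SmoothFun U) := Matrix.of fun a i => dir U (b i) (φc a)
  have hJ : ∀ y : U, (ev y).mapMatrix J = LinearMap.toMatrix b b (fderiv ℝ φ y) := by
    intro y
    ext a i
    have h1 : HasFDerivAt (fun y => c a (φ y)) ((c a).comp (fderiv ℝ φ y)) y :=
      (c a).hasFDerivAt.comp (y : E) (hφd y y.2).hasFDerivAt
    rw [AlgHom.mapMatrix_apply, Matrix.map_apply, LinearMap.toMatrix_apply]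
    refine (ev_dir (F := fun y => c a (φ y)) (fun _ => rfl) (b i) y).trans ?_
    rw [h1.fderiv]
    rfl
  have hJu : IsUnit J.det := by
    refine isUnit_of_ne_zero fun y => ?_
    have h1 : (fderiv ℝ ψ (φ y)).comp (fderiv ℝ φ y) = ContinuousLinearMap.id ℝ E := by
      have h2 : HasFDerivAt (ψ ∘ φ) ((fderiv ℝ ψ (φ y)).comp (fderiv ℝ φ y)) y :=
        (hψ y y.2).hasFDerivAt.comp (y : E) (hφd y y.2).hasFDerivAt
      refine h2.unique ((hasFDerivAt_id (y : E)).congr_of_eventuallyEq ?_)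
      filter_upwards [U.2.mem_nhds y.2] with z hz using hψφ z hz
    have h3 : LinearMap.toMatrix b b (fderiv ℝ ψ (φ y)) * LinearMap.toMatrix b b (fderiv ℝ φ y)
        = 1 := by
      rw [← LinearMap.toMatrix_comp]
      have := congrArg (fun L : E →L[ℝ] E => LinearMap.toMatrix b b (L : E →ₗ[ℝ] E)) h1
      simpa using this
    rw [AlgHom.map_det, hJ]
    exact ((Matrix.isUnit_iff_isUnit_det _).mp (IsUnit.of_mul_eq_one_right _ h3)).ne_zero
  have hKJ : J⁻¹ * J = 1 := J.nonsing_inv_mul hJu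
  have hJK : J * J⁻¹ = 1 := J.mul_nonsing_inv hJu
  let D : ι → Derivation ℝ (SmoothFun U) (SmoothFun U) := fun i => dir U (b i)
  let D' : ι → Derivation ℝ (SmoothFun U) (SmoothFun U) := fun a => ∑ i, J⁻¹ i a • D i
  have hD' : ∀ a x, D' a x = ∑ i, J⁻¹ i a * D i x := fun a x => by
    have h1 := congrFun (map_sum Derivation.coeFnAddMonoidHom (fun i => J⁻¹ i a • D i)
      Finset.univ) x
    rw [Finset.sum_apply] at h1
    exact h1
  have hf : IsFrame (fun y : U => (y : E)) b D := isFrame_dir U b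
  -- the dual frame `D'` consists of the partial derivatives in the coordinates `φ`
  have hf' : IsFrame (fun y : U => φ y) b D' := by
    intro F f hF a y
    have h1 : F =ᶠ[𝓝 (φ y)] extend f ∘ ψ := by
      have h2 : ∀ᶠ z in 𝓝 (φ y), ψ z ∈ U :=
        (hψ y y.2).continuousAt (U.2.mem_nhds ((hψφ y y.2).symm ▸ y.2))
      filter_upwards [h2, hφψ y y.2] with z hz hz'
      have h3 : F (φ (ψ z)) = _ := hF ⟨ψ z, hz⟩
      rw [hz'] at h3
      rw [Function.comp_apply, extend_apply f ⟨ψ z, hz⟩, h3]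
    have h3 : DifferentiableAt ℝ F (φ y) := by
      refine DifferentiableAt.congr_of_eventuallyEq ?_ h1
      refine DifferentiableAt.comp (φ y) ?_ (hψ y y.2)
      rw [hψφ y y.2]
      exact differentiableAt_extend f y
    have h4 : ∀ i, ev y (D i f) = ∑ e, ev y (J e i) * Coord.pd b F e (φ y) := by
      intro i
      have h5 : HasFDerivAt (F ∘ φ) ((fderiv ℝ F (φ y)).comp (fderiv ℝ φ y)) y :=
        h3.hasFDerivAt.comp (y : E) (hφd y y.2).hasFDerivAt
      rw [ev_dir (F := F ∘ φ) hF, h5.fderiv, ContinuousLinearMap.comp_apply]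
      conv_lhs => rw [← b.sum_repr (fderiv ℝ φ y (b i))]
      rw [map_sum]
      refine Finset.sum_congr rfl fun e _ => ?_
      have h6 : ev y (J e i) = b.repr (fderiv ℝ φ y (b i)) e := by
        have := congrFun (congrFun (hJ y) e) i
        rwa [LinearMap.toMatrix_apply] at this
      rw [map_smul, h6, smul_eq_mul, Coord.pd]
    have h7 : ∀ e, ∑ i, ev y (J⁻¹ i a) * (ev y (J e i) * Coord.pd b F e (φ y))
        = ev y ((J * J⁻¹) e a) * Coord.pd b F e (φ y) := by
      intro e
      rw [Matrix.mul_apply, map_sum, Finset.sum_mul]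
      exact Finset.sum_congr rfl fun _ _ => by rw [map_mul]; ring
    rw [hD', map_sum]
    simp only [map_mul, h4, Finset.mul_sum]
    rw [Finset.sum_comm]
    simp only [h7, hJK, Matrix.one_apply]
    simp
  let g' : Matrix ι ι (SmoothFun U) := Matrix.of fun i j =>
    SmoothFun.mk (fun y => G' (φ y) i j) (hG' i j)
  have hg' : ∀ i j, Reads (fun y : U => φ y) (fun z => G' z i j) (g' i j) := fun i j y => rfl
  obtain ⟨gi', hgi', hgr'⟩ := Matrix.exists_inv_of_ev hg' (fun y => hdet y y.2)
  let g : Matrix ι ι (SmoothFun U) := Jᵀ * g' * J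
  have hgm : ∀ y : U, (ev y).mapMatrix g = G y := by
    intro y
    have e1 : (ev y).mapMatrix g' = G' (φ y) := by ext i j; rfl
    have e2 : (ev y).mapMatrix Jᵀ = ((ev y).mapMatrix J)ᵀ := by ext i j; rfl
    rw [map_mul, map_mul, e1, e2, hJ, hG y y.2]
  have hg : ∀ i j, Reads (fun y : U => (y : E)) (fun z => G z i j) (g i j) := fun i j y =>
    (congrFun (congrFun (hgm y) i) j).symm
  have hdetG : ∀ y : U, IsUnit (G y).det := by
    intro y
    have e1 : IsUnit ((ev y).mapMatrix J).det := by
      rw [← AlgHom.map_det]; exact hJu.map _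
    rw [hG y y.2, Matrix.det_mul, Matrix.det_mul, Matrix.det_transpose, ← hJ]
    exact (e1.mul (hdet y y.2)).mul e1
  obtain ⟨gi, hgi, hgr⟩ := Matrix.exists_inv_of_ev hg hdetG
  have hcc : CoordChange D D' J J⁻¹ g g' gi gi' :=
    { frame := fun i x => by
        have h1 : ∀ j, ∑ a, J a i * (J⁻¹ j a * D j x) = (J⁻¹ * J) j i * D j x := fun j => by
          rw [Matrix.mul_apply, Finset.sum_mul]
          exact Finset.sum_congr rfl fun _ _ => by ring
        simp only [hD', Finset.mul_sum]
        rw [Finset.sum_comm]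
        simp only [h1, hKJ, Matrix.one_apply]
        simp
      closed := fun i j a => dir_comm _ _ _
      inv := hKJ
      symm := by
        ext i j : 1
        exact ext_ev fun y => hsymm y y.2 j i
      metric := rfl
      metric_inv := hgi
      metric_inv' := hgi' }
  have := congrArg (ev ⟨y, hy⟩) (hcc.scal_eq fun i j x => dir_comm _ _ _)
  rw [← hf.scalar hg hgr ⟨y, hy⟩, ← hf'.scalar hg' hgr' ⟨y, hy⟩] at this
  exact this

/-- The scalar curvature of a smooth nondegenerate metric is a smooth function. -/
theorem Coord.contDiffOn_scalar {U : Opens E} (b : Module.Basis ι ℝ E)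
    {G : E → Matrix ι ι ℝ} (hG : ∀ i j, ContDiffOn ℝ ∞ (fun y => G y i j) U)
    (hdet : ∀ y ∈ U, IsUnit (G y).det) : ContDiffOn ℝ ∞ (Coord.scalar b G) U := by
  let g : Matrix ι ι (SmoothFun U) := Matrix.of fun i j => SmoothFun.mk _ (hG i j)
  have hg : ∀ i j, Reads (fun y : U => (y : E)) (fun z => G z i j) (g i j) := fun i j y => rfl
  obtain ⟨gi, hgi, hgr⟩ := Matrix.exists_inv_of_ev hg fun y => hdet y y.2
  have h := (isFrame_dir U b).scalar hg hgr
  exact (contDiffOn_extend _).congr fun y hy =>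
    (h ⟨y, hy⟩).trans (extend_apply _ ⟨y, hy⟩).symm

end ChangeOfCoordinates

end

noncomputable section

/-! ### Coordinate vector fields and metric components in a chart -/

open TopologicalSpace (Opens)
open scoped Matrix

namespace Chart

variable {ι : Type*} [Fintype ι] [DecidableEq ι]
  {E : Type*} [NormedAddCommGroup E] [NormedSpace ℝ E]
  {H : Type*} [TopologicalSpace H] {J : ModelWithCorners ℝ E H} [J.Boundaryless]
  {M : Type*} [TopologicalSpace M] [ChartedSpace H M] [IsManifold J ∞ M]
  {e e' : OpenPartialHomeomorph M H}

theorem contMDiffOn_symm (he : e ∈ atlas H M) :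
    ContMDiffOn 𝓘(ℝ, E) J ∞ (e.extend J).symm (e.extend J).target := by
  rw [e.extend_target']
  exact contMDiffOn_extend_symm (IsManifold.subset_maximalAtlas he)

theorem mdifferentiableAt_symm (he : e ∈ atlas H M) {y : E} (hy : y ∈ (e.extend J).target) :
    MDifferentiableAt 𝓘(ℝ, E) J (e.extend J).symm y :=
  ((contMDiffOn_symm he).contMDiffAt (e.isOpen_extend_target.mem_nhds hy)).mdifferentiableAt
    (by simp)

theorem mdifferentiableAt_extend (he : e ∈ atlas H M) {p : M} (hp : p ∈ e.source) :
    MDifferentiableAt J 𝓘(ℝ, E) (e.extend J) p :=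
  (e.contMDiffAt_extend (n := ∞) (IsManifold.subset_maximalAtlas he) hp).mdifferentiableAt
    (by simp)

theorem symm_mem_source {y : E} (hy : y ∈ (e.extend J).target) :
    (e.extend J).symm y ∈ e.source := by
  rw [← e.extend_source (I := J)]
  exact (e.extend J).map_target hy

/-- The differential of a chart inverts that of its inverse. -/
theorem mfderiv_extend_mfderiv_symm (he : e ∈ atlas H M) {y : E}
    (hy : y ∈ (e.extend J).target) (X : E) :
    mfderiv J 𝓘(ℝ, E) (e.extend J) ((e.extend J).symm y)
      (mfderiv 𝓘(ℝ, E) J (e.extend J).symm y X) = X := by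
  have h1 := (mdifferentiableAt_extend (J := J) he (symm_mem_source hy)).hasMFDerivAt.comp y
    (mdifferentiableAt_symm he hy).hasMFDerivAt
  have h2 : HasMFDerivAt 𝓘(ℝ, E) 𝓘(ℝ, E) (e.extend J ∘ (e.extend J).symm) y
      (ContinuousLinearMap.id ℝ E) := by
    refine (hasMFDerivAt_id y).congr_of_eventuallyEq ?_
    filter_upwards [e.isOpen_extend_target.mem_nhds hy] with z hz
    exact (e.extend J).right_inv hz
  exact congrArg (fun L : E →L[ℝ] E => L X) (hasMFDerivAt_unique h1 h2)

/-- The coordinate vector fields are smooth, as maps from the coordinate domain to the tangent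
bundle. -/
theorem contMDiffOn_coordVec (b : Module.Basis ι ℝ E) (he : e ∈ atlas H M) (i : ι) :
    ContMDiffOn 𝓘(ℝ, E) J.tangent ∞
      (fun y => (⟨(e.extend J).symm y, coordVec J b e i y⟩ : TangentBundle J M))
      (e.extend J).target := by
  have hopen : IsOpen (e.extend J).target := e.isOpen_extend_target
  have h1 := (contMDiffOn_symm (J := J) he).contMDiffOn_tangentMapWithin (m := ∞) (by simp)
    hopen.uniqueMDiffOn
  have h2 : ContMDiffOn 𝓘(ℝ, E) 𝓘(ℝ, E).tangent ∞
      (fun y => (⟨y, b i⟩ : TangentBundle 𝓘(ℝ, E) E)) (e.extend J).target :=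
    contMDiffOn_vectorSpace_iff_contDiffOn.2 contDiffOn_const
  refine (h1.comp h2 fun y hy => hy).congr fun y hy => ?_
  simp only [Function.comp, tangentMapWithin, coordVec]
  rw [mfderivWithin_of_isOpen hopen hy]

/-- Expansion of `B(LX, LY)` in the coordinates of `X` and `Y`. -/
theorem bilin_sum_smul (B : E →L[ℝ] E →L[ℝ] ℝ) (L : E →L[ℝ] E) (b : ι → E) (c d : ι → ℝ) :
    B (L (∑ k, c k • b k)) (L (∑ l, d l • b l)) =
      ∑ l, ∑ k, c k * B (L (b k)) (L (b l)) * d l := by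
  simp only [map_sum, map_smul, sum_apply, smul_apply, smul_eq_mul, Finset.mul_sum]
  exact Finset.sum_congr rfl fun l _ => Finset.sum_congr rfl fun k _ => by ring

/-- The chart changes `y ↦ e' (e⁻¹ y)` pull the components of a metric in `e'` back to those
in `e`. -/
theorem metricComp_transition (b : Module.Basis ι ℝ E) (he : e ∈ atlas H M) (he' : e' ∈ atlas H M)
    (g : ∀ p : M, TangentSpace J p →L[ℝ] TangentSpace J p →L[ℝ] ℝ) {y : E}
    (hy : y ∈ (e.extend J).target) (hy' : (e.extend J).symm y ∈ e'.source) :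
    metricComp J b (fun p X Y => g p X Y) e y =
      (LinearMap.toMatrix b b (fderiv ℝ (e'.extend J ∘ (e.extend J).symm) y))ᵀ
        * metricComp J b (fun p X Y => g p X Y) e' (e'.extend J ((e.extend J).symm y))
        * LinearMap.toMatrix b b (fderiv ℝ (e'.extend J ∘ (e.extend J).symm) y) := by
  set φ := e'.extend J ∘ (e.extend J).symm with hφ
  have hdφ : MDifferentiableAt 𝓘(ℝ, E) 𝓘(ℝ, E) φ y :=
    (mdifferentiableAt_extend (J := J) he' hy').comp y (mdifferentiableAt_symm he hy)
  have hty : φ y ∈ (e'.extend J).target :=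
    (e'.extend J).map_source (by rwa [e'.extend_source])
  have hev : (e.extend J).symm =ᶠ[𝓝 y] (e'.extend J).symm ∘ φ := by
    have hc := (e.continuousAt_extend_symm' hy).preimage_mem_nhds (e'.open_source.mem_nhds hy')
    filter_upwards [hc] with z hz
    exact (e'.extend_left_inv hz).symm
  have hcomp := ((mdifferentiableAt_symm (J := J) he' hty).hasMFDerivAt.comp y
    hdφ.hasMFDerivAt).congr_of_eventuallyEq hev
  have hmf : ∀ X : E, mfderiv 𝓘(ℝ, E) J (e.extend J).symm y X =
      (mfderiv 𝓘(ℝ, E) J (e'.extend J).symm (φ y) : E →L[ℝ] E) (fderiv ℝ φ y X) := by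
    intro X
    have := congrArg (fun L : E →L[ℝ] E => L X) hcomp.mfderiv
    rw [← mfderiv_eq_fderiv]
    exact this
  have hpt : (e.extend J).symm y = (e'.extend J).symm (φ y) := hev.eq_of_nhds
  -- tangent spaces at equal points are identified by substitution
  have key : ∀ p q : M, p = q → ∀ X Y X' Y' : E, X = X' → Y = Y' →
      (g p : E →L[ℝ] E →L[ℝ] ℝ) X Y = (g q : E →L[ℝ] E →L[ℝ] ℝ) X' Y' := by
    rintro p _ rfl X Y _ _ rfl rfl; rfl
  ext i j
  have h1 : metricComp J b (fun p X Y => g p X Y) e y i j =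
      (g ((e'.extend J).symm (φ y)) : E →L[ℝ] E →L[ℝ] ℝ)
        ((mfderiv 𝓘(ℝ, E) J (e'.extend J).symm (φ y) : E →L[ℝ] E) (fderiv ℝ φ y (b i)))
        ((mfderiv 𝓘(ℝ, E) J (e'.extend J).symm (φ y) : E →L[ℝ] E) (fderiv ℝ φ y (b j))) :=
    key _ _ hpt _ _ _ _ (hmf _) (hmf _)
  have h2 : ∀ k, fderiv ℝ φ y (b k) =
      ∑ l, LinearMap.toMatrix b b (fderiv ℝ φ y : E →ₗ[ℝ] E) l k • b l := by
    intro k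
    simp only [LinearMap.toMatrix_apply]
    exact (b.sum_repr _).symm
  rw [h1, h2 i, h2 j]
  refine (bilin_sum_smul (E := E) (g ((e'.extend J).symm (φ y)))
    (mfderiv 𝓘(ℝ, E) J (e'.extend J).symm (φ y)) b _ _).trans ?_
  simp only [Matrix.mul_apply, Matrix.transpose_apply, Finset.sum_mul]
  rfl

section Riemannian

variable (h : Bundle.ContMDiffRiemannianMetric J ∞ E (fun x : M => TangentSpace J x))
  (b : Module.Basis ι ℝ E)

theorem contDiffOn_metricComp (he : e ∈ atlas H M) (i j : ι) :
    ContDiffOn ℝ ∞ (fun y => metricComp J b (fun p X Y => h.inner p X Y) e y i j)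
      (e.extend J).target := by
  have h1 := (h.contMDiff.contMDiffOn (s := Set.univ)).comp (contMDiffOn_symm (J := J) he)
    fun y _ => Set.mem_univ _
  have h2 := h1.clm_bundle_apply₂ (F₃ := ℝ) (E₃ := fun _ : M => ℝ)
    (contMDiffOn_coordVec b he i) (contMDiffOn_coordVec b he j)
  rw [← contMDiffOn_iff_contDiffOn]
  intro y hy
  exact ((Bundle.contMDiffWithinAt_totalSpace.1 (h2 y hy)).2).congr_of_mem (fun z hz => rfl) hy

theorem metricComp_symm (y : E) (i j : ι) :
    metricComp J b (fun p X Y => h.inner p X Y) e y i j =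
      metricComp J b (fun p X Y => h.inner p X Y) e y j i :=
  h.symm _ _ _

/-- A vector in the kernel of the matrix of components would have length zero. -/
theorem isUnit_det_metricComp (he : e ∈ atlas H M) {y : E} (hy : y ∈ (e.extend J).target) :
    IsUnit (metricComp J b (fun p X Y => h.inner p X Y) e y).det := by
  rw [isUnit_iff_ne_zero]
  intro h0
  obtain ⟨c, hc, hmul⟩ := Matrix.exists_mulVec_eq_zero_iff.2 h0
  set L : E →L[ℝ] E := mfderiv 𝓘(ℝ, E) J (e.extend J).symm y with hL
  set X : E := ∑ k, c k • b k with hX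
  have hX0 : L X ≠ 0 := by
    intro hz
    have h1 := mfderiv_extend_mfderiv_symm (J := J) he hy X
    have h2 : X = 0 := by
      rw [← h1]
      exact (congrArg (mfderiv J 𝓘(ℝ, E) (e.extend J) ((e.extend J).symm y) : E →L[ℝ] E) hz).trans
        (map_zero _)
    apply hc
    funext k
    have := congrArg (fun Z => b.repr Z k) h2
    simpa [hX, Finsupp.single_apply] using this
  have hp := h.pos ((e.extend J).symm y) (L X) hX0
  have hz : h.inner ((e.extend J).symm y) (L X) (L X) = 0 := by
    refine (bilin_sum_smul (E := E) (h.inner ((e.extend J).symm y)) L b c c).trans ?_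
    rw [Finset.sum_comm]
    refine Finset.sum_eq_zero fun k _ => ?_
    have := congrFun hmul k
    simp only [Matrix.mulVec, dotProduct, Pi.zero_apply] at this
    simp only [mul_assoc, ← Finset.mul_sum]
    exact mul_eq_zero_of_right _ this
  exact hp.ne' hz

/-- The scalar curvature computed in two charts agrees on their overlap. -/
theorem scalar_eq_of_charts (he : e ∈ atlas H M) (he' : e' ∈ atlas H M) {p : M}
    (hp : p ∈ e.source) (hp' : p ∈ e'.source) :
    Coord.scalar b (metricComp J b (fun p X Y => h.inner p X Y) e) (e.extend J p) =
      Coord.scalar b (metricComp J b (fun p X Y => h.inner p X Y) e') (e'.extend J p) := by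
  set U : Opens E := ⟨(e.extend J).target ∩ (e.extend J).symm ⁻¹' e'.source,
    (e.continuousOn_extend_symm).isOpen_inter_preimage e.isOpen_extend_target e'.open_source⟩
    with hU
  set φ := e'.extend J ∘ (e.extend J).symm with hφ
  set ψ := e.extend J ∘ (e'.extend J).symm with hψ
  have htar : ∀ y ∈ U, φ y ∈ (e'.extend J).target := fun y hy =>
    (e'.extend J).map_source (by rw [e'.extend_source]; exact hy.2)
  have hback : ∀ y ∈ U, (e'.extend J).symm (φ y) = (e.extend J).symm y := fun y hy =>
    e'.extend_left_inv hy.2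
  have hsm : ContDiffOn ℝ ∞ φ U := by
    rw [← contMDiffOn_iff_contDiffOn]
    exact (e'.contMDiffOn_extend (IsManifold.subset_maximalAtlas he')).comp
      ((contMDiffOn_symm (J := J) he).mono fun y hy => hy.1) fun y hy => hy.2
  have hpU : e.extend J p ∈ U := by
    refine ⟨(e.extend J).map_source (by rwa [e.extend_source]), ?_⟩
    change (e.extend J).symm (e.extend J p) ∈ e'.source
    rwa [e.extend_left_inv hp]
  have := Coord.scalar_eq_of_change (U := U) b (φ := φ) (ψ := ψ)
    (G := metricComp J b (fun p X Y => h.inner p X Y) e)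
    (G' := metricComp J b (fun p X Y => h.inner p X Y) e') hsm ?_ ?_ ?_ ?_ ?_ ?_ ?_ hpU
  · rw [this, hφ]
    simp only [Function.comp, e.extend_left_inv hp]
  · intro y hy
    have h1 : (e'.extend J).symm (φ y) ∈ e.source := by
      rw [hback y hy]; exact symm_mem_source hy.1
    exact ((mdifferentiableAt_extend (J := J) he h1).comp (φ y)
      (mdifferentiableAt_symm he' (htar y hy))).differentiableAt
  · intro y hy
    simp only [hψ, Function.comp]
    rw [hback y hy]
    exact (e.extend J).right_inv hy.1
  · intro y hy
    have h1 : (e'.extend J).symm (φ y) ∈ e.source := by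
      rw [hback y hy]; exact symm_mem_source hy.1
    filter_upwards [e'.isOpen_extend_target.mem_nhds (htar y hy),
      (e'.continuousAt_extend_symm' (htar y hy)).preimage_mem_nhds (e.open_source.mem_nhds h1)]
      with z hz hz'
    simp only [hφ, hψ, Function.comp]
    rw [e.extend_left_inv hz']
    exact (e'.extend J).right_inv hz
  · intro i j
    exact (contDiffOn_metricComp h b he' i j).comp hsm htar
  · intro y _ i j
    exact metricComp_symm h b _ _ _
  · intro y hy
    exact isUnit_det_metricComp h b he' (htar y hy)
  · intro y hy
    exact metricComp_transition b he he' h.inner hy.1 hy.2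

/-- The scalar curvature of a Riemannian metric as a function on the manifold; at each point it is
computed in the preferred chart there. -/
def scalarCurvature (p : M) : ℝ :=
  Coord.scalar b (metricComp J b (fun p X Y => h.inner p X Y) (chartAt H p))
    ((chartAt H p).extend J p)

theorem scalarCurvature_eq (he : e ∈ atlas H M) {p : M} (hp : p ∈ e.source) :
    scalarCurvature h b p =
      Coord.scalar b (metricComp J b (fun p X Y => h.inner p X Y) e) (e.extend J p) :=
  scalar_eq_of_charts h b (chart_mem_atlas H p) he (mem_chart_source H p) hp

theorem contMDiff_scalarCurvature : ContMDiff J 𝓘(ℝ, ℝ) ∞ (scalarCurvature h b) := by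
  intro p
  have he := chart_mem_atlas H p
  set U : Opens E := ⟨((chartAt H p).extend J).target, (chartAt H p).isOpen_extend_target⟩
  have h1 : ContDiffOn ℝ ∞
      (Coord.scalar b (metricComp J b (fun p X Y => h.inner p X Y) (chartAt H p))) U :=
    Coord.contDiffOn_scalar b (contDiffOn_metricComp h b he)
      fun y hy => isUnit_det_metricComp h b he hy
  have h2 := (contMDiffOn_iff_contDiffOn.2 h1).comp
    ((chartAt H p).contMDiffOn_extend (I := J) (n := ∞) (IsManifold.subset_maximalAtlas he))
    fun q hq => ((chartAt H p).extend J).map_source (by rwa [(chartAt H p).extend_source])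
  exact (h2.congr fun q hq => scalarCurvature_eq h b he hq).contMDiffAt
    ((chartAt H p).open_source.mem_nhds (mem_chart_source H p))

end Riemannian

end Chart

end

noncomputable section

/-! ### Product charts of `I × N` -/

open TopologicalSpace (Opens)
open scoped Matrix

namespace GRW

variable {m : ℕ} {I : Opens ℝ} {N : Type*} [TopologicalSpace N]
  [ChartedSpace (EuclideanSpace ℝ (Fin m)) N]

/-- Every chart of the interval `I` is the inclusion into `ℝ`. -/
theorem chart_interval {e : OpenPartialHomeomorph I ℝ} (he : e ∈ atlas ℝ I) :
    e.source = Set.univ ∧ e.target = I ∧ ∀ t : I, e t = t := by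
  obtain ⟨_, ⟨t, rfl⟩, ht⟩ := he
  rw [Set.mem_singleton_iff] at ht
  subst ht
  simp [OpenPartialHomeomorph.subtypeRestr_def, chartAt_self_eq]

theorem atlas_prod {e : OpenPartialHomeomorph (I × N) (ModelProd ℝ (EuclideanSpace ℝ (Fin m)))}
    (he : e ∈ atlas (ModelProd ℝ (EuclideanSpace ℝ (Fin m))) (I × N)) :
    ∃ e₁ ∈ atlas ℝ I, ∃ e₂ ∈ atlas (EuclideanSpace ℝ (Fin m)) N, e = e₁.prod e₂ := by
  obtain ⟨e₁, h₁, e₂, h₂, rfl⟩ := he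
  exact ⟨e₁, h₁, e₂, h₂, rfl⟩

variable {e₁ : OpenPartialHomeomorph I ℝ} {e₂ : OpenPartialHomeomorph N (EuclideanSpace ℝ (Fin m))}

theorem prod_target (he₁ : e₁ ∈ atlas ℝ I) :
    ((e₁.prod e₂).extend (model m)).target = (I : Set ℝ) ×ˢ (e₂.extend (𝓡 m)).target := by
  obtain ⟨-, h, -⟩ := chart_interval he₁
  ext ⟨t, x⟩
  simp [h]

theorem prod_mem_target (he₁ : e₁ ∈ atlas ℝ I) {t : ℝ} {x : EuclideanSpace ℝ (Fin m)} :
    (t, x) ∈ ((e₁.prod e₂).extend (model m)).target ↔ t ∈ I ∧ x ∈ (e₂.extend (𝓡 m)).target := by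
  rw [prod_target he₁]; rfl

theorem isOpen_prod_target (he₁ : e₁ ∈ atlas ℝ I) :
    IsOpen ((e₁.prod e₂).extend (model m)).target := by
  rw [prod_target he₁]
  exact I.2.prod e₂.isOpen_extend_target

theorem prod_symm (t : ℝ) (x : EuclideanSpace ℝ (Fin m)) :
    ((e₁.prod e₂).extend (model m)).symm (t, x) = (e₁.symm t, (e₂.extend (𝓡 m)).symm x) := rfl

theorem interval_symm (he₁ : e₁ ∈ atlas ℝ I) {t : ℝ} (ht : t ∈ I) : (e₁.symm t : ℝ) = t := by
  obtain ⟨-, h, h'⟩ := chart_interval he₁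
  rw [← h']
  exact e₁.right_inv (by rw [h]; exact ht)

variable [IsManifold (𝓡 m) ∞ N]

/-- In a product chart `dt` is the differential of the first coordinate. -/
theorem dt_mfderiv_symm (he₁ : e₁ ∈ atlas ℝ I)
    (he₂ : e₂ ∈ atlas (EuclideanSpace ℝ (Fin m)) N) {t : ℝ} {x : EuclideanSpace ℝ (Fin m)}
    (ht : t ∈ I) (hx : x ∈ (e₂.extend (𝓡 m)).target) (X : ℝ × EuclideanSpace ℝ (Fin m)) :
    dt (((e₁.prod e₂).extend (model m)).symm (t, x))
      (mfderiv 𝓘(ℝ, ℝ × EuclideanSpace ℝ (Fin m)) (model m)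
        ((e₁.prod e₂).extend (model m)).symm (t, x) X) = X.1 := by
  have he : e₁.prod e₂ ∈ atlas (ModelProd ℝ (EuclideanSpace ℝ (Fin m))) (I × N) :=
    ⟨e₁, he₁, e₂, he₂, rfl⟩
  have hy : (t, x) ∈ ((e₁.prod e₂).extend (model m)).target := (prod_mem_target he₁).2 ⟨ht, hx⟩
  have h0 := (hasMFDerivAt_val (((e₁.prod e₂).extend (model m)).symm (t, x)).1).comp _
    (hasMFDerivAt_fst (I := 𝓘(ℝ, ℝ)) (I' := 𝓡 m)
      (x := ((e₁.prod e₂).extend (model m)).symm (t, x)))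
  have h1 := h0.mdifferentiableAt.hasMFDerivAt.comp (t, x)
    (Chart.mdifferentiableAt_symm (J := model m) he hy).hasMFDerivAt
  have h2 : HasMFDerivAt 𝓘(ℝ, ℝ × EuclideanSpace ℝ (Fin m)) 𝓘(ℝ, ℝ)
      (fun y : ℝ × EuclideanSpace ℝ (Fin m) => y.1) (t, x)
      (ContinuousLinearMap.fst ℝ ℝ (EuclideanSpace ℝ (Fin m))) :=
    hasFDerivAt_fst.hasMFDerivAt
  have h3 := h2.congr_of_eventuallyEq (f₁ := ((fun s : I => (s : ℝ)) ∘ Prod.fst) ∘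
    ((e₁.prod e₂).extend (model m)).symm) (by
      filter_upwards [(isOpen_prod_target he₁).mem_nhds hy] with z hz
      exact interval_symm he₁ ((prod_mem_target he₁).1 hz).1)
  exact congrArg (fun L : ℝ × EuclideanSpace ℝ (Fin m) →L[ℝ] ℝ => L X) (hasMFDerivAt_unique h1 h3)

theorem spatial_mfderiv_symm (he₁ : e₁ ∈ atlas ℝ I)
    (he₂ : e₂ ∈ atlas (EuclideanSpace ℝ (Fin m)) N) {t : ℝ} {x : EuclideanSpace ℝ (Fin m)}
    (ht : t ∈ I) (hx : x ∈ (e₂.extend (𝓡 m)).target) (X : ℝ × EuclideanSpace ℝ (Fin m)) :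
    spatial (((e₁.prod e₂).extend (model m)).symm (t, x))
      (mfderiv 𝓘(ℝ, ℝ × EuclideanSpace ℝ (Fin m)) (model m)
        ((e₁.prod e₂).extend (model m)).symm (t, x) X) =
      mfderiv 𝓘(ℝ, EuclideanSpace ℝ (Fin m)) (𝓡 m) (e₂.extend (𝓡 m)).symm x X.2 := by
  have he : e₁.prod e₂ ∈ atlas (ModelProd ℝ (EuclideanSpace ℝ (Fin m))) (I × N) :=
    ⟨e₁, he₁, e₂, he₂, rfl⟩
  have hy : (t, x) ∈ ((e₁.prod e₂).extend (model m)).target := (prod_mem_target he₁).2 ⟨ht, hx⟩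
  have h0 := hasMFDerivAt_snd (I := 𝓘(ℝ, ℝ)) (I' := 𝓡 m)
      (x := ((e₁.prod e₂).extend (model m)).symm (t, x))
  have h1 := h0.mdifferentiableAt.hasMFDerivAt.comp (t, x)
    (Chart.mdifferentiableAt_symm (J := model m) he hy).hasMFDerivAt
  have h2 : HasMFDerivAt 𝓘(ℝ, ℝ × EuclideanSpace ℝ (Fin m)) 𝓘(ℝ, EuclideanSpace ℝ (Fin m))
      (fun y : ℝ × EuclideanSpace ℝ (Fin m) => y.2) (t, x)
      (ContinuousLinearMap.snd ℝ ℝ (EuclideanSpace ℝ (Fin m))) :=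
    hasFDerivAt_snd.hasMFDerivAt
  have h3 := HasMFDerivAt.comp (t, x) (g := (e₂.extend (𝓡 m)).symm)
    (Chart.mdifferentiableAt_symm (J := 𝓡 m) he₂ hx).hasMFDerivAt h2
  exact congrArg (fun L : ℝ × EuclideanSpace ℝ (Fin m) →L[ℝ] EuclideanSpace ℝ (Fin m) => L X)
    (hasMFDerivAt_unique h1 h3)

/-- The velocity `∂/∂t` is the coordinate vector field of the time coordinate. -/
theorem velocity_eq_coordVec (he₁ : e₁ ∈ atlas ℝ I)
    (he₂ : e₂ ∈ atlas (EuclideanSpace ℝ (Fin m)) N) {t : ℝ} {x : EuclideanSpace ℝ (Fin m)}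
    (ht : t ∈ I) (hx : x ∈ (e₂.extend (𝓡 m)).target) :
    velocity (((e₁.prod e₂).extend (model m)).symm (t, x)) =
      coordVec (model m) (basis m) (e₁.prod e₂) (.inl ()) (t, x) := by
  have h1 := dt_mfderiv_symm he₁ he₂ ht hx (basis m (.inl ()))
  have h2 := spatial_mfderiv_symm he₁ he₂ ht hx (basis m (.inl ()))
  rw [dt_apply] at h1
  rw [spatial_apply] at h2
  rw [basis_inl] at h1 h2
  rw [coordVec, basis_inl]
  exact Prod.ext h1.symm (h2.trans (map_zero _)).symm

variable (h : Bundle.ContMDiffRiemannianMetric (𝓡 m) ∞ (EuclideanSpace ℝ (Fin m))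
  (fun x : N => TangentSpace (𝓡 m) x)) {a : ℝ → ℝ}

/-- The components of the fibre metric in a chart of the fibre. -/
abbrev fibreComp (e₂ : OpenPartialHomeomorph N (EuclideanSpace ℝ (Fin m))) :
    EuclideanSpace ℝ (Fin m) → Matrix (Fin m) (Fin m) ℝ :=
  metricComp (𝓡 m) (fibreBasis m) (fun p X Y => h.inner p X Y) e₂

/-- The components of the space-time metric in a product chart. -/
theorem metricComp_prod (he₁ : e₁ ∈ atlas ℝ I)
    (he₂ : e₂ ∈ atlas (EuclideanSpace ℝ (Fin m)) N) {t : ℝ} {x : EuclideanSpace ℝ (Fin m)}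
    (ht : t ∈ I) (hx : x ∈ (e₂.extend (𝓡 m)).target) (i j : Unit ⊕ Fin m) :
    metricComp (model m) (basis m) (metric (I := I) a h) (e₁.prod e₂) (t, x) i j =
      -((basis m i).1 * (basis m j).1) + a t ^ 2 *
        h.inner ((e₂.extend (𝓡 m)).symm x)
          (mfderiv 𝓘(ℝ, EuclideanSpace ℝ (Fin m)) (𝓡 m) (e₂.extend (𝓡 m)).symm x (basis m i).2)
          (mfderiv 𝓘(ℝ, EuclideanSpace ℝ (Fin m)) (𝓡 m) (e₂.extend (𝓡 m)).symm x
            (basis m j).2) := by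
  simp only [metricComp, Matrix.of_apply, metric, coordVec]
  rw [dt_mfderiv_symm he₁ he₂ ht hx, dt_mfderiv_symm he₁ he₂ ht hx,
    spatial_mfderiv_symm he₁ he₂ ht hx, spatial_mfderiv_symm he₁ he₂ ht hx, prod_symm,
    interval_symm he₁ ht]

theorem isWarped_metricComp (ha : ContDiffOn ℝ ∞ a I) (hpos : ∀ t ∈ I, 0 < a t)
    (he₁ : e₁ ∈ atlas ℝ I) (he₂ : e₂ ∈ atlas (EuclideanSpace ℝ (Fin m)) N) :
    IsWarped I ⟨(e₂.extend (𝓡 m)).target, e₂.isOpen_extend_target⟩ a (fibreComp h e₂)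
      (metricComp (model m) (basis m) (metric (I := I) a h) (e₁.prod e₂)) where
  smooth_a := ha
  pos := hpos
  smooth_H := Chart.contDiffOn_metricComp h _ he₂
  symm := fun x _ i j => Chart.metricComp_symm h _ x i j
  det := fun x hx => Chart.isUnit_det_metricComp h _ he₂ hx
  eq := by
    intro t ht x hx
    -- the inner product and the differential of the chart, as maps of the coordinate space
    obtain ⟨B, L, hG, hH⟩ : ∃ (B : EuclideanSpace ℝ (Fin m) →L[ℝ] EuclideanSpace ℝ (Fin m) →L[ℝ] ℝ)
        (L : EuclideanSpace ℝ (Fin m) →L[ℝ] EuclideanSpace ℝ (Fin m)),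
        (∀ i j, metricComp (model m) (basis m) (metric (I := I) a h) (e₁.prod e₂) (t, x) i j =
          -((basis m i).1 * (basis m j).1) + a t ^ 2 * B (L (basis m i).2) (L (basis m j).2)) ∧
        ∀ i j, fibreComp h e₂ x i j = B (L (fibreBasis m i)) (L (fibreBasis m j)) :=
      ⟨h.inner ((e₂.extend (𝓡 m)).symm x),
        mfderiv 𝓘(ℝ, EuclideanSpace ℝ (Fin m)) (𝓡 m) (e₂.extend (𝓡 m)).symm x,
        metricComp_prod h he₁ he₂ ht hx, fun _ _ => rfl⟩
    have hb : ∀ i : Unit, basis m (.inl i) = (1, 0) := fun _ => basis_inl m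
    ext i j
    rw [hG]
    rcases i with i | i <;> rcases j with j | j <;> simp [hb, basis_inr, hH]

end GRW

end

noncomputable section

/-! ### Vector fields on `I × N` in product charts -/

open TopologicalSpace (Opens)
open scoped Matrix

namespace GRW

variable {m : ℕ} {I : Opens ℝ} {N : Type*} [TopologicalSpace N]
  [ChartedSpace (EuclideanSpace ℝ (Fin m)) N] [IsManifold (𝓡 m) ∞ N]
  {e₁ : OpenPartialHomeomorph I ℝ} {e₂ : OpenPartialHomeomorph N (EuclideanSpace ℝ (Fin m))}
  {t : ℝ} {x : EuclideanSpace ℝ (Fin m)}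
  (h : Bundle.ContMDiffRiemannianMetric (𝓡 m) ∞ (EuclideanSpace ℝ (Fin m))
    (fun x : N => TangentSpace (𝓡 m) x)) {a : ℝ → ℝ}

theorem vecComp_velocity (he₁ : e₁ ∈ atlas ℝ I)
    (he₂ : e₂ ∈ atlas (EuclideanSpace ℝ (Fin m)) N) (ht : t ∈ I)
    (hx : x ∈ (e₂.extend (𝓡 m)).target) (k : Unit ⊕ Fin m) :
    vecComp (model m) (basis m) (velocity (I := I) (N := N)) (e₁.prod e₂) k (t, x) =
      if k = .inl () then 1 else 0 := by
  have he : e₁.prod e₂ ∈ atlas (ModelProd ℝ (EuclideanSpace ℝ (Fin m))) (I × N) :=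
    ⟨e₁, he₁, e₂, he₂, rfl⟩
  have hy : (t, x) ∈ ((e₁.prod e₂).extend (model m)).target := (prod_mem_target he₁).2 ⟨ht, hx⟩
  rw [vecComp, velocity_eq_coordVec he₁ he₂ ht hx, coordVec]
  have h1 := Chart.mfderiv_extend_mfderiv_symm (J := model m) he hy (basis m (.inl ()))
  have h2 := congrArg (fun X => (basis m).repr X k) h1
  refine h2.trans ?_
  simp only [Module.Basis.repr_self, Finsupp.single_apply, eq_comm]

/-- The time component of a vector field is its value under `dt`. -/
theorem vecComp_inl (he₁ : e₁ ∈ atlas ℝ I)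
    (he₂ : e₂ ∈ atlas (EuclideanSpace ℝ (Fin m)) N) (ht : t ∈ I)
    (hx : x ∈ (e₂.extend (𝓡 m)).target)
    (v : ∀ p : I × N, TangentSpace (model m) p) :
    vecComp (model m) (basis m) v (e₁.prod e₂) (.inl ()) (t, x) =
      dt (((e₁.prod e₂).extend (model m)).symm (t, x))
        (v (((e₁.prod e₂).extend (model m)).symm (t, x))) := by
  have he : e₁.prod e₂ ∈ atlas (ModelProd ℝ (EuclideanSpace ℝ (Fin m))) (I × N) :=
    ⟨e₁, he₁, e₂, he₂, rfl⟩
  have hy : (t, x) ∈ ((e₁.prod e₂).extend (model m)).target := (prod_mem_target he₁).2 ⟨ht, hx⟩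
  set p := ((e₁.prod e₂).extend (model m)).symm (t, x) with hp
  have h0 : HasMFDerivAt 𝓘(ℝ, ℝ × EuclideanSpace ℝ (Fin m)) 𝓘(ℝ, ℝ)
      (fun y : ℝ × EuclideanSpace ℝ (Fin m) => y.1) ((e₁.prod e₂).extend (model m) p)
      (ContinuousLinearMap.fst ℝ ℝ (EuclideanSpace ℝ (Fin m))) :=
    hasFDerivAt_fst.hasMFDerivAt
  have h1 := h0.comp p (Chart.mdifferentiableAt_extend (J := model m) he
    (Chart.symm_mem_source hy)).hasMFDerivAt
  have h2 : (fun y : ℝ × EuclideanSpace ℝ (Fin m) => y.1) ∘ ((e₁.prod e₂).extend (model m)) =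
      fun q : I × N => (q.1 : ℝ) := by
    funext q
    exact (chart_interval he₁).2.2 q.1
  rw [h2] at h1
  have h3 := congrArg (fun L : ℝ × EuclideanSpace ℝ (Fin m) →L[ℝ] ℝ => L (v p)) h1.mfderiv
  refine Eq.trans ?_ h3.symm
  have h4 : ∀ X : ℝ × EuclideanSpace ℝ (Fin m), (basis m).repr X (.inl ()) = X.1 := by
    intro X
    simp [basis]
  exact h4 _

/-- A unit time-like vector is not tangent to the fibre, where the metric is positive. -/
theorem dt_ne_zero_of_metric_eq_neg_one {p : I × N} {X : TangentSpace (model m) p}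
    (hX : metric a h p X X = -1) : dt p X ≠ 0 := by
  intro h0
  have h1 : 0 ≤ h.inner p.2 (spatial p X) (spatial p X) := by
    by_cases hz : spatial p X = 0
    · rw [hz, map_zero]
    · exact (h.pos _ _ hz).le
  rw [metric, h0] at hX
  nlinarith [mul_nonneg (sq_nonneg (a p.1)) h1]

theorem covecComp_inl (ha : ContDiffOn ℝ ∞ a I) (hpos : ∀ t ∈ I, 0 < a t) (he₁ : e₁ ∈ atlas ℝ I)
    (he₂ : e₂ ∈ atlas (EuclideanSpace ℝ (Fin m)) N) (ht : t ∈ I)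
    (hx : x ∈ (e₂.extend (𝓡 m)).target) (v : ∀ p : I × N, TangentSpace (model m) p) :
    covecComp (model m) (basis m) (metric (I := I) a h) v (e₁.prod e₂) (.inl ()) (t, x) =
      -dt (((e₁.prod e₂).extend (model m)).symm (t, x))
        (v (((e₁.prod e₂).extend (model m)).symm (t, x))) := by
  rw [covecComp, (isWarped_metricComp h ha hpos he₁ he₂).eq t ht x hx, Fintype.sum_sum_type]
  simp [vecComp_inl he₁ he₂ ht hx]

theorem covecComp_velocity (ha : ContDiffOn ℝ ∞ a I) (hpos : ∀ t ∈ I, 0 < a t)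
    (he₁ : e₁ ∈ atlas ℝ I) (he₂ : e₂ ∈ atlas (EuclideanSpace ℝ (Fin m)) N) (ht : t ∈ I)
    (hx : x ∈ (e₂.extend (𝓡 m)).target) (k : Unit ⊕ Fin m) :
    covecComp (model m) (basis m) (metric (I := I) a h) velocity (e₁.prod e₂) k (t, x) =
      if k = .inl () then -1 else 0 := by
  rw [covecComp, (isWarped_metricComp h ha hpos he₁ he₂).eq t ht x hx]
  simp only [vecComp_velocity he₁ he₂ ht hx, mul_ite, mul_one, mul_zero, Finset.sum_ite_eq',
    Finset.mem_univ, if_true]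
  rcases k with ⟨⟩ | k
  · simp
  · simp

theorem contMDiff_velocity :
    ContMDiff (model m) (model m).tangent ∞
      (fun p : I × N => (⟨p, velocity p⟩ : TangentBundle (model m) (I × N))) := by
  intro p
  have he : (chartAt ℝ p.1).prod (chartAt (EuclideanSpace ℝ (Fin m)) p.2) ∈
      atlas (ModelProd ℝ (EuclideanSpace ℝ (Fin m))) (I × N) :=
    ⟨_, chart_mem_atlas _ _, _, chart_mem_atlas _ _, rfl⟩
  have h1 := (Chart.contMDiffOn_coordVec (J := model m) (basis m) he (.inl ())).comp
    (((chartAt ℝ p.1).prod (chartAt (EuclideanSpace ℝ (Fin m)) p.2)).contMDiffOn_extend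
      (I := model m) (n := ∞) (IsManifold.subset_maximalAtlas he))
    fun q hq => (((chartAt ℝ p.1).prod (chartAt (EuclideanSpace ℝ (Fin m)) p.2)).extend
      (model m)).map_source (by rwa [OpenPartialHomeomorph.extend_source])
  refine (h1.congr fun q hq => ?_).contMDiffAt
    (((chartAt ℝ p.1).prod (chartAt (EuclideanSpace ℝ (Fin m)) p.2)).open_source.mem_nhds
      ⟨mem_chart_source _ _, mem_chart_source _ _⟩)
  set e := (chartAt ℝ p.1).prod (chartAt (EuclideanSpace ℝ (Fin m)) p.2) with he_def
  have hy : e.extend (model m) q ∈ (e.extend (model m)).target :=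
    (e.extend (model m)).map_source (by rwa [OpenPartialHomeomorph.extend_source])
  obtain ⟨ht, hx⟩ := (prod_mem_target (chart_mem_atlas ℝ p.1)).1 hy
  have h2 := velocity_eq_coordVec (chart_mem_atlas ℝ p.1)
    (chart_mem_atlas (EuclideanSpace ℝ (Fin m)) p.2) ht hx
  have h3 : (e.extend (model m)).symm (e.extend (model m) q) = q := e.extend_left_inv hq
  have h4 : ∀ q' : I × N, q' = q → (⟨q, velocity q⟩ : TangentBundle (model m) (I × N)) =
      ⟨q', velocity q'⟩ := by
    rintro _ rfl; rfl
  refine (h4 _ h3).trans ?_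
  simp only [Function.comp]
  exact congrArg (Bundle.TotalSpace.mk _) h2

theorem contMDiff_comp_time {f : ℝ → ℝ} (hf : ContDiffOn ℝ ∞ f I) :
    ContMDiff (model m) 𝓘(ℝ, ℝ) ∞ (fun p : I × N => f p.1) :=
  (contMDiffOn_iff_contDiffOn.2 hf).comp_contMDiff
    (contMDiff_subtype_val.comp contMDiff_fst) fun p => p.1.2

end GRW

end

noncomputable section

/-! ### Einstein fibres -/

open TopologicalSpace (Opens)
open scoped Matrix

namespace Coord

variable {ι : Type*} [Fintype ι] [DecidableEq ι] [Nonempty ι]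
  {E : Type*} [NormedAddCommGroup E] [NormedSpace ℝ E]

/-- If the Ricci tensor is a multiple of the metric, the factor is determined by the trace. -/
theorem tracefreeRicci_eq_zero_of_ricci_eq (b : Module.Basis ι ℝ E) {G : E → Matrix ι ι ℝ} {y : E}
    (hsymm : ∀ i j, G y i j = G y j i) (hdet : IsUnit (G y).det) {c : ℝ}
    (hc : ∀ i j, ricci b G i j y = c * G y i j) (i j : ι) : tracefreeRicci b G i j y = 0 := by
  have h1 : scalar b G y = c * Fintype.card ι := by
    have h2 : ∀ k, ∑ l, (G y)⁻¹ k l * ricci b G k l y = c := by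
      intro k
      have h3 : ((G y)⁻¹ * G y) k k = 1 := by
        rw [Matrix.nonsing_inv_mul _ hdet, Matrix.one_apply_eq]
      rw [Matrix.mul_apply] at h3
      calc ∑ l, (G y)⁻¹ k l * ricci b G k l y = c * ∑ l, (G y)⁻¹ k l * G y l k := by
            rw [Finset.mul_sum]
            exact Finset.sum_congr rfl fun l _ => by rw [hc, hsymm k l]; ring
        _ = c := by rw [h3, mul_one]
    simp only [scalar, h2, Finset.sum_const, Finset.card_univ, nsmul_eq_mul]
    ring
  have h4 : (Fintype.card ι : ℝ) ≠ 0 := by simp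
  rw [tracefreeRicci, h1, hc]
  field_simp
  ring

end Coord

namespace GRW

variable {m : ℕ} {I : Opens ℝ} {N : Type*} [TopologicalSpace N]
  [ChartedSpace (EuclideanSpace ℝ (Fin m)) N] [IsManifold (𝓡 m) ∞ N]
  (h : Bundle.ContMDiffRiemannianMetric (𝓡 m) ∞ (EuclideanSpace ℝ (Fin m))
    (fun x : N => TangentSpace (𝓡 m) x)) {a : ℝ → ℝ}

/-- The fibre `(N, h)` is an Einstein manifold: in each chart the trace-free part of its Ricci
tensor vanishes. -/
def FibreEinstein : Prop :=
  ∀ e₂ ∈ atlas (EuclideanSpace ℝ (Fin m)) N, ∀ x ∈ (e₂.extend (𝓡 m)).target, ∀ i j : Fin m,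
    Coord.tracefreeRicci (fibreBasis m) (fibreComp h e₂) i j x = 0

variable {h}

/-- The mixed Ricci components `R_{0i} = 0` force `B v_i = 0`, since `v_0 ≠ 0`; so `R_{ij}` is a
multiple of the metric. -/
theorem fibreEinstein_of_isPerfectFluid [NeZero m] (ha : ContDiffOn ℝ ∞ a I)
    (hpos : ∀ t ∈ I, 0 < a t)
    (hP : IsPerfectFluid (model m) (basis m) (metric (I := I) a h)) {t : ℝ} (ht : t ∈ I) :
    FibreEinstein h := by
  obtain ⟨A, B, v, -, -, -, hv, hR⟩ := hP
  intro e₂ he₂ x hx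
  have he₁ := chart_mem_atlas ℝ (⟨t, ht⟩ : I)
  set e₁ := chartAt ℝ (⟨t, ht⟩ : I)
  have hW := isWarped_metricComp h ha hpos he₁ he₂
  set p := ((e₁.prod e₂).extend (model m)).symm (t, x) with hp
  have hR' := hR _ ⟨e₁, he₁, e₂, he₂, rfl⟩ (t, x) ((prod_mem_target he₁).2 ⟨ht, hx⟩)
  have hv0 := covecComp_inl h ha hpos he₁ he₂ ht hx v
  have hdt := dt_ne_zero_of_metric_eq_neg_one h (hv p)
  have hGx := hW.eq t ht x hx
  have hmix : ∀ i, B p * covecComp (model m) (basis m) (metric (I := I) a h) v (e₁.prod e₂)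
      (.inr i) (t, x) = 0 := by
    intro i
    have h1 := hR' (.inl ()) (.inr i)
    rw [hW.ricci_inl_inr ht hx, hGx, hv0, Matrix.fromBlocks_apply₁₂, Matrix.zero_apply, mul_zero,
      zero_add] at h1
    have h2 : dt p (v p) * (B p * covecComp (model m) (basis m) (metric (I := I) a h) v
        (e₁.prod e₂) (.inr i) (t, x)) = 0 := by
      linear_combination h1
    exact (mul_eq_zero.1 h2).resolve_left hdt
  refine Coord.tracefreeRicci_eq_zero_of_ricci_eq (fibreBasis m)
    (Chart.metricComp_symm h _ x) (Chart.isUnit_det_metricComp h _ he₂ hx)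
    (c := A p * a t ^ 2 - (a t * deriv (deriv a) t + (m - 1) * deriv a t ^ 2)) fun i j => ?_
  have h1 := hR' (.inr i) (.inr j)
  rw [hW.ricci_inr_inr ht hx, hGx, Matrix.fromBlocks_apply₂₂, Matrix.smul_apply, smul_eq_mul] at h1
  have h2 := hmix i
  change Coord.ricci (fibreBasis m) (fibreComp h e₂) i j x = _ * fibreComp h e₂ x i j
  linear_combination h1 + covecComp (model m) (basis m) (metric (I := I) a h) v (e₁.prod e₂)
      (.inr j) (t, x) * h2

/-- The comoving velocity exhibits the perfect fluid; with `λ` the fibre's scalar curvature divided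
by its dimension, `A = (λ + (m - 1) a'² + a a'') / a²` and `B = A - m a'' / a`. The fibre has to be
Einstein only if there is a time at all: otherwise the space-time is empty. -/
theorem isPerfectFluid_of_fibreEinstein (ha : ContDiffOn ℝ ∞ a I) (hpos : ∀ t ∈ I, 0 < a t)
    (hE : I.1.Nonempty → FibreEinstein h) :
    IsPerfectFluid (model m) (basis m) (metric (I := I) a h) := by
  have ha1 : ContDiffOn ℝ ∞ (deriv a) I := ha.deriv_of_isOpen I.2 (by simp)
  have ha2 : ContDiffOn ℝ ∞ (deriv (deriv a)) I := ha1.deriv_of_isOpen I.2 (by simp)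
  have hne : ∀ p : I × N, a p.1 ≠ 0 := fun p => (hpos _ p.1.2).ne'
  have hinv : ContDiffOn ℝ ∞ (fun t => (a t)⁻¹) I := ha.inv fun t ht => (hpos t ht).ne'
  have hscal : ContMDiff (model m) 𝓘(ℝ, ℝ) ∞
      (fun p : I × N => Chart.scalarCurvature h (fibreBasis m) p.2) :=
    (Chart.contMDiff_scalarCurvature h (fibreBasis m)).comp contMDiff_snd
  have hA : ContMDiff (model m) 𝓘(ℝ, ℝ) ∞ (fun p : I × N =>
      (1 / (m : ℝ) * Chart.scalarCurvature h (fibreBasis m) p.2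
        + (((m : ℝ) - 1) * deriv a p.1 ^ 2 + a p.1 * deriv (deriv a) p.1)) * (a p.1)⁻¹ ^ 2) :=
    ((contMDiff_const.mul hscal).add (contMDiff_comp_time
      ((contDiffOn_const.mul (ha1.pow 2)).add (ha.mul ha2)))).mul
      (contMDiff_comp_time (hinv.pow 2))
  have hB := hA.sub (contMDiff_comp_time (N := N)
    ((contDiffOn_const (c := (m : ℝ))).mul (ha2.mul hinv)))
  refine ⟨_, _, velocity, hA, hB, contMDiff_velocity, metric_velocity a h, ?_⟩
  intro e he y hy
  obtain ⟨e₁, he₁, e₂, he₂, rfl⟩ := atlas_prod he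
  obtain ⟨t, x⟩ := y
  obtain ⟨ht, hx⟩ := (prod_mem_target he₁).1 hy
  have hW := isWarped_metricComp h ha hpos he₁ he₂
  have ha0 : a t ≠ 0 := (hpos t ht).ne'
  have hs := Chart.scalarCurvature_eq h (fibreBasis m) he₂
    (Chart.symm_mem_source (J := 𝓡 m) hx)
  rw [(e₂.extend (𝓡 m)).right_inv hx] at hs
  have hric : ∀ i j, Coord.ricci (fibreBasis m) (fibreComp h e₂) i j x =
      1 / (m : ℝ) * (Coord.scalar (fibreBasis m) (fibreComp h e₂) x * fibreComp h e₂ x i j) := by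
    intro i j
    have := hE ⟨t, ht⟩ e₂ he₂ x hx i j
    rw [Coord.tracefreeRicci, Fintype.card_fin] at this
    exact sub_eq_zero.1 this
  have hGx := hW.eq t ht x hx
  intro k l
  rw [covecComp_velocity h ha hpos he₁ he₂ ht hx, covecComp_velocity h ha hpos he₁ he₂ ht hx,
    prod_symm]
  simp only [interval_symm he₁ ht, hs]
  rcases k with ⟨⟩ | k <;> rcases l with ⟨⟩ | l
  · rw [hW.ricci_inl_inl ht hx, hGx]
    simp
    ring
  · rw [hW.ricci_inl_inr ht hx, hGx]
    simp
  · rw [hW.ricci_inr_inl ht hx, hGx]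
    simp
  · rw [hW.ricci_inr_inr ht hx, hGx, hric]
    simp only [Matrix.fromBlocks_apply₂₂, Matrix.smul_apply, smul_eq_mul, reduceCtorEq, if_false]
    field_simp
    ring

theorem fibreEinstein_of_contractedWeylZero (hm : 3 ≤ m) (ha : ContDiffOn ℝ ∞ a I)
    (hpos : ∀ t ∈ I, 0 < a t)
    (hC : ContractedWeylZero (model m) (basis m) (metric (I := I) a h) velocity) {t : ℝ}
    (ht : t ∈ I) : FibreEinstein h := by
  intro e₂ he₂ x hx i j
  have he₁ := chart_mem_atlas ℝ (⟨t, ht⟩ : I)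
  set e₁ := chartAt ℝ (⟨t, ht⟩ : I)
  have h1 := hC _ ⟨e₁, he₁, e₂, he₂, rfl⟩ (t, x) ((prod_mem_target he₁).2 ⟨ht, hx⟩)
    (.inr i) (.inr j)
  -- the velocity has components `(1, 0)`, so the contraction is the single component `C_{0ij0}`
  simp only [mul_assoc, ← Finset.mul_sum] at h1
  simp only [vecComp_velocity he₁ he₂ ht hx, ite_mul, one_mul, zero_mul, Finset.sum_ite_eq',
    Finset.mem_univ, if_true] at h1
  rw [(isWarped_metricComp h ha hpos he₁ he₂).weyl_electric hm ht hx] at h1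
  have h2 : (1 : ℝ) / ((m : ℝ) - 1) ≠ 0 := by
    have : (3 : ℝ) ≤ m := by exact_mod_cast hm
    exact one_div_ne_zero (by linarith)
  exact (mul_eq_zero.1 (neg_eq_zero.1 h1)).resolve_left h2

theorem weylContractZero_of_fibreEinstein (hm : 3 ≤ m) (ha : ContDiffOn ℝ ∞ a I)
    (hpos : ∀ t ∈ I, 0 < a t) (hE : I.1.Nonempty → FibreEinstein h) :
    WeylContractZero (model m) (basis m) (metric (I := I) a h) velocity := by
  intro e he y hy j k l
  obtain ⟨e₁, he₁, e₂, he₂, rfl⟩ := atlas_prod he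
  obtain ⟨t, x⟩ := y
  obtain ⟨ht, hx⟩ := (prod_mem_target he₁).1 hy
  simp only [vecComp_velocity he₁ he₂ ht hx, ite_mul, one_mul, zero_mul, Finset.sum_ite_eq',
    Finset.mem_univ, if_true]
  exact (isWarped_metricComp h ha hpos he₁ he₂).weyl_inl_eq_zero hm
    (fun x hx => hE ⟨t, ht⟩ e₂ he₂ x hx) ht hx j k l

theorem divWeylZero_of_fibreEinstein (hm : 3 ≤ m) (ha : ContDiffOn ℝ ∞ a I)
    (hpos : ∀ t ∈ I, 0 < a t) (hE : I.1.Nonempty → FibreEinstein h) :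
    DivWeylZero (model m) (basis m) (metric (I := I) a h) := by
  intro e he y hy j k l
  obtain ⟨e₁, he₁, e₂, he₂, rfl⟩ := atlas_prod he
  obtain ⟨t, x⟩ := y
  obtain ⟨ht, hx⟩ := (prod_mem_target he₁).1 hy
  exact (isWarped_metricComp h ha hpos he₁ he₂).divWeyl_eq_zero hm
    (fun x hx => hE ⟨t, ht⟩ e₂ he₂ x hx) ht hx j k l

/-- `∇^p C_{0ijp}` is a nonzero multiple of the trace-free Ricci tensor of the fibre at a time where
`a'` does not vanish. -/
theorem fibreEinstein_of_divWeylContractZero (hm : 3 ≤ m) (ha : ContDiffOn ℝ ∞ a I)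
    (hpos : ∀ t ∈ I, 0 < a t)
    (hD : DivWeylContractZero (model m) (basis m) (metric (I := I) a h) velocity) {t : ℝ}
    (ht : t ∈ I) (hat : deriv a t ≠ 0) : FibreEinstein h := by
  intro e₂ he₂ x hx i j
  have he₁ := chart_mem_atlas ℝ (⟨t, ht⟩ : I)
  set e₁ := chartAt ℝ (⟨t, ht⟩ : I)
  have h1 := hD _ ⟨e₁, he₁, e₂, he₂, rfl⟩ (t, x) ((prod_mem_target he₁).2 ⟨ht, hx⟩)
    (.inr i) (.inr j)
  simp only [vecComp_velocity he₁ he₂ ht hx, ite_mul, one_mul, zero_mul, Finset.sum_ite_eq',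
    Finset.mem_univ, if_true] at h1
  rw [(isWarped_metricComp h ha hpos he₁ he₂).divWeyl_inl_inr_inr hm ht hx] at h1
  have h3 : (3 : ℝ) ≤ m := by exact_mod_cast hm
  have h2 : (1 : ℝ) / ((m : ℝ) - 1) ≠ 0 := one_div_ne_zero (by linarith)
  have h4 : ((m : ℝ) - 2) * (deriv a t * (a t)⁻¹) ≠ 0 :=
    mul_ne_zero (by linarith) (mul_ne_zero hat (inv_ne_zero (hpos t ht).ne'))
  exact (mul_eq_zero.1 ((mul_eq_zero.1 h1).resolve_left h4)).resolve_left h2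

theorem divWeylContractZero_of_divWeylZero
    (hD : DivWeylZero (model m) (basis m) (metric (I := I) a h)) :
    DivWeylContractZero (model m) (basis m) (metric (I := I) a h) velocity :=
  fun e he y hy k l => Finset.sum_eq_zero fun j _ => by rw [hD e he y hy j k l, mul_zero]

theorem contractedWeylZero_of_weylContractZero
    (hC : WeylContractZero (model m) (basis m) (metric (I := I) a h) velocity) :
    ContractedWeylZero (model m) (basis m) (metric (I := I) a h) velocity := by
  intro e he y hy k l
  refine Finset.sum_eq_zero fun j _ => ?_
  simp only [mul_assoc, ← Finset.mul_sum]
  rw [hC e he y hy j k l, mul_zero]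

end GRW

theorem exists_deriv_ne_zero_of_ordConnected {s : Set ℝ} (hs : IsOpen s) (hc : s.OrdConnected)
    {f : ℝ → ℝ} (hf : DifferentiableOn ℝ f s) (hne : ∃ x ∈ s, ∃ y ∈ s, f x ≠ f y) :
    ∃ t ∈ s, deriv f t ≠ 0 := by
  obtain ⟨x, hx, y, hy, hxy⟩ := hne
  by_contra! hcon
  refine hxy (hc.convex.is_const_of_fderivWithin_eq_zero (𝕜 := ℝ) hf (fun t ht => ?_) hx hy)
  rw [fderivWithin_of_isOpen hs ht]
  ext
  simpa using hcon t ht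

end

theorem mainTheorem2 {m : ℕ} (hm : 3 ≤ m)
    (I : TopologicalSpace.Opens ℝ) (hI : (I : Set ℝ).OrdConnected)
    (a : ℝ → ℝ) (ha : ContDiffOn ℝ ∞ a I) (hpos : ∀ t ∈ I, 0 < a t)
    {N : Type*} [TopologicalSpace N] [ChartedSpace (EuclideanSpace ℝ (Fin m)) N]
    [IsManifold (𝓡 m) ∞ N]
    (h : Bundle.ContMDiffRiemannianMetric (𝓡 m) ∞ (EuclideanSpace ℝ (Fin m))
      (fun x : N => TangentSpace (𝓡 m) x)) :
    (IsPerfectFluid (GRW.model m) (GRW.basis m) (GRW.metric (I := I) a h) ↔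
      ContractedWeylZero (GRW.model m) (GRW.basis m) (GRW.metric (I := I) a h) GRW.velocity) ∧
    (IsPerfectFluid (GRW.model m) (GRW.basis m) (GRW.metric (I := I) a h) ↔
      WeylContractZero (GRW.model m) (GRW.basis m) (GRW.metric (I := I) a h) GRW.velocity) ∧
    (IsPerfectFluid (GRW.model m) (GRW.basis m) (GRW.metric (I := I) a h) →
      DivWeylZero (GRW.model m) (GRW.basis m) (GRW.metric (I := I) a h) ∧
      DivWeylContractZero (GRW.model m) (GRW.basis m) (GRW.metric (I := I) a h) GRW.velocity) ∧
    ((∃ s ∈ I, ∃ t ∈ I, a s ≠ a t) →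
      (IsPerfectFluid (GRW.model m) (GRW.basis m) (GRW.metric (I := I) a h) ↔
        DivWeylZero (GRW.model m) (GRW.basis m) (GRW.metric (I := I) a h)) ∧
      (IsPerfectFluid (GRW.model m) (GRW.basis m) (GRW.metric (I := I) a h) ↔
        DivWeylContractZero (GRW.model m) (GRW.basis m) (GRW.metric (I := I) a h)
          GRW.velocity)) := by
  have : NeZero m := ⟨by omega⟩
  have hfluid : (I.1.Nonempty → GRW.FibreEinstein h) →
      IsPerfectFluid (GRW.model m) (GRW.basis m) (GRW.metric (I := I) a h) :=
    GRW.isPerfectFluid_of_fibreEinstein ha hpos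
  have hEin : IsPerfectFluid (GRW.model m) (GRW.basis m) (GRW.metric (I := I) a h) →
      I.1.Nonempty → GRW.FibreEinstein h :=
    fun hP ⟨_, ht⟩ => GRW.fibreEinstein_of_isPerfectFluid ha hpos hP ht
  have hC : ContractedWeylZero (GRW.model m) (GRW.basis m) (GRW.metric (I := I) a h)
      GRW.velocity → I.1.Nonempty → GRW.FibreEinstein h :=
    fun hC ⟨_, ht⟩ => GRW.fibreEinstein_of_contractedWeylZero hm ha hpos hC ht
  have hW := fun hP => GRW.weylContractZero_of_fibreEinstein hm ha hpos (hEin hP)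
  have hD := fun hP => GRW.divWeylZero_of_fibreEinstein hm ha hpos (hEin hP)
  refine ⟨⟨fun hP => GRW.contractedWeylZero_of_weylContractZero (hW hP), fun h0 => hfluid (hC h0)⟩,
    ⟨hW, fun h0 => hfluid (hC (GRW.contractedWeylZero_of_weylContractZero h0))⟩,
    fun hP => ⟨hD hP, GRW.divWeylContractZero_of_divWeylZero (hD hP)⟩, fun hne => ?_⟩
  obtain ⟨t, ht, hat⟩ :=
    exists_deriv_ne_zero_of_ordConnected I.2 hI (ha.differentiableOn (by simp)) hne
  have hback : DivWeylContractZero (GRW.model m) (GRW.basis m) (GRW.metric (I := I) a h)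
      GRW.velocity → IsPerfectFluid (GRW.model m) (GRW.basis m) (GRW.metric (I := I) a h) :=
    fun h0 => hfluid fun _ => GRW.fibreEinstein_of_divWeylContractZero hm ha hpos h0 ht hat
  exact ⟨⟨hD, fun h0 => hback (GRW.divWeylContractZero_of_divWeylZero h0)⟩,
    ⟨fun hP => GRW.divWeylContractZero_of_divWeylZero (hD hP), hback⟩⟩
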